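/- For every $r\in\mathbb N$ let $d=d_r\ge 1$ be an integer and, on some probability space, let $(\xi_{k\ell})_{1\le k<\ell\le r}$ be i.i.d. copies of a $0/1$ random variable $\xi_r$ with $\mathbb P(\xi_r=1)=p_r$, and let $(\mathbf v^{k\ell})_{1\le k<\ell\le r}$ be mutually independent random vectors in $\mathbb R^{d}$ (not necessarily identically distributed), independent of $(\xi_{k\ell})_{k<\ell}$, such that: (a) they are normalized and isotropic: $\mathbb E\,\mathbf v^{k\ell}\mathbf v^{k\ell\,T}=d^{-1}I_d$; (b) their norms are uniformly bounded: there is a constant $C$ with $\|\mathbf v^{k\ell}\|_2\le C$ almost surely for all $r$ and all $k<\ell\le r$; (c) their quadratic forms concentrate: for every sequence of deterministic real $d_r\times d_r$ matrices $D_r$ with operator norm $\|D_r\|_{op}=1$, $\ \max_{k<\ell\le r}\mathbf{Var}\big(\langle D_r\mathbf v^{k\ell},\mathbf v^{k\ell}\rangle\big)\to 0$ as $r\to\infty$. Let $\mathcal A=\mathcal A_r$ be the symmetric $rd\times rd$ block matrix with $d\times d$ blocks whose diagonal blocks are $0$ and whose blocks in positions $(k,\ell)$ and $(\ell,k)$,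 $k<\ell$, are both equal to $\xi_{k\ell}\,\mathbf v^{k\ell}\mathbf v^{k\ell\,T}$. Let $N_{\mathcal A_r}=\frac1{rd}\sum_{i}\delta_{\lambda_i}$ be its empirical spectral distribution, where $(\lambda_i)_{i\le rd}$ are its eigenvalues counted with multiplicity. Suppose that, as $r\to\infty$, $d_r\to\infty$ and $r p_r/d_r\to c$ for some $c\ge 0$. Then there is a non-random probability measure $N$ on $\mathbb R$ such that $N_{\mathcal A_r}$ converges weakly in probability to $N$, that is, $\int\varphi\,dN_{\mathcal A_r}\to\int\varphi\,dN$ in probability for every bounded continuous $\varphi:\mathbb R\to\mathbb R$. Moreover, the Stieltjes transform $f(z)=\int_{\mathbb R}\frac{N(d\lambda)}{\lambda-z}$ satisfies $$ z f(z)^3+(1-c)f(z)^2-z f(z)-1=0\qquad\text{for all } z\in\mathbb C\setminus\mathbb R, $$ and $f$ is the only solution of this equation on $\mathbb C\setminus\mathbb R$ in the class of Stieltjes transforms of non-negative Borel measures on $\mathbb R$ (measures $\mu$ with $\int(1+|\lambda|)^{-1}\mu(d\lambda)<\infty$, so that the transform is defined). -/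

import Mathlib

open MeasureTheory ProbabilityTheory Filter Topology
open scoped ENNReal BoundedContinuousFunction

noncomputable section

/-- The pairs `(k, l)` with `k < l` of block indices. -/
abbrev BlockPair (r : ℕ) : Type := {q : Fin r × Fin r // q.1 < q.2}

/-- The `(k, l)` block: `x_{kl} w^{kl} (w^{kl})ᵀ` for `k < l`, extended symmetrically to `l < k`,
and zero on the diagonal. -/
def adjBlock {r d : ℕ} (x : BlockPair r → ℝ) (w : BlockPair r → EuclideanSpace ℝ (Fin d))
    (k l : Fin r) : Matrix (Fin d) (Fin d) ℝ :=
  if h : k < l then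
    Matrix.of fun i j => x ⟨(k, l), h⟩ * w ⟨(k, l), h⟩ i * w ⟨(k, l), h⟩ j
  else if h : l < k then
    Matrix.of fun i j => x ⟨(l, k), h⟩ * w ⟨(l, k), h⟩ i * w ⟨(l, k), h⟩ j
  else 0

/-- The `rd × rd` block adjacency matrix with the `d × d` blocks `adjBlock x w k l`. -/
def blockAdj {r d : ℕ} (x : BlockPair r → ℝ) (w : BlockPair r → EuclideanSpace ℝ (Fin d)) :
    Matrix (Fin r × Fin d) (Fin r × Fin d) ℝ :=
  Matrix.of fun a b => adjBlock x w a.1 b.1 a.2 b.2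

theorem blockAdj_isHermitian {r d : ℕ} (x : BlockPair r → ℝ)
    (w : BlockPair r → EuclideanSpace ℝ (Fin d)) : (blockAdj x w).IsHermitian := by
  ext ⟨k, i⟩ ⟨l, j⟩
  rcases lt_trichotomy k l with h | h | h
  · simp [blockAdj, adjBlock, h, h.not_gt]; ring
  · subst h; simp [blockAdj, adjBlock]
  · simp [blockAdj, adjBlock, h, h.not_gt]; ring

/-- The empirical spectral distribution of a real symmetric matrix:
the mass `1 / n` at each of its `n` eigenvalues, counted with multiplicity. -/
def empiricalSpectral {n : Type*} [Fintype n] [DecidableEq n] {M : Matrix n n ℝ}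
    (hM : M.IsHermitian) : Measure ℝ :=
  (Fintype.card n : ℝ≥0∞)⁻¹ • ∑ i, Measure.dirac (hM.eigenvalues i)

/-- The Stieltjes transform `z ↦ ∫ μ(dx) / (x - z)`. -/
def stieltjes (μ : Measure ℝ) (z : ℂ) : ℂ := ∫ x : ℝ, ((x : ℂ) - z)⁻¹ ∂μ

/-- `f` is, off the real line, the Stieltjes transform of a non-negative measure on the line
(any measure for which the defining integral converges absolutely; in particular any
finite measure). -/
def IsStieltjesOfMeasure (f : ℂ → ℂ) : Prop :=
  ∃ μ : Measure ℝ, ∀ z : ℂ, z.im ≠ 0 →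
    Integrable (fun x : ℝ => ((x : ℂ) - z)⁻¹) μ ∧ f z = stieltjes μ z

/-- The random measures `ν r` (each on its own probability space) converge weakly, in
probability, to the non-random measure `N`. -/
def WeakTendstoInProb {Ω : ℕ → Type*} [∀ r, MeasurableSpace (Ω r)] (P : ∀ r, Measure (Ω r))
    (ν : ∀ r, Ω r → Measure ℝ) (N : Measure ℝ) : Prop :=
  ∀ φ : ℝ →ᵇ ℝ, ∀ ε : ℝ, 0 < ε →
    Tendsto (fun r => P r {ω | ε ≤ |∫ x, φ x ∂(ν r ω) - ∫ x, φ x ∂N|}) atTop (𝓝 0)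

/-- Concentration of quadratic forms: for every sequence of deterministic matrices `D r` of
operator norm one, the variance of `(D r y, y)` tends to zero, uniformly over the vectors `y`
of the `r`-th family. -/
def ConcentratedForms {Ω : ℕ → Type*} [∀ r, MeasurableSpace (Ω r)] (P : ∀ r, Measure (Ω r))
    {ι : ℕ → Type*} {d : ℕ → ℕ} (y : ∀ r, ι r → Ω r → EuclideanSpace ℝ (Fin (d r))) : Prop :=
  ∀ D : ∀ r, Matrix (Fin (d r)) (Fin (d r)) ℝ,
    (∀ r, ‖Matrix.toEuclideanCLM (n := Fin (d r)) (𝕜 := ℝ) (D r)‖ = 1) →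
    ∀ ε : ℝ, 0 < ε → ∀ᶠ r in atTop, ∀ a : ι r,
      variance (fun ω => inner ℝ (Matrix.toEuclideanCLM (n := Fin (d r)) (𝕜 := ℝ) (D r) (y r a ω))
        (y r a ω)) (P r) ≤ ε

end

/-! Let G = (A - z)⁻¹, let γ_k be the mean of the trace of the k-th diagonal block of G divided by
d, put κ = rp/d, and for an edge (k, l) let α, β be the vector v^{kl} placed in block k and in block
l. The identity zG = AG - 1, traced over block k, expresses z times the normalised trace as -1 plus
d⁻¹ times the sum over l of ξ_{kl}⟨α, Gβ⟩. Deleting the edge changes A by ξ(αβᵀ + βαᵀ), so for ξ = 1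
the number ⟨α, Gβ⟩ is an explicit rational function of the forms ⟨α, G⁰α⟩, ⟨α, G⁰β⟩, ⟨β, G⁰β⟩ of the
resolvent G⁰ without that edge (`norm_form_add_edgeFun_le`).

As G⁰ is independent of v^{kl}, isotropy and concentration replace these forms by normalised block
traces of G⁰ (`IsEdgeLaw.integral_sq_removedForm_sub_le`). Restoring the edge costs O(1/d).
Efron–Stein (`integral_sq_sub_integral_le_sum`) replaces diagonal block traces by their means, on
average over k, and a Hilbert–Schmidt bound makes off-diagonal block traces small, on average over
(k, l). Hence zγ_k + 1 + (κ/r) Σ_l γ_kγ_l/(1 - γ_kγ_l) ≈ 0.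

The vectors need not be identically distributed, so the γ_k may differ. For large Im z the system is
contractive, the γ_k nearly agree, and their mean m satisfies zm + 1 + κm²/(1 - m²) ≈ 0
(`norm_mean_equation_le`); multiplying by m² - 1 gives the cubic. This yields
`IsEdgeLaw.integral_norm_limitCubic_le`.

Large Im z is enough. A bounded second moment gives tightness. The transform of any limit point
solves the cubic on a set with an accumulation point in the upper half plane, hence everywhere off
the real line. By `limitCubic_root_unique` the cubic has at most one root with positive imaginary
part, so by Stieltjes inversion the limit point is unique, and compactness gives convergence in
probability (`exists_weak_limit_of_limitCubic`). -/

/-! ### Uniqueness of the root of the cubic in the upper half plane. -/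

/-- The cubic whose root is the limiting Stieltjes transform. -/
def limitCubic (c : ℝ) (z w : ℂ) : ℂ := z * w ^ 3 + (1 - (c : ℂ)) * w ^ 2 - z * w - 1

theorem limitCubic_conj (c : ℝ) (z w : ℂ) :
    limitCubic c ((starRingEnd ℂ) z) ((starRingEnd ℂ) w) = (starRingEnd ℂ) (limitCubic c z w) := by
  simp [limitCubic]

/-- The cubic says z = -1/w + cw/(w² - 1), whose imaginary part is Im w times 1/|w|² - c(1 +
|w|²)/|w² - 1|². Positivity of Im z makes this bracket positive. -/
theorem normSq_root_lt {c : ℝ} {z w : ℂ} (hz : 0 < z.im) (hw : 0 < w.im)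
    (h : limitCubic c z w = 0) :
    c * (1 + Complex.normSq w) * Complex.normSq w < Complex.normSq (w ^ 2 - 1) := by
  have hw0 : 0 < Complex.normSq w := Complex.normSq_pos.2 (by rintro rfl; simp at hw)
  have hw1 : 0 < Complex.normSq (w ^ 2 - 1) := by
    refine Complex.normSq_pos.2 fun h1 => ?_
    have h2 : (w - 1) * (w + 1) = 0 := by linear_combination h1
    rcases mul_eq_zero.1 h2 with h3 | h3
    · have := congrArg Complex.im h3; simp at this; linarith
    · have := congrArg Complex.im h3; simp at this; linarith
  have key : z * (Complex.normSq w : ℂ) * (Complex.normSq (w ^ 2 - 1) : ℂ) =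
      -(starRingEnd ℂ) w * (Complex.normSq (w ^ 2 - 1) : ℂ)
        + c * ((Complex.normSq w : ℂ) * ((Complex.normSq w : ℂ) * (starRingEnd ℂ) w - w)) := by
    rw [Complex.normSq_eq_conj_mul_self, Complex.normSq_eq_conj_mul_self]
    simp only [map_sub, map_pow, map_one]
    unfold limitCubic at h
    linear_combination ((starRingEnd ℂ) w * ((starRingEnd ℂ) w ^ 2 - 1)) * h
  have him := congrArg Complex.im key
  have e1 : (z * (Complex.normSq w : ℂ) * (Complex.normSq (w ^ 2 - 1) : ℂ)).im =
      z.im * Complex.normSq w * Complex.normSq (w ^ 2 - 1) := by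
    rw [Complex.im_mul_ofReal, Complex.im_mul_ofReal]
  have e2 : (-(starRingEnd ℂ) w * (Complex.normSq (w ^ 2 - 1) : ℂ)
        + c * ((Complex.normSq w : ℂ) * ((Complex.normSq w : ℂ) * (starRingEnd ℂ) w - w))).im =
      w.im * Complex.normSq (w ^ 2 - 1)
        - c * Complex.normSq w * (1 + Complex.normSq w) * w.im := by
    rw [Complex.add_im, Complex.im_mul_ofReal, Complex.im_ofReal_mul, Complex.im_ofReal_mul,
      Complex.sub_im, Complex.im_ofReal_mul]
    simp
    ring
  rw [e1, e2] at him
  have : 0 < w.im * (Complex.normSq (w ^ 2 - 1) - c * (1 + Complex.normSq w) * Complex.normSq w) := by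
    have : 0 < z.im * Complex.normSq w * Complex.normSq (w ^ 2 - 1) := by positivity
    nlinarith
  have := (mul_pos_iff_of_pos_left hw).1 this
  linarith

/-- Two distinct roots for the same z satisfy (f² - 1)(g² - 1) = c fg(fg + 1). The product of the
two strict bounds from `normSq_root_lt` contradicts this, because |fg + 1|² ≤ (1 + |f|²)(1 + |g|²)
by Cauchy–Schwarz. -/
theorem limitCubic_root_unique {c : ℝ} (hc : 0 ≤ c) {z f g : ℂ} (hz : 0 < z.im) (hf : 0 < f.im)
    (hg : 0 < g.im) (h1 : limitCubic c z f = 0) (h2 : limitCubic c z g = 0) : f = g := by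
  by_contra hne
  have l1 := normSq_root_lt hz hf h1
  have l2 := normSq_root_lt hz hg h2
  -- The combination of the two equations that eliminates z.
  have hzero : (f - g) * ((f ^ 2 - 1) * (g ^ 2 - 1) - c * (f * g * (f * g + 1))) = 0 := by
    unfold limitCubic at h1 h2
    linear_combination (f * (f ^ 2 - 1)) * h2 - (g * (g ^ 2 - 1)) * h1
  have h3 : (f ^ 2 - 1) * (g ^ 2 - 1) = c * (f * g * (f * g + 1)) :=
    sub_eq_zero.1 ((mul_eq_zero.1 hzero).resolve_left (sub_ne_zero.2 hne))
  have h4 := congrArg Complex.normSq h3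
  simp only [map_mul, Complex.normSq_ofReal] at h4
  have h5 : Complex.normSq (f * g + 1) ≤ (1 + Complex.normSq f) * (1 + Complex.normSq g) := by
    simp only [Complex.normSq_eq_norm_sq]
    have : ‖f * g + 1‖ ≤ ‖f‖ * ‖g‖ + 1 := by
      simpa using norm_add_le (f * g) 1
    have h0 := norm_nonneg (f * g + 1)
    nlinarith [sq_nonneg (‖f‖ - ‖g‖), norm_nonneg f, norm_nonneg g]
  have nf := Complex.normSq_nonneg f
  have ng := Complex.normSq_nonneg g
  have h6 := mul_lt_mul'' l1 l2 (by positivity) (by positivity)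
  have h7 : c * c * (Complex.normSq f * Complex.normSq g * Complex.normSq (f * g + 1)) ≤
      c * c * (Complex.normSq f * Complex.normSq g * ((1 + Complex.normSq f) * (1 + Complex.normSq g))) := by
    gcongr
  nlinarith

/-! ### Stieltjes transforms: symmetry, positivity, holomorphy. -/

theorem stieltjes_conj (μ : Measure ℝ) (z : ℂ) :
    stieltjes μ ((starRingEnd ℂ) z) = (starRingEnd ℂ) (stieltjes μ z) := by
  unfold stieltjes
  rw [← integral_conj]
  simp

theorem im_inv_ofReal_sub (x : ℝ) (z : ℂ) :
    (((x : ℂ) - z)⁻¹).im = z.im / Complex.normSq ((x : ℂ) - z) := by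
  simp [Complex.inv_im]

theorem stieltjes_im (μ : Measure ℝ) {z : ℂ} (h : Integrable (fun x : ℝ => ((x : ℂ) - z)⁻¹) μ) :
    (stieltjes μ z).im = ∫ x : ℝ, z.im / Complex.normSq ((x : ℂ) - z) ∂μ := by
  unfold stieltjes
  have := Complex.imCLM.integral_comp_comm h
  simp only [Complex.imCLM_apply, im_inv_ofReal_sub] at this
  exact this.symm

theorem ofReal_sub_ne_zero {z : ℂ} (hz : z.im ≠ 0) (x : ℝ) : (x : ℂ) - z ≠ 0 := by
  intro h
  have := congrArg Complex.im h
  simp at this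
  exact hz this

theorem stieltjes_im_pos {μ : Measure ℝ} (hμ : μ ≠ 0) {z : ℂ} (hz : 0 < z.im)
    (h : Integrable (fun x : ℝ => ((x : ℂ) - z)⁻¹) μ) : 0 < (stieltjes μ z).im := by
  rw [stieltjes_im μ h]
  have hpos : ∀ x : ℝ, 0 < z.im / Complex.normSq ((x : ℂ) - z) := fun x =>
    div_pos hz (Complex.normSq_pos.2 (ofReal_sub_ne_zero hz.ne' x))
  rw [integral_pos_iff_support_of_nonneg (fun x => (hpos x).le)]
  · have : Function.support (fun x : ℝ => z.im / Complex.normSq ((x : ℂ) - z)) = Set.univ := by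
      ext x; simpa using (hpos x).ne'
    rw [this]
    exact Measure.measure_univ_pos.2 hμ
  · have := h.im
    simpa [im_inv_ofReal_sub] using this

theorem continuous_inv_ofReal_sub {z : ℂ} (hz : z.im ≠ 0) :
    Continuous (fun x : ℝ => ((x : ℂ) - z)⁻¹) :=
  Continuous.inv₀ (by fun_prop) (ofReal_sub_ne_zero hz)

theorem norm_inv_ofReal_sub_le {z : ℂ} (hz : z.im ≠ 0) (x : ℝ) :
    ‖((x : ℂ) - z)⁻¹‖ ≤ |z.im|⁻¹ := by
  rw [norm_inv]
  refine inv_anti₀ (abs_pos.2 hz) ?_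
  simpa using Complex.abs_im_le_norm ((x : ℂ) - z)

/-- The function `x ↦ 1 / (x - z)` as a bounded continuous function. -/
noncomputable def invSubBCF (z : ℂ) (hz : z.im ≠ 0) : ℝ →ᵇ ℂ :=
  BoundedContinuousFunction.ofNormedAddCommGroup _ (continuous_inv_ofReal_sub hz) |z.im|⁻¹
    (norm_inv_ofReal_sub_le hz)

theorem integrable_inv_ofReal_sub (μ : Measure ℝ) [IsFiniteMeasure μ] {z : ℂ} (hz : z.im ≠ 0) :
    Integrable (fun x : ℝ => ((x : ℂ) - z)⁻¹) μ :=
  (invSubBCF z hz).integrable μ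

theorem stieltjes_eq_resolventTransform (μ : Measure ℝ) (z : ℂ) :
    stieltjes μ z = resolventTransform μ z := by
  simp [stieltjes, resolventTransform_apply, resolvent, Ring.inverse_eq_inv']

theorem differentiableAt_stieltjes (μ : Measure ℝ) [IsFiniteMeasure μ] {z : ℂ} (hz : z.im ≠ 0) :
    DifferentiableAt ℂ (stieltjes μ) z := by
  have : stieltjes μ = resolventTransform μ := funext (stieltjes_eq_resolventTransform μ)
  rw [this]
  refine (hasDerivAt_resolventTransform z ?_).differentiableAt
  rintro ⟨x, -, rfl⟩
  simp at hz

theorem isPreconnected_upperHalfPlane : IsPreconnected {z : ℂ | 0 < z.im} :=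
  (convex_halfSpace_im_gt 0).isPreconnected

/-- The identity theorem in the upper half plane, followed by conjugation for the lower one. -/
theorem limitCubic_stieltjes_eq_zero (c : ℝ) (μ : Measure ℝ) [IsFiniteMeasure μ] {u : ℕ → ℂ} {w : ℂ}
    (hw : 0 < w.im) (hu : Tendsto u atTop (𝓝[≠] w))
    (h : ∀ n, limitCubic c (u n) (stieltjes μ (u n)) = 0) {z : ℂ} (hz : z.im ≠ 0) :
    limitCubic c z (stieltjes μ z) = 0 := by
  have hopen : IsOpen {z : ℂ | 0 < z.im} := isOpen_lt continuous_const Complex.continuous_im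
  have hdiff : DifferentiableOn ℂ (fun z => limitCubic c z (stieltjes μ z)) {z : ℂ | 0 < z.im} := by
    intro z hz
    have := differentiableAt_stieltjes μ (ne_of_gt hz)
    unfold limitCubic
    exact DifferentiableAt.differentiableWithinAt (by fun_prop)
  have hup : ∀ z : ℂ, 0 < z.im → limitCubic c z (stieltjes μ z) = 0 := by
    intro z hz
    refine (hdiff.analyticOnNhd hopen).eqOn_zero_of_preconnected_of_frequently_eq_zero
      isPreconnected_upperHalfPlane (z₀ := w) hw ?_ hz
    exact hu.frequently (Frequently.of_forall h)
  rcases lt_or_gt_of_ne hz with h' | h'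
  · have := hup ((starRingEnd ℂ) z) (by simpa using h')
    rw [stieltjes_conj, limitCubic_conj] at this
    simpa using this
  · exact hup z h'

/-! ### Stieltjes inversion by Poisson smoothing. -/

/-- The substitution t = x + yu moves the height y from the Poisson kernel into the argument of φ,
where the limit y → 0 is one of dominated convergence. -/
theorem integral_comp_affine_cauchy (φ : ℝ → ℝ) (x : ℝ) {y : ℝ} (hy : 0 < y) :
    ∫ t : ℝ, φ t * (y / ((x - t) ^ 2 + y ^ 2)) = ∫ u : ℝ, φ (x + y * u) * (1 + u ^ 2)⁻¹ := by
  have h1 : ∫ u : ℝ, φ (x + y * u) * (1 + u ^ 2)⁻¹ =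
      ∫ u : ℝ, (fun t : ℝ => φ (x + t) * (y * (y / (t ^ 2 + y ^ 2)))) (y * u) := by
    refine integral_congr_ae (Eventually.of_forall fun u => ?_)
    have : (1 + u ^ 2) ≠ 0 := by positivity
    have : ((y * u) ^ 2 + y ^ 2) ≠ 0 := by positivity
    simp only
    congr 1
    field_simp
    ring
  rw [h1, Measure.integral_comp_mul_left (fun t : ℝ => φ (x + t) * (y * (y / (t ^ 2 + y ^ 2)))),
    ← integral_smul, ← integral_add_left_eq_self _ x]
  refine integral_congr_ae (Eventually.of_forall fun t => ?_)
  have : (t ^ 2 + y ^ 2) ≠ 0 := by positivity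
  simp only [abs_of_pos (inv_pos.2 hy), smul_eq_mul, sub_add_cancel_left, neg_sq]
  field_simp

theorem integrable_cauchy_kernel (x : ℝ) {y : ℝ} (hy : 0 < y) :
    Integrable (fun t : ℝ => y / ((x - t) ^ 2 + y ^ 2)) := by
  have h := ((integrable_inv_one_add_sq.comp_div hy.ne').comp_sub_left x).const_mul y⁻¹
  refine h.congr (Eventually.of_forall fun t => ?_)
  have : ((x - t) ^ 2 + y ^ 2) ≠ 0 := by positivity
  have : (1 + ((x - t) / y) ^ 2) ≠ 0 := by positivity
  simp only
  field_simp
  ring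

theorem integral_cauchy_kernel (x : ℝ) {y : ℝ} (hy : 0 < y) :
    ∫ t : ℝ, y / ((x - t) ^ 2 + y ^ 2) = Real.pi := by
  have := integral_comp_affine_cauchy (fun _ => 1) x hy
  simpa only [one_mul, integral_univ_inv_one_add_sq] using this

theorem integrable_cauchy_kernel_prod (μ : Measure ℝ) [IsFiniteMeasure μ] (φ : ℝ →ᵇ ℝ) {y : ℝ}
    (hy : 0 < y) :
    Integrable (Function.uncurry fun x t : ℝ => φ t * (y / ((x - t) ^ 2 + y ^ 2)))
      (μ.prod volume) := by
  have hcont : Continuous (Function.uncurry fun x t : ℝ => φ t * (y / ((x - t) ^ 2 + y ^ 2))) := by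
    unfold Function.uncurry
    refine Continuous.mul (by fun_prop) (Continuous.div (by fun_prop) (by fun_prop) fun q => ?_)
    positivity
  have hint : ∀ x : ℝ, Integrable (fun t : ℝ => φ t * (y / ((x - t) ^ 2 + y ^ 2))) := fun x =>
    (integrable_cauchy_kernel x hy).bdd_mul (c := ‖φ‖) φ.continuous.aestronglyMeasurable
      (Eventually.of_forall φ.norm_coe_le_norm)
  rw [integrable_prod_iff hcont.aestronglyMeasurable]
  refine ⟨Eventually.of_forall hint, ?_⟩
  refine Integrable.of_bound (hcont.aestronglyMeasurable.norm.integral_prod_right')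
    (‖φ‖ * Real.pi) (Eventually.of_forall fun x => ?_)
  rw [Real.norm_of_nonneg (by positivity), ← integral_cauchy_kernel x hy, ← integral_const_mul]
  refine integral_mono (hint x).norm ((integrable_cauchy_kernel x hy).const_mul _) fun t => ?_
  simp only [Function.uncurry_apply_pair, norm_mul]
  have : 0 ≤ y / ((x - t) ^ 2 + y ^ 2) := by positivity
  rw [Real.norm_of_nonneg this]
  exact mul_le_mul_of_nonneg_right (φ.norm_coe_le_norm t) this

/-- The imaginary part of the transform is the Poisson integral of μ; Fubini transfers the smoothing
from μ to φ. -/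
theorem integral_mul_stieltjes_im (μ : Measure ℝ) [IsFiniteMeasure μ] (φ : ℝ →ᵇ ℝ) {y : ℝ}
    (hy : 0 < y) :
    ∫ t : ℝ, φ t * (stieltjes μ ⟨t, y⟩).im = ∫ x, (∫ u : ℝ, φ (x + y * u) * (1 + u ^ 2)⁻¹) ∂μ := by
  have h1 : ∀ t : ℝ, φ t * (stieltjes μ ⟨t, y⟩).im
      = ∫ x, φ t * (y / ((x - t) ^ 2 + y ^ 2)) ∂μ := by
    intro t
    rw [stieltjes_im μ (integrable_inv_ofReal_sub μ (by simpa using hy.ne')), ← integral_const_mul]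
    refine integral_congr_ae (Eventually.of_forall fun x => ?_)
    simp [Complex.normSq_apply, sq]
  simp_rw [h1]
  rw [← integral_integral_swap (integrable_cauchy_kernel_prod μ φ hy)]
  simp_rw [integral_comp_affine_cauchy φ _ hy]

theorem tendsto_integral_cauchy_smoothing (μ : Measure ℝ) [IsFiniteMeasure μ] (φ : ℝ →ᵇ ℝ) :
    Tendsto (fun n : ℕ => ∫ x, (∫ u : ℝ, φ (x + ((n : ℝ) + 1)⁻¹ * u) * (1 + u ^ 2)⁻¹) ∂μ) atTop
      (𝓝 ((∫ x, φ x ∂μ) * Real.pi)) := by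
  have hlim : Tendsto (fun n : ℕ => ((n : ℝ) + 1)⁻¹) atTop (𝓝 0) := by
    simpa using tendsto_one_div_add_atTop_nhds_zero_nat (𝕜 := ℝ)
  have hcont : ∀ y : ℝ, Continuous (fun q : ℝ × ℝ => φ (q.1 + y * q.2) * (1 + q.2 ^ 2)⁻¹) := by
    intro y
    refine Continuous.mul (by fun_prop) (Continuous.inv₀ (by fun_prop) fun q => ?_)
    positivity
  have hbd : ∀ y x u : ℝ, ‖φ (x + y * u) * (1 + u ^ 2)⁻¹‖ ≤ ‖φ‖ * (1 + u ^ 2)⁻¹ := by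
    intro y x u
    have h0 : (0 : ℝ) ≤ (1 + u ^ 2)⁻¹ := by positivity
    rw [norm_mul, Real.norm_of_nonneg h0]
    exact mul_le_mul_of_nonneg_right (φ.norm_coe_le_norm _) h0
  have hI : Integrable (fun u : ℝ => ‖φ‖ * (1 + u ^ 2)⁻¹) := integrable_inv_one_add_sq.const_mul _
  rw [← integral_mul_const]
  refine tendsto_integral_of_dominated_convergence (fun _ => ‖φ‖ * Real.pi) (fun n => ?_)
    (integrable_const _) (fun n => Eventually.of_forall fun x => ?_) (Eventually.of_forall fun x => ?_)
  · exact (hcont _).aestronglyMeasurable.integral_prod_right'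
  · rw [← integral_univ_inv_one_add_sq, ← integral_const_mul]
    exact norm_integral_le_of_norm_le hI (Eventually.of_forall (hbd _ x))
  · rw [← integral_univ_inv_one_add_sq, ← integral_const_mul]
    refine tendsto_integral_of_dominated_convergence (fun u => ‖φ‖ * (1 + u ^ 2)⁻¹) (fun n => ?_) hI
      (fun n => Eventually.of_forall (hbd _ x)) (Eventually.of_forall fun u => ?_)
    · exact ((hcont _).comp (by fun_prop : Continuous fun u : ℝ => (x, u))).aestronglyMeasurable
    · refine Tendsto.mul_const _ ?_
      refine (φ.continuous.tendsto x).comp ?_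
      simpa using (hlim.mul_const u).const_add x

/-- The imaginary parts at height y determine the smoothed integral of every bounded continuous φ;
letting y → 0 along 1/(n + 1) recovers π∫φ. -/
theorem eq_of_stieltjes_eq {μ ν : Measure ℝ} [IsFiniteMeasure μ] [IsFiniteMeasure ν]
    (h : ∀ z : ℂ, 0 < z.im → stieltjes μ z = stieltjes ν z) : μ = ν := by
  refine ext_of_forall_integral_eq_of_IsFiniteMeasure fun φ => ?_
  have h1 := tendsto_integral_cauchy_smoothing μ φ
  have h2 := tendsto_integral_cauchy_smoothing ν φ
  have h3 : ∀ n : ℕ, ∫ x, (∫ u : ℝ, φ (x + ((n : ℝ) + 1)⁻¹ * u) * (1 + u ^ 2)⁻¹) ∂μ =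
      ∫ x, (∫ u : ℝ, φ (x + ((n : ℝ) + 1)⁻¹ * u) * (1 + u ^ 2)⁻¹) ∂ν := by
    intro n
    have hy : (0 : ℝ) < ((n : ℝ) + 1)⁻¹ := by positivity
    rw [← integral_mul_stieltjes_im μ φ hy, ← integral_mul_stieltjes_im ν φ hy]
    simp_rw [fun t : ℝ => h ⟨t, ((n : ℝ) + 1)⁻¹⟩ hy]
  simp_rw [h3] at h1
  exact mul_right_cancel₀ Real.pi_ne_zero (tendsto_nhds_unique h1 h2)

/-! ### Tightness, limit points and convergence in probability. -/

/-- The tail of `μ` is at most `K / t` for `t = 1, 2, …`. -/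
def TailBound (K : NNReal) (μ : Measure ℝ) : Prop :=
  ∀ n : ℕ, μ (Metric.closedBall 0 ((n : ℝ) + 1))ᶜ ≤ ((K / ((n : NNReal) + 1) : NNReal) : ℝ≥0∞)

/-- Prokhorov's theorem; an ultrafilter finer than `atTop` plays the role of a convergent
subsequence. -/
theorem exists_ultrafilter_tendsto_of_tailBound {K : NNReal} {ν : ℕ → ProbabilityMeasure ℝ}
    (h : ∀ n, TailBound K (ν n)) :
    ∃ (N : ProbabilityMeasure ℝ) (U : Ultrafilter ℕ), (U : Filter ℕ) ≤ atTop ∧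
      Tendsto ν U (𝓝 N) := by
  have hu : Tendsto (fun n : ℕ => K / ((n : NNReal) + 1)) atTop (𝓝 0) := by
    have := (tendsto_one_div_add_atTop_nhds_zero_nat (𝕜 := NNReal)).const_mul K
    simpa [div_eq_mul_inv] using this
  have hcomp := isCompact_setOfPred_probabilityMeasure_mass_eq_compl_isCompact_le (E := ℝ) hu
    (K := fun n : ℕ => Metric.closedBall 0 ((n : ℝ) + 1)) (fun n => isCompact_closedBall _ _)
    (Or.inl inferInstance)
  let U : Ultrafilter ℕ := Ultrafilter.of atTop
  obtain ⟨N, -, hN⟩ := hcomp.ultrafilter_le_nhds (U.map ν) (by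
    rw [le_principal_iff, Ultrafilter.coe_map]
    refine Filter.mem_map.2 (Filter.univ_mem' fun n m => ?_)
    have := h n m
    rw [← ENNReal.coe_le_coe]
    simpa using this)
  exact ⟨N, U, Ultrafilter.of_le _, hN⟩

theorem tendsto_stieltjes {ι : Type*} {l : Filter ι} {ν : ι → ProbabilityMeasure ℝ}
    {N : ProbabilityMeasure ℝ} (h : Tendsto ν l (𝓝 N)) {z : ℂ} (hz : z.im ≠ 0) :
    Tendsto (fun n => stieltjes (ν n) z) l (𝓝 (stieltjes N z)) :=
  (ProbabilityMeasure.tendsto_iff_forall_integral_rclike_tendsto ℂ).1 h (invSubBCF z hz)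

theorem continuous_limitCubic (c : ℝ) (z : ℂ) : Continuous (limitCubic c z) := by
  unfold limitCubic; fun_prop

/-- Points of the upper half plane that accumulate at `(η + 1) i`. -/
noncomputable def testPoint (η : ℝ) (n : ℕ) : ℂ := ⟨0, η + 1 + 1 / ((n : ℝ) + 1)⟩

theorem tendsto_testPoint (η : ℝ) :
    Tendsto (testPoint η) atTop (𝓝[≠] (⟨0, η + 1⟩ : ℂ)) := by
  rw [tendsto_nhdsWithin_iff]
  constructor
  · have h : Tendsto (fun n : ℕ => (⟨0, η + 1⟩ : ℂ) + ((1 / ((n : ℝ) + 1) : ℝ) : ℂ) * Complex.I)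
        atTop (𝓝 ((⟨0, η + 1⟩ : ℂ) + ((0 : ℝ) : ℂ) * Complex.I)) := by
      refine Tendsto.const_add _ (Tendsto.mul_const _ ?_)
      exact (Complex.continuous_ofReal.tendsto 0).comp tendsto_one_div_add_atTop_nhds_zero_nat
    simp only [Complex.ofReal_zero, zero_mul, add_zero] at h
    have h2 : ∀ t : ℝ, (⟨0, η + 1⟩ : ℂ) + (t : ℂ) * Complex.I = ⟨0, η + 1 + t⟩ := by
      intro t
      apply Complex.ext <;> simp
    exact h.congr fun n => h2 _
  · refine Eventually.of_forall fun n hn => ?_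
    have := congrArg Complex.im (Set.mem_singleton_iff.1 hn)
    have h2 : (0 : ℝ) < 1 / ((n : ℝ) + 1) := by positivity
    simp only [testPoint] at this
    linarith

theorem lt_im_testPoint (η : ℝ) (n : ℕ) : η < (testPoint η n).im := by
  have h2 : (0 : ℝ) < 1 / ((n : ℝ) + 1) := by positivity
  simp only [testPoint]
  linarith

/-- At a fixed test point the bound 1/(n + 1) is available as soon as n ≥ i, so the cubic vanishes
there in the limit. The test points accumulate inside the half plane, so the identity theorem
applies. -/
theorem limitCubic_eq_zero_of_tendsto {c η : ℝ} (hη : 0 ≤ η) {ν : ℕ → ProbabilityMeasure ℝ}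
    {N : ProbabilityMeasure ℝ} {U : Ultrafilter ℕ} (hU : (U : Filter ℕ) ≤ atTop)
    (h : Tendsto ν U (𝓝 N))
    (hν : ∀ n, ∀ i ≤ n, ‖limitCubic c (testPoint η i) (stieltjes (ν n) (testPoint η i))‖
      ≤ 1 / ((n : ℝ) + 1)) {z : ℂ} (hz : z.im ≠ 0) : limitCubic c z (stieltjes N z) = 0 := by
  refine limitCubic_stieltjes_eq_zero c N (w := ⟨0, η + 1⟩) (by simp; linarith)
    (tendsto_testPoint η) (fun i => ?_) hz
  have hi : (testPoint η i).im ≠ 0 := (hη.trans_lt (lt_im_testPoint η i)).ne'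
  have h1 := ((continuous_limitCubic c (testPoint η i)).tendsto _).comp (tendsto_stieltjes h hi)
  have h2 : Tendsto (fun n : ℕ => 1 / ((n : ℝ) + 1)) U (𝓝 0) :=
    tendsto_one_div_add_atTop_nhds_zero_nat.mono_left hU
  refine tendsto_nhds_unique h1 (squeeze_zero_norm' ?_ h2)
  filter_upwards [hU (eventually_ge_atTop i)] with n hn using hν n i hn

theorem eq_of_limitCubic_stieltjes {c : ℝ} (hc : 0 ≤ c) {N N' : Measure ℝ}
    [IsProbabilityMeasure N] [IsProbabilityMeasure N']
    (h : ∀ z : ℂ, z.im ≠ 0 → limitCubic c z (stieltjes N z) = 0)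
    (h' : ∀ z : ℂ, z.im ≠ 0 → limitCubic c z (stieltjes N' z) = 0) : N = N' :=
  eq_of_stieltjes_eq fun z hz => limitCubic_root_unique hc hz
    (stieltjes_im_pos (IsProbabilityMeasure.ne_zero N) hz (integrable_inv_ofReal_sub N hz.ne'))
    (stieltjes_im_pos (IsProbabilityMeasure.ne_zero N') hz (integrable_inv_ofReal_sub N' hz.ne'))
    (h z hz.ne') (h' z hz.ne')

/-- The measure behind f may be infinite: only the sign of the imaginary part is used. The zero
measure is excluded because the cubic takes the value -1 at w = 0. -/
theorem eq_stieltjes_of_limitCubic {c : ℝ} (hc : 0 ≤ c) {N : Measure ℝ} [IsProbabilityMeasure N]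
    (h : ∀ z : ℂ, z.im ≠ 0 → limitCubic c z (stieltjes N z) = 0) {f : ℂ → ℂ}
    (hf : IsStieltjesOfMeasure f) (h' : ∀ z : ℂ, z.im ≠ 0 → limitCubic c z (f z) = 0) {z : ℂ}
    (hz : z.im ≠ 0) : f z = stieltjes N z := by
  obtain ⟨μ, hμ⟩ := hf
  have hμ0 : μ ≠ 0 := by
    rintro rfl
    have h1 := h' z hz
    rw [(hμ z hz).2] at h1
    simp [stieltjes, limitCubic] at h1
  have hup : ∀ z : ℂ, 0 < z.im → stieltjes μ z = stieltjes N z := fun z hz =>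
    limitCubic_root_unique hc hz (stieltjes_im_pos hμ0 hz (hμ z hz.ne').1)
      (stieltjes_im_pos (IsProbabilityMeasure.ne_zero N) hz (integrable_inv_ofReal_sub N hz.ne'))
      (by rw [← (hμ z hz.ne').2]; exact h' z hz.ne') (h z hz.ne')
  rw [(hμ z hz).2]
  rcases lt_or_gt_of_ne hz with hn | hp
  · have := hup ((starRingEnd ℂ) z) (by simpa using hn)
    rw [stieltjes_conj, stieltjes_conj] at this
    exact (starRingEnd ℂ).injective this
  · exact hup z hp

/-- Compactness, by contradiction: counterexamples for every n would have a limit point solving the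
cubic, hence equal to N, although its integral of φ stays at distance ε. Only finitely many
approximate equations are then needed, so a union bound can handle them. -/
theorem exists_limitCubic_tolerance {c η : ℝ} (hc : 0 ≤ c) (hη : 0 ≤ η) {N : Measure ℝ}
    [IsProbabilityMeasure N] (h : ∀ z : ℂ, z.im ≠ 0 → limitCubic c z (stieltjes N z) = 0)
    (K : NNReal) (φ : ℝ →ᵇ ℝ) {ε : ℝ} (hε : 0 < ε) :
    ∃ n : ℕ, ∀ μ : Measure ℝ, IsProbabilityMeasure μ → TailBound K μ →
      (∀ i ≤ n, ‖limitCubic c (testPoint η i) (stieltjes μ (testPoint η i))‖ < 1 / ((n : ℝ) + 1)) →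
      |∫ x, φ x ∂μ - ∫ x, φ x ∂N| < ε := by
  by_contra! hcon
  choose μ hμ htail hcub hbig using hcon
  let ν : ℕ → ProbabilityMeasure ℝ := fun n => ⟨μ n, hμ n⟩
  obtain ⟨N', U, hU, hlim⟩ := exists_ultrafilter_tendsto_of_tailBound (ν := ν) htail
  have hN' : ∀ z : ℂ, z.im ≠ 0 → limitCubic c z (stieltjes N' z) = 0 := fun z hz =>
    limitCubic_eq_zero_of_tendsto hη hU hlim (fun n i hi => (hcub n i hi).le) hz
  have heq : N = N' := eq_of_limitCubic_stieltjes hc h hN'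
  have h1 := ProbabilityMeasure.tendsto_iff_forall_integral_tendsto.1 hlim φ
  rw [← heq] at h1
  have h2 : Tendsto (fun n => |∫ x, φ x ∂(ν n : Measure ℝ) - ∫ x, φ x ∂N|) U (𝓝 0) := by
    have := (h1.sub_const (∫ x, φ x ∂N)).abs
    simpa using this
  obtain ⟨n, hn⟩ := (h2.eventually_lt_const hε).exists
  exact absurd hn (not_lt.2 (hbig n))

/-- No limit is given in advance: N is obtained as a limit point of suitable realisations of the
random measures, and `exists_limitCubic_tolerance` then compares all the others with it. -/
theorem exists_weak_limit_of_limitCubic {Ω : ℕ → Type*} [∀ r, MeasurableSpace (Ω r)]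
    (P : ∀ r, Measure (Ω r)) [∀ r, IsProbabilityMeasure (P r)] (ν : ∀ r, Ω r → Measure ℝ)
    {c η : ℝ} (hc : 0 ≤ c) (hη : 0 ≤ η)
    (hprob : ∀ᶠ r in atTop, ∀ ω, IsProbabilityMeasure (ν r ω))
    (htail : ∀ ε : ℝ≥0∞, 0 < ε → ∃ K : NNReal, ∀ᶠ r in atTop, P r {ω | ¬ TailBound K (ν r ω)} ≤ ε)
    (hcub : ∀ z : ℂ, η < z.im → ∀ δ : ℝ, 0 < δ →
      Tendsto (fun r => P r {ω | δ ≤ ‖limitCubic c z (stieltjes (ν r ω) z)‖}) atTop (𝓝 0)) :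
    ∃ N : Measure ℝ, IsProbabilityMeasure N ∧ WeakTendstoInProb P ν N ∧
      ∀ z : ℂ, z.im ≠ 0 → limitCubic c z (stieltjes N z) = 0 := by
  have hbad : ∀ n : ℕ, ∀ ε : ℝ≥0∞, 0 < ε → ∀ᶠ r in atTop, P r {ω | ∃ i ≤ n,
      1 / ((n : ℝ) + 1) ≤ ‖limitCubic c (testPoint η i) (stieltjes (ν r ω) (testPoint η i))‖} ≤ ε := by
    intro n ε hε
    have h1 : Tendsto (fun r => ∑ i ∈ Finset.range (n + 1), P r {ω | 1 / ((n : ℝ) + 1) ≤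
        ‖limitCubic c (testPoint η i) (stieltjes (ν r ω) (testPoint η i))‖}) atTop (𝓝 0) := by
      have := tendsto_finsetSum (Finset.range (n + 1)) fun i _ =>
        hcub (testPoint η i) (lt_im_testPoint η i) (1 / ((n : ℝ) + 1)) (by positivity)
      simpa using this
    filter_upwards [h1.eventually_le_const hε] with r hr
    refine le_trans (le_trans (measure_mono ?_) (measure_biUnion_finset_le _ _)) hr
    rintro ω ⟨i, hi, h⟩
    simp only [Set.mem_iUnion]
    exact ⟨i, Finset.mem_range.2 (Nat.lt_succ_of_le hi), h⟩
  obtain ⟨N, hN, hNcub⟩ : ∃ N : Measure ℝ, IsProbabilityMeasure N ∧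
      ∀ z : ℂ, z.im ≠ 0 → limitCubic c z (stieltjes N z) = 0 := by
    -- Bad events of probability at most 1/2 and 1/4 cannot cover the space, so for each n some
    -- realisation is good, with the same K for all n.
    obtain ⟨K, hK⟩ := htail 2⁻¹ (by simp)
    have hex : ∀ n : ℕ, ∃ μ : ProbabilityMeasure ℝ, TailBound K μ ∧
        ∀ i ≤ n, ‖limitCubic c (testPoint η i) (stieltjes μ (testPoint η i))‖
          ≤ 1 / ((n : ℝ) + 1) := by
      intro n
      obtain ⟨r, h1, h2, h3⟩ := (hprob.and (hK.and (hbad n 4⁻¹ (by simp)))).exists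
      by_contra! hcon
      have huniv : (Set.univ : Set (Ω r)) ⊆ {ω | ¬ TailBound K (ν r ω)} ∪ {ω | ∃ i ≤ n,
          1 / ((n : ℝ) + 1) ≤
            ‖limitCubic c (testPoint η i) (stieltjes (ν r ω) (testPoint η i))‖} := by
        intro ω _
        by_cases ht : TailBound K (ν r ω)
        · obtain ⟨i, hi, hlt⟩ := hcon ⟨ν r ω, h1 ω⟩ ht
          exact Or.inr ⟨i, hi, hlt.le⟩
        · exact Or.inl ht
      have h4 := (measure_mono huniv).trans ((measure_union_le _ _).trans (add_le_add h2 h3))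
      rw [measure_univ] at h4
      have h5 : (2⁻¹ + 4⁻¹ : ℝ≥0∞) < 1 := by
        rw [← ENNReal.toReal_lt_toReal (by simp) (by simp), ENNReal.toReal_add (by simp) (by simp)]
        norm_num
      exact absurd h4 (not_le.2 h5)
    choose μ hμ1 hμ2 using hex
    obtain ⟨N, U, hU, hlim⟩ := exists_ultrafilter_tendsto_of_tailBound hμ1
    exact ⟨N, inferInstance, fun z hz => limitCubic_eq_zero_of_tendsto hη hU hlim hμ2 hz⟩
  refine ⟨N, hN, fun φ ε hε => ?_, hNcub⟩
  rw [ENNReal.tendsto_nhds_zero]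
  intro δ hδ
  have hδ2 : 0 < δ / 2 := ENNReal.half_pos hδ.ne'
  obtain ⟨K, hK⟩ := htail (δ / 2) hδ2
  obtain ⟨n, hn⟩ := exists_limitCubic_tolerance hc hη hNcub K φ hε
  filter_upwards [hprob, hK, hbad n (δ / 2) hδ2] with r h1 h2 h3
  have hsub : {ω | ε ≤ |∫ x, φ x ∂(ν r ω) - ∫ x, φ x ∂N|} ⊆ {ω | ¬ TailBound K (ν r ω)} ∪
      {ω | ∃ i ≤ n, 1 / ((n : ℝ) + 1) ≤
        ‖limitCubic c (testPoint η i) (stieltjes (ν r ω) (testPoint η i))‖} := by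
    intro ω hω
    by_contra hcon
    simp only [Set.mem_union, Set.mem_ofPred_eq, not_or, not_not, not_exists, not_and, not_le] at hcon
    exact absurd hω (not_le.2 (hn _ (h1 ω) hcon.1 hcon.2))
  calc _ ≤ _ := measure_mono hsub
    _ ≤ δ / 2 + δ / 2 := (measure_union_le _ _).trans (add_le_add h2 h3)
    _ = δ := ENNReal.add_halves δ

/-- Chebyshev's inequality; |x| > n + 1 is weakened to x² ≥ n + 1, since decay like 1/n is enough.
-/
theorem tailBound_of_lintegral_sq_le {K : NNReal} {μ : Measure ℝ}
    (h : ∫⁻ x, ENNReal.ofReal (x ^ 2) ∂μ ≤ K) : TailBound K μ := by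
  intro n
  have h1 : (Metric.closedBall (0 : ℝ) ((n : ℝ) + 1))ᶜ ⊆
      {x | ((n + 1 : NNReal) : ℝ≥0∞) ≤ ENNReal.ofReal (x ^ 2)} := by
    intro x hx
    simp only [Set.mem_compl_iff, Metric.mem_closedBall, dist_zero_right, not_le,
      Real.norm_eq_abs] at hx
    have h3 : (n : ℝ) + 1 ≤ x ^ 2 := by
      rw [← sq_abs]; nlinarith [(Nat.cast_nonneg n : (0 : ℝ) ≤ n)]
    simp only [Set.mem_ofPred_eq]
    have e : ((n + 1 : NNReal) : ℝ≥0∞) = ENNReal.ofReal ((n : ℝ) + 1) := by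
      rw [← ENNReal.ofReal_coe_nnreal]
      push_cast
      rfl
    rw [e]
    exact ENNReal.ofReal_le_ofReal h3
  refine (measure_mono h1).trans ?_
  refine (meas_ge_le_lintegral_div (by fun_prop) (by simp) (by simp)).trans ?_
  rw [ENNReal.coe_div (by positivity)]
  gcongr

/-! ### The Efron–Stein inequality on a finite product space. -/

section Resampling

set_option linter.unusedSectionVars false

variable {ι Y : Type*} [Fintype ι] [DecidableEq ι] [MeasurableSpace Y] (ρ : ι → Measure Y)
  [∀ i, IsProbabilityMeasure (ρ i)]

theorem measurePreserving_update (e : ι) :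
    MeasurePreserving (fun q : (ι → Y) × Y => Function.update q.1 e q.2)
      ((Measure.pi ρ).prod (ρ e)) (Measure.pi ρ) := by
  have hm : Measurable (fun q : (ι → Y) × Y => Function.update q.1 e q.2) := by
    refine measurable_pi_lambda _ fun i => ?_
    by_cases h : i = e
    · subst h; simpa using measurable_snd
    · simpa [Function.update_of_ne h] using! (measurable_pi_apply i).comp measurable_fst
  refine ⟨hm, (Measure.pi_eq fun s hs => ?_).symm⟩
  rw [Measure.map_apply hm (MeasurableSet.univ_pi hs)]
  have hpre : (fun q : (ι → Y) × Y => Function.update q.1 e q.2) ⁻¹' Set.univ.pi s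
      = (Set.univ.pi (Function.update s e Set.univ)) ×ˢ s e := by
    ext q
    simp only [Set.mem_preimage, Set.mem_pi, Set.mem_univ, true_implies, Set.mem_prod]
    constructor
    · intro h
      refine ⟨fun i => ?_, by simpa using h e⟩
      by_cases hi : i = e
      · subst hi; simp
      · simpa [Function.update_of_ne hi] using h i
    · rintro ⟨h1, h2⟩ i
      by_cases hi : i = e
      · subst hi; simpa using h2
      · simpa [Function.update_of_ne hi] using h1 i
  rw [hpre, Measure.prod_prod, Measure.pi_pi, ← Finset.mul_prod_erase Finset.univ _ (Finset.mem_univ e),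
    ← Finset.mul_prod_erase Finset.univ (fun i => ρ i (s i)) (Finset.mem_univ e)]
  simp only [Function.update_self, measure_univ, one_mul]
  rw [mul_comm]
  congr 1
  refine Finset.prod_congr rfl fun i hi => ?_
  rw [Function.update_of_ne (Finset.ne_of_mem_erase hi)]

theorem integral_resample {E : Type*} [NormedAddCommGroup E] [NormedSpace ℝ E] (e : ι)
    {f : (ι → Y) → E} (hf : Integrable f (Measure.pi ρ)) :
    ∫ x, f x ∂(Measure.pi ρ) = ∫ x, (∫ y, f (Function.update x e y) ∂(ρ e)) ∂(Measure.pi ρ) := by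
  have hmp := measurePreserving_update ρ e
  have h1 := integral_map hmp.measurable.aemeasurable (by rw [hmp.map_eq]; exact hf.1)
  rw [hmp.map_eq] at h1
  rw [h1]
  exact integral_prod _ (hmp.integrable_comp_of_integrable hf)

variable {ρ}

theorem integrable_of_measurable_bounded {α : Type*} [MeasurableSpace α] {μ : Measure α}
    [IsFiniteMeasure μ] {f : α → ℝ} (hf : Measurable f) {B : ℝ} (hB : ∀ x, |f x| ≤ B) :
    Integrable f μ :=
  Integrable.of_bound hf.aestronglyMeasurable B (Eventually.of_forall hB)

/-- The bias–variance identity. It shows both that the mean is the best constant approximation and,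
with a = 0, Jensen's inequality for squares. -/
theorem integral_sub_sq_eq {α : Type*} [MeasurableSpace α] {μ : Measure α}
    [IsProbabilityMeasure μ] {f : α → ℝ} (hf : Measurable f) {B : ℝ} (hB : ∀ x, |f x| ≤ B) (a : ℝ) :
    ∫ x, (f x - a) ^ 2 ∂μ = ∫ x, (f x - ∫ y, f y ∂μ) ^ 2 ∂μ + (∫ y, f y ∂μ - a) ^ 2 := by
  set m := ∫ y, f y ∂μ with hm
  have hI := integrable_of_measurable_bounded (μ := μ) hf hB
  have hI2 : Integrable (fun x => (f x - m) ^ 2) μ := by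
    refine integrable_of_measurable_bounded (by fun_prop) (B := (B + |m|) ^ 2) fun x => ?_
    rw [abs_pow]
    gcongr
    exact (abs_sub _ _).trans (by gcongr; exact hB x)
  have hI3 : Integrable (fun x => 2 * (m - a) * (f x - m)) μ :=
    (hI.sub (integrable_const m)).const_mul _
  have e : ∀ x, (f x - a) ^ 2 = (f x - m) ^ 2 + 2 * (m - a) * (f x - m) + (m - a) ^ 2 := by
    intro x; ring
  simp_rw [e]
  have hI4 : Integrable (fun x => (f x - m) ^ 2 + 2 * (m - a) * (f x - m)) μ := hI2.add hI3
  rw [integral_add hI4 (integrable_const _), integral_add hI2 hI3, integral_const_mul,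
    integral_sub hI (integrable_const _), ← hm]
  simp

/-- The average of `f` over the coordinate `e`. -/
noncomputable def coordAverage (ρ : ι → Measure Y) (e : ι) (f : (ι → Y) → ℝ) (x : ι → Y) : ℝ :=
  ∫ y, f (Function.update x e y) ∂(ρ e)

theorem measurable_comp_update {f : (ι → Y) → ℝ} (hf : Measurable f) (e : ι) (x : ι → Y) :
    Measurable fun y => f (Function.update x e y) :=
  hf.comp (measurable_update x)

theorem measurable_coordAverage {f : (ι → Y) → ℝ} (hf : Measurable f) (e : ι) :
    Measurable (coordAverage ρ e f) := by
  have : StronglyMeasurable fun q : (ι → Y) × Y => f (Function.update q.1 e q.2) :=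
    (hf.comp (measurePreserving_update ρ e).measurable).stronglyMeasurable
  exact this.integral_prod_right'.measurable

theorem abs_coordAverage_le {f : (ι → Y) → ℝ} {B : ℝ} (hB : ∀ x, |f x| ≤ B) (e : ι) (x : ι → Y) :
    |coordAverage ρ e f x| ≤ B := by
  have := norm_integral_le_of_norm_le_const (μ := ρ e) (f := fun y => f (Function.update x e y))
    (Eventually.of_forall fun y => hB _)
  simpa [coordAverage] using this

theorem coordAverage_update (e : ι) (f : (ι → Y) → ℝ) (x : ι → Y) (y : Y) :
    coordAverage ρ e f (Function.update x e y) = coordAverage ρ e f x := by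
  simp [coordAverage]

theorem integral_coordAverage {f : (ι → Y) → ℝ} (hf : Measurable f) {B : ℝ} (hB : ∀ x, |f x| ≤ B)
    (e : ι) : ∫ x, coordAverage ρ e f x ∂(Measure.pi ρ) = ∫ x, f x ∂(Measure.pi ρ) :=
  (integral_resample ρ e (integrable_of_measurable_bounded hf hB)).symm

theorem abs_sub_sq_le {a b A B : ℝ} (ha : |a| ≤ A) (hb : |b| ≤ B) : |(a - b) ^ 2| ≤ (A + B) ^ 2 := by
  rw [abs_pow]
  gcongr
  exact (abs_sub _ _).trans (by gcongr)

/-- Averaging over e is the L² projection onto functions that do not depend on the coordinate e, so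
no such function is closer to f. -/
theorem integral_sq_sub_coordAverage_le {f h : (ι → Y) → ℝ} (hf : Measurable f) (hh : Measurable h)
    {B B' : ℝ} (hB : ∀ x, |f x| ≤ B) (hB' : ∀ x, |h x| ≤ B') {e : ι}
    (hinv : ∀ x y, h (Function.update x e y) = h x) :
    ∫ x, (f x - coordAverage ρ e f x) ^ 2 ∂(Measure.pi ρ) ≤
      ∫ x, (f x - h x) ^ 2 ∂(Measure.pi ρ) := by
  have hF := measurable_coordAverage (ρ := ρ) hf e
  have hm1 : Measurable fun x => (f x - coordAverage ρ e f x) ^ 2 := (hf.sub hF).pow_const 2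
  have hm2 : Measurable fun x => (f x - h x) ^ 2 := (hf.sub hh).pow_const 2
  have hb1 : ∀ x, |(f x - coordAverage ρ e f x) ^ 2| ≤ (B + B) ^ 2 := fun x =>
    abs_sub_sq_le (hB x) (abs_coordAverage_le hB e x)
  have hb2 : ∀ x, |(f x - h x) ^ 2| ≤ (B + B') ^ 2 := fun x => abs_sub_sq_le (hB x) (hB' x)
  rw [← integral_coordAverage hm1 hb1 e, ← integral_coordAverage hm2 hb2 e]
  refine integral_mono (integrable_of_measurable_bounded (measurable_coordAverage hm1 e)
    (abs_coordAverage_le hb1 e)) (integrable_of_measurable_bounded (measurable_coordAverage hm2 e)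
    (abs_coordAverage_le hb2 e)) fun x => ?_
  have := integral_sub_sq_eq (μ := ρ e) (measurable_comp_update hf e x) (fun y => hB _) (h x)
  unfold coordAverage at *
  simp only [hinv, Function.update_idem]
  rw [this]
  exact le_add_of_nonneg_right (sq_nonneg _)

/-- The same projection is an L² contraction. -/
theorem integral_sq_coordAverage_sub_le {f h : (ι → Y) → ℝ} (hf : Measurable f) (hh : Measurable h)
    {B B' : ℝ} (hB : ∀ x, |f x| ≤ B) (hB' : ∀ x, |h x| ≤ B') (e : ι) :
    ∫ x, (coordAverage ρ e f x - coordAverage ρ e h x) ^ 2 ∂(Measure.pi ρ) ≤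
      ∫ x, (f x - h x) ^ 2 ∂(Measure.pi ρ) := by
  have hm1 : Measurable fun x => (coordAverage ρ e f x - coordAverage ρ e h x) ^ 2 :=
    ((measurable_coordAverage hf e).sub (measurable_coordAverage hh e)).pow_const 2
  have hm2 : Measurable fun x => (f x - h x) ^ 2 := (hf.sub hh).pow_const 2
  have hb1 : ∀ x, |(coordAverage ρ e f x - coordAverage ρ e h x) ^ 2| ≤ (B + B') ^ 2 := fun x =>
    abs_sub_sq_le (abs_coordAverage_le hB e x) (abs_coordAverage_le hB' e x)
  have hb2 : ∀ x, |(f x - h x) ^ 2| ≤ (B + B') ^ 2 := fun x => abs_sub_sq_le (hB x) (hB' x)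
  rw [← integral_coordAverage hm2 hb2 e]
  refine integral_mono (integrable_of_measurable_bounded hm1 hb1)
    (integrable_of_measurable_bounded (measurable_coordAverage hm2 e) (abs_coordAverage_le hb2 e))
    fun x => ?_
  have h1 := measurable_comp_update hf e x
  have h2 := measurable_comp_update hh e x
  have := integral_sub_sq_eq (μ := ρ e) (h1.sub h2) (B := B + B')
    (fun y => (abs_sub _ _).trans (add_le_add (hB _) (hB' _))) 0
  simp only [coordAverage]
  simp only [Pi.sub_apply, sub_zero] at this
  rw [this, integral_sub (integrable_of_measurable_bounded h1 fun y => hB _)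
    (integrable_of_measurable_bounded h2 fun y => hB' _)]
  exact le_add_of_nonneg_left (integral_nonneg fun y => sq_nonneg _)

/-- Induction on the set of coordinates that f depends on. With F the average of f over e and m the
mean, f - F and F - m are orthogonal. The first is bounded through `h e`; the second by induction,
with each `h i` averaged over e, which keeps it free of coordinate i and does not increase its
distance. -/
theorem integral_sq_sub_integral_le_of_dependsOn (s : Finset ι) :
    ∀ (f : (ι → Y) → ℝ) (h : ι → (ι → Y) → ℝ) (B : ℝ), Measurable f → (∀ x, |f x| ≤ B) →
      (∀ x y : ι → Y, (∀ i ∈ s, x i = y i) → f x = f y) →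
      (∀ i ∈ s, Measurable (h i)) → (∀ i ∈ s, ∀ x, |h i x| ≤ B) →
      (∀ i ∈ s, ∀ x y, h i (Function.update x i y) = h i x) →
      ∫ x, (f x - ∫ y, f y ∂(Measure.pi ρ)) ^ 2 ∂(Measure.pi ρ) ≤
        ∑ i ∈ s, ∫ x, (f x - h i x) ^ 2 ∂(Measure.pi ρ) := by
  induction s using Finset.induction_on with
  | empty =>
    intro f h B _ _ hdep _ _ _
    obtain ⟨x₀⟩ := (Measure.pi ρ).nonempty_of_neZero
    have hconst : f = fun _ => f x₀ := funext fun x => hdep x x₀ (by simp)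
    rw [hconst]
    simp
  | insert e s he ih =>
    intro f h B hf hB hdep hh hhB hinv
    have hF := measurable_coordAverage (ρ := ρ) hf e
    have hFB := abs_coordAverage_le (ρ := ρ) hB e
    have hmean := integral_coordAverage (ρ := ρ) hf hB e
    set m := ∫ y, f y ∂(Measure.pi ρ) with hm
    set F := coordAverage ρ e f with hFdef
    have hind := ih F (fun i => coordAverage ρ e (h i)) B hF hFB
      (fun x y hxy => by
        refine integral_congr_ae (Eventually.of_forall fun t => hdep _ _ fun i hi => ?_)
        rcases eq_or_ne i e with rfl | hne
        · simp
        · rw [Function.update_of_ne hne, Function.update_of_ne hne]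
          exact hxy i ((Finset.mem_insert.1 hi).resolve_left hne))
      (fun i hi => measurable_coordAverage (hh i (Finset.mem_insert_of_mem hi)) e)
      (fun i hi => abs_coordAverage_le (hhB i (Finset.mem_insert_of_mem hi)) e)
      (fun i hi x y => by
        have hne : e ≠ i := fun h => he (h ▸ hi)
        simp only [coordAverage]
        refine integral_congr_ae (Eventually.of_forall fun t => ?_)
        simp only
        rw [Function.update_comm hne.symm, hinv i (Finset.mem_insert_of_mem hi)])
    rw [hmean] at hind
    have hmB : |m| ≤ B := by
      have := norm_integral_le_of_norm_le_const (μ := Measure.pi ρ) (f := f)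
        (Eventually.of_forall hB)
      simpa using this
    have i1 : Integrable (fun x => (f x - F x) ^ 2) (Measure.pi ρ) :=
      integrable_of_measurable_bounded ((hf.sub hF).pow_const 2) fun x => abs_sub_sq_le (hB x) (hFB x)
    have i2 : Integrable (fun x => (F x - m) ^ 2) (Measure.pi ρ) :=
      integrable_of_measurable_bounded ((hF.sub_const m).pow_const 2)
        fun x => abs_sub_sq_le (hFB x) hmB
    have hcm : Measurable fun x => (f x - F x) * (F x - m) := (hf.sub hF).mul (hF.sub_const m)
    have hcb : ∀ x, |(f x - F x) * (F x - m)| ≤ (B + B) * (B + B) := by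
      intro x
      rw [abs_mul]
      have h1 : |f x - F x| ≤ B + B := (abs_sub _ _).trans (add_le_add (hB x) (hFB x))
      have h2 : |F x - m| ≤ B + B := (abs_sub _ _).trans (add_le_add (hFB x) hmB)
      exact mul_le_mul h1 h2 (abs_nonneg _) ((abs_nonneg _).trans h1)
    have i3 : Integrable (fun x => (f x - F x) * (F x - m)) (Measure.pi ρ) :=
      integrable_of_measurable_bounded hcm hcb
    -- With the other coordinates fixed, F - m is constant in coordinate e and f - F averages to
    -- zero.
    have hcross : ∫ x, (f x - F x) * (F x - m) ∂(Measure.pi ρ) = 0 := by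
      rw [← integral_coordAverage hcm hcb e]
      refine integral_eq_zero_of_ae (Eventually.of_forall fun x => ?_)
      have hupd : ∀ y, F (Function.update x e y) = F x := coordAverage_update e f x
      change ∫ y, (f (Function.update x e y) - F (Function.update x e y)) *
        (F (Function.update x e y) - m) ∂(ρ e) = 0
      simp_rw [hupd]
      rw [integral_mul_const, integral_sub (integrable_of_measurable_bounded
        (measurable_comp_update hf e x) fun y => hB _) (integrable_const _)]
      simp [hFdef, coordAverage]
    have hsplit : ∫ x, (f x - m) ^ 2 ∂(Measure.pi ρ) =
        ∫ x, (f x - F x) ^ 2 ∂(Measure.pi ρ) + ∫ x, (F x - m) ^ 2 ∂(Measure.pi ρ) := by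
      have e1 : ∀ x, (f x - m) ^ 2 =
          (f x - F x) ^ 2 + 2 * ((f x - F x) * (F x - m)) + (F x - m) ^ 2 := by intro x; ring
      simp_rw [e1]
      have i4 : Integrable (fun x => (f x - F x) ^ 2 + 2 * ((f x - F x) * (F x - m)))
        (Measure.pi ρ) := i1.add (i3.const_mul 2)
      rw [integral_add i4 i2, integral_add i1 (i3.const_mul 2),
        integral_const_mul, hcross]
      ring
    rw [hsplit, Finset.sum_insert he]
    refine add_le_add (integral_sq_sub_coordAverage_le hf (hh e (Finset.mem_insert_self e s)) hB
      (hhB e (Finset.mem_insert_self e s)) (hinv e (Finset.mem_insert_self e s))) (hind.trans ?_)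
    exact Finset.sum_le_sum fun i hi => integral_sq_coordAverage_sub_le hf
      (hh i (Finset.mem_insert_of_mem hi)) hB (hhB i (Finset.mem_insert_of_mem hi)) e

/-- The Efron–Stein inequality. -/
theorem integral_sq_sub_integral_le_sum {f : (ι → Y) → ℝ} {h : ι → (ι → Y) → ℝ} {B : ℝ}
    (hf : Measurable f) (hB : ∀ x, |f x| ≤ B) (hh : ∀ i, Measurable (h i))
    (hhB : ∀ i x, |h i x| ≤ B) (hinv : ∀ i x y, h i (Function.update x i y) = h i x) :
    ∫ x, (f x - ∫ y, f y ∂(Measure.pi ρ)) ^ 2 ∂(Measure.pi ρ) ≤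
      ∑ i, ∫ x, (f x - h i x) ^ 2 ∂(Measure.pi ρ) :=
  integral_sq_sub_integral_le_of_dependsOn Finset.univ f h B hf hB
    (fun _ _ hxy => congrArg f (funext fun i => hxy i (Finset.mem_univ i))) (fun i _ => hh i)
    (fun i _ => hhB i) fun i _ => hinv i

end Resampling

/-! ### Deterministic resolvent bounds. -/

section Resolvent

open Matrix

variable {n : Type*} [Fintype n]

/-- The squared Euclidean norm of a complex vector. -/
noncomputable def sqSum (u : n → ℂ) : ℝ := ∑ i, ‖u i‖ ^ 2

theorem sqSum_nonneg (u : n → ℂ) : 0 ≤ sqSum u := Finset.sum_nonneg fun _ _ => by positivity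

theorem eq_zero_of_sqSum_eq_zero {u : n → ℂ} (h : sqSum u = 0) : u = 0 := by
  funext i
  have := (Finset.sum_eq_zero_iff_of_nonneg (fun i _ => by positivity)).1 h i (Finset.mem_univ i)
  simpa using this

theorem norm_dotProduct_sq_le (u w : n → ℂ) : ‖u ⬝ᵥ w‖ ^ 2 ≤ sqSum u * sqSum w := by
  have h1 : ‖u ⬝ᵥ w‖ ≤ ∑ i, ‖u i‖ * ‖w i‖ := by
    refine (norm_sum_le _ _).trans (le_of_eq ?_)
    simp
  have h2 := Finset.sum_mul_sq_le_sq_mul_sq Finset.univ (fun i => ‖u i‖) (fun i => ‖w i‖)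
  exact (pow_le_pow_left₀ (norm_nonneg _) h1 2).trans h2

theorem star_dotProduct_self (u : n → ℂ) : star u ⬝ᵥ u = (sqSum u : ℂ) := by
  simp [dotProduct, sqSum, Complex.conj_mul']

variable [DecidableEq n]

/-- The matrix `A - z` over the complex numbers. -/
noncomputable def shiftedMatrix (A : Matrix n n ℝ) (z : ℂ) : Matrix n n ℂ := A.map Complex.ofReal - z • 1

/-- The resolvent `(A - z)⁻¹`. -/
noncomputable def resolventMatrix (A : Matrix n n ℝ) (z : ℂ) : Matrix n n ℂ := (shiftedMatrix A z)⁻¹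

theorem im_star_dotProduct_shiftedMatrix {A : Matrix n n ℝ} (hA : A.IsHermitian) (z : ℂ)
    (w : n → ℂ) : (star w ⬝ᵥ (shiftedMatrix A z *ᵥ w)).im = -(z.im * sqSum w) := by
  have hH : (A.map Complex.ofReal).IsHermitian := by
    ext i j
    have := congrFun (congrFun hA i) j
    simp only [conjTranspose_apply, star_trivial] at this
    simp [this]
  have h1 : (star w ⬝ᵥ (A.map Complex.ofReal *ᵥ w)).im = 0 := by
    simpa using hH.im_star_dotProduct_mulVec_self w
  rw [shiftedMatrix, sub_mulVec, dotProduct_sub, smul_mulVec, one_mulVec, dotProduct_smul,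
    star_dotProduct_self, Complex.sub_im, h1]
  simp

/-- For real symmetric A the form ⟨w, (A - z)w⟩ has imaginary part -Im z |w|², and Cauchy–Schwarz
gives |Im z||w| ≤ |(A - z)w|. Invertibility and all the norm bounds on the resolvent come from this.
-/
theorem sqSum_le_of_mulVec {A : Matrix n n ℝ} (hA : A.IsHermitian) (z : ℂ) (w : n → ℂ) :
    z.im ^ 2 * sqSum w ≤ sqSum (shiftedMatrix A z *ᵥ w) := by
  have h1 := im_star_dotProduct_shiftedMatrix hA z w
  have h2 := norm_dotProduct_sq_le (star w) (shiftedMatrix A z *ᵥ w)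
  have h3 : sqSum (star w) = sqSum w := by simp [sqSum]
  rw [h3] at h2
  have h4 := Complex.abs_im_le_norm (star w ⬝ᵥ (shiftedMatrix A z *ᵥ w))
  rw [h1] at h4
  have h5 := pow_le_pow_left₀ (abs_nonneg _) h4 2
  rw [sq_abs] at h5
  rcases (sqSum_nonneg w).eq_or_lt with h0 | h0
  · rw [← h0, mul_zero]; exact sqSum_nonneg _
  · have : sqSum w * (z.im ^ 2 * sqSum w) ≤ sqSum w * sqSum (shiftedMatrix A z *ᵥ w) := by
      calc _ = (-(z.im * sqSum w)) ^ 2 := by ring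
        _ ≤ _ := h5.trans h2
    exact le_of_mul_le_mul_left this h0

theorem isUnit_det_shiftedMatrix {A : Matrix n n ℝ} (hA : A.IsHermitian) {z : ℂ} (hz : z.im ≠ 0) :
    IsUnit (shiftedMatrix A z).det := by
  rw [← Matrix.isUnit_iff_isUnit_det, ← Matrix.mulVec_injective_iff_isUnit]
  intro u w huw
  have h1 : shiftedMatrix A z *ᵥ (u - w) = 0 := by rw [mulVec_sub]; exact sub_eq_zero.2 huw
  have h2 := sqSum_le_of_mulVec hA z (u - w)
  rw [h1] at h2
  have h3 : sqSum (0 : n → ℂ) = 0 := by simp [sqSum]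
  rw [h3] at h2
  have h4 : 0 < z.im ^ 2 := by positivity
  have h5 : sqSum (u - w) = 0 :=
    le_antisymm (nonpos_of_mul_nonpos_right h2 h4) (sqSum_nonneg _)
  exact sub_eq_zero.1 (eq_zero_of_sqSum_eq_zero h5)

theorem shiftedMatrix_mul_resolventMatrix {A : Matrix n n ℝ} (hA : A.IsHermitian) {z : ℂ}
    (hz : z.im ≠ 0) : shiftedMatrix A z * resolventMatrix A z = 1 :=
  mul_nonsing_inv _ (isUnit_det_shiftedMatrix hA hz)

theorem resolventMatrix_mul_shiftedMatrix {A : Matrix n n ℝ} (hA : A.IsHermitian) {z : ℂ}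
    (hz : z.im ≠ 0) : resolventMatrix A z * shiftedMatrix A z = 1 :=
  nonsing_inv_mul _ (isUnit_det_shiftedMatrix hA hz)

theorem sqSum_resolventMatrix_mulVec_le {A : Matrix n n ℝ} (hA : A.IsHermitian) {z : ℂ}
    (hz : z.im ≠ 0) (u : n → ℂ) : sqSum (resolventMatrix A z *ᵥ u) ≤ sqSum u / z.im ^ 2 := by
  have h := sqSum_le_of_mulVec hA z (resolventMatrix A z *ᵥ u)
  rw [mulVec_mulVec, shiftedMatrix_mul_resolventMatrix hA hz, one_mulVec] at h
  rw [le_div_iff₀ (by positivity), mul_comm]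
  exact h

/-- The resolvent is complex symmetric rather than Hermitian, which is why the forms below are
bilinear, without conjugation. -/
theorem transpose_resolventMatrix {A : Matrix n n ℝ} (hA : A.IsHermitian) (z : ℂ) :
    (resolventMatrix A z)ᵀ = resolventMatrix A z := by
  rw [resolventMatrix, transpose_nonsing_inv]
  congr 1
  ext i j
  have := congrFun (congrFun hA i) j
  simp only [conjTranspose_apply, star_trivial] at this
  simp [shiftedMatrix, this, Matrix.one_apply, eq_comm]

theorem resolventMatrix_apply_comm {A : Matrix n n ℝ} (hA : A.IsHermitian) (z : ℂ) (i j : n) :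
    resolventMatrix A z i j = resolventMatrix A z j i :=
  congrFun (congrFun (transpose_resolventMatrix hA z) j) i

theorem resolventMatrix_sub {A B : Matrix n n ℝ} (hA : A.IsHermitian) (hB : B.IsHermitian) {z : ℂ}
    (hz : z.im ≠ 0) : resolventMatrix A z - resolventMatrix B z =
      -(resolventMatrix A z * (A - B).map Complex.ofReal * resolventMatrix B z) := by
  have h : (A - B).map Complex.ofReal = shiftedMatrix A z - shiftedMatrix B z := by
    ext i j; simp [shiftedMatrix]
  rw [h, mul_sub, sub_mul, resolventMatrix_mul_shiftedMatrix hA hz, mul_assoc,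
    shiftedMatrix_mul_resolventMatrix hB hz]
  simp

theorem resolventMatrix_eq_of_mul_eq_one {A : Matrix n n ℝ} {z : ℂ} {B : Matrix n n ℂ}
    (h : shiftedMatrix A z * B = 1) : resolventMatrix A z = B := inv_eq_right_inv h

theorem smul_resolventMatrix {A : Matrix n n ℝ} (hA : A.IsHermitian) {z : ℂ}
    (hz : z.im ≠ 0) : z • resolventMatrix A z = A.map Complex.ofReal * resolventMatrix A z - 1 := by
  have := shiftedMatrix_mul_resolventMatrix hA hz
  rw [shiftedMatrix, sub_mul, smul_mul_assoc, one_mul] at this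
  rw [← this]; abel

/-- By Cramer's formula. Continuity is the source of measurability for all the integrands built from
the resolvent. -/
theorem continuous_resolventMatrix {X : Type*} [TopologicalSpace X] {A : X → Matrix n n ℝ}
    (hc : Continuous A) (hA : ∀ x, (A x).IsHermitian) {z : ℂ} (hz : z.im ≠ 0) :
    Continuous fun x => resolventMatrix (A x) z := by
  have hs : Continuous fun x => shiftedMatrix (A x) z := by
    unfold shiftedMatrix
    exact (hc.matrix_map Complex.continuous_ofReal).sub continuous_const
  unfold resolventMatrix
  simp only [Matrix.inv_def, Ring.inverse_eq_inv']
  exact (hs.matrix_det.inv₀ fun x => (isUnit_det_shiftedMatrix (hA x) hz).ne_zero).smul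
    hs.matrix_adjugate

/-- By symmetry each row is the image of a unit vector under the resolvent, hence has squared norm
at most 1/(Im z)². -/
theorem sum_norm_sq_resolventMatrix_le {A : Matrix n n ℝ} (hA : A.IsHermitian) {z : ℂ}
    (hz : z.im ≠ 0) : ∑ i, ∑ j, ‖resolventMatrix A z i j‖ ^ 2 ≤ Fintype.card n / z.im ^ 2 := by
  have h1 : ∀ i, ∑ j, ‖resolventMatrix A z i j‖ ^ 2 ≤ 1 / z.im ^ 2 := by
    intro i
    have h2 := sqSum_resolventMatrix_mulVec_le hA hz (Pi.single i 1)
    have h3 : sqSum (Pi.single i 1 : n → ℂ) = 1 := by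
      unfold sqSum
      rw [Finset.sum_eq_single i] <;> simp +contextual
    rw [h3] at h2
    refine le_trans (le_of_eq ?_) h2
    unfold sqSum
    refine Finset.sum_congr rfl fun j _ => ?_
    rw [resolventMatrix_apply_comm hA]
    simp
  refine (Finset.sum_le_sum fun i _ => h1 i).trans (le_of_eq ?_)
  simp [div_eq_mul_inv]

theorem norm_resolventMatrix_apply_le {A : Matrix n n ℝ} (hA : A.IsHermitian) {z : ℂ}
    (hz : z.im ≠ 0) (i j : n) : ‖resolventMatrix A z i j‖ ≤ |z.im|⁻¹ := by
  have h2 := sqSum_resolventMatrix_mulVec_le hA hz (Pi.single j 1)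
  have h3 : sqSum (Pi.single j 1 : n → ℂ) = 1 := by
    unfold sqSum
    rw [Finset.sum_eq_single j] <;> simp +contextual
  rw [h3] at h2
  have h4 : ‖resolventMatrix A z i j‖ ^ 2 ≤ sqSum (resolventMatrix A z *ᵥ Pi.single j 1) := by
    have := Finset.single_le_sum (f := fun i => ‖(resolventMatrix A z *ᵥ Pi.single j 1) i‖ ^ 2)
      (fun _ _ => by positivity) (Finset.mem_univ i)
    simpa [sqSum] using this
  refine (pow_le_pow_iff_left₀ (norm_nonneg _) (by positivity) two_ne_zero).1 ?_
  rw [inv_pow, sq_abs]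
  simpa using h4.trans h2

end Resolvent

/-! ### Empirical spectral distribution, resolvent trace and second moment. -/

section Spectral

open Matrix

variable {n : Type*} [Fintype n] [DecidableEq n]

theorem exists_real_diagonalization {A : Matrix n n ℝ} (hA : A.IsHermitian) :
    ∃ U V : Matrix n n ℝ, U * V = 1 ∧ V * U = 1 ∧ A = U * diagonal hA.eigenvalues * V := by
  refine ⟨hA.eigenvectorUnitary, star (hA.eigenvectorUnitary : Matrix n n ℝ), ?_, ?_, ?_⟩
  · simp
  · simp
  · exact hA.spectral_theorem

theorem trace_resolventMatrix {A : Matrix n n ℝ} (hA : A.IsHermitian) {z : ℂ} (hz : z.im ≠ 0) :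
    (resolventMatrix A z).trace = ∑ i, ((hA.eigenvalues i : ℂ) - z)⁻¹ := by
  obtain ⟨U, V, hUV, hVU, hd⟩ := exists_real_diagonalization hA
  have hmap : ∀ M N : Matrix n n ℝ, (M * N).map Complex.ofReal =
      M.map Complex.ofReal * N.map Complex.ofReal := fun M N => Matrix.map_mul (f := Complex.ofRealHom)
  have hUV' : U.map Complex.ofReal * V.map Complex.ofReal = 1 := by
    rw [← hmap, hUV]; exact Matrix.map_one _ Complex.ofReal_zero Complex.ofReal_one
  have hVU' : V.map Complex.ofReal * U.map Complex.ofReal = 1 := by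
    rw [← hmap, hVU]; exact Matrix.map_one _ Complex.ofReal_zero Complex.ofReal_one
  set U' := U.map Complex.ofReal
  set V' := V.map Complex.ofReal
  set D : Matrix n n ℂ := diagonal fun i => ((hA.eigenvalues i : ℂ) - z) with hD
  set E : Matrix n n ℂ := diagonal fun i => ((hA.eigenvalues i : ℂ) - z)⁻¹ with hE
  have hDE : D * E = 1 := by
    rw [hD, hE, diagonal_mul_diagonal, ← diagonal_one]
    congr 1
    funext i
    exact mul_inv_cancel₀ (ofReal_sub_ne_zero hz _)
  have hs : shiftedMatrix A z = U' * D * V' := by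
    have h1 : D = (diagonal hA.eigenvalues).map Complex.ofReal - z • 1 := by
      ext i j
      by_cases h : i = j <;> simp [hD, h]
    have h2 : A.map Complex.ofReal = U' * (diagonal hA.eigenvalues).map Complex.ofReal * V' := by
      conv_lhs => rw [hd]
      rw [hmap, hmap]
    rw [shiftedMatrix, h1, h2, mul_sub, sub_mul, mul_smul_comm, mul_one, smul_mul_assoc, hUV']
  have hr : resolventMatrix A z = U' * E * V' := by
    refine resolventMatrix_eq_of_mul_eq_one ?_
    calc shiftedMatrix A z * (U' * E * V') = U' * (D * (V' * U') * E) * V' := by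
          rw [hs]; simp only [mul_assoc]
      _ = 1 := by rw [hVU', mul_one, hDE, mul_one, hUV']
  rw [hr, trace_mul_cycle, hVU', one_mul, hE, trace_diagonal]

/-- Both sides are the trace of A². -/
theorem sum_sq_eigenvalues {A : Matrix n n ℝ} (hA : A.IsHermitian) :
    ∑ i, hA.eigenvalues i ^ 2 = ∑ i, ∑ j, A i j ^ 2 := by
  obtain ⟨U, V, hUV, hVU, hd⟩ := exists_real_diagonalization hA
  have h1 : (A * A).trace = ∑ i, hA.eigenvalues i ^ 2 := by
    have : A * A = U * (diagonal hA.eigenvalues * diagonal hA.eigenvalues) * V := by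
      calc A * A = U * diagonal hA.eigenvalues * V * (U * diagonal hA.eigenvalues * V) := by
            rw [← hd]
        _ = U * (diagonal hA.eigenvalues * (V * U) * diagonal hA.eigenvalues) * V := by
            simp only [mul_assoc]
        _ = _ := by rw [hVU, mul_one]
    rw [this, trace_mul_cycle, hVU, one_mul, diagonal_mul_diagonal, trace_diagonal]
    simp [sq]
  rw [← h1]
  refine Finset.sum_congr rfl fun i _ => ?_
  rw [diag_apply, mul_apply]
  refine Finset.sum_congr rfl fun j _ => ?_
  have := congrFun (congrFun hA i) j
  simp only [conjTranspose_apply, star_trivial] at this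
  rw [this, sq]

theorem stieltjes_empiricalSpectral {A : Matrix n n ℝ} (hA : A.IsHermitian) {z : ℂ}
    (hz : z.im ≠ 0) :
    stieltjes (empiricalSpectral hA) z = (Fintype.card n : ℂ)⁻¹ * (resolventMatrix A z).trace := by
  unfold stieltjes empiricalSpectral
  rw [integral_smul_measure, integral_finsetSum_measure fun i _ =>
    integrable_inv_ofReal_sub _ hz, trace_resolventMatrix hA hz]
  simp

theorem lintegral_sq_empiricalSpectral {A : Matrix n n ℝ} (hA : A.IsHermitian) [Nonempty n] :
    ∫⁻ x, ENNReal.ofReal (x ^ 2) ∂(empiricalSpectral hA) =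
      ENNReal.ofReal ((Fintype.card n : ℝ)⁻¹ * ∑ i, ∑ j, A i j ^ 2) := by
  unfold empiricalSpectral
  rw [lintegral_smul_measure, lintegral_finsetSum_measure, ← sum_sq_eigenvalues hA,
    ENNReal.ofReal_mul (by positivity), ENNReal.ofReal_sum_of_nonneg fun i _ => sq_nonneg _,
    ENNReal.ofReal_inv_of_pos (by positivity)]
  simp

theorem isProbabilityMeasure_empiricalSpectral {A : Matrix n n ℝ} (hA : A.IsHermitian)
    [Nonempty n] : IsProbabilityMeasure (empiricalSpectral hA) := by
  constructor
  simp only [empiricalSpectral, Measure.smul_apply, Measure.coe_finsetSum, Finset.sum_apply,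
    measure_univ, Finset.sum_const, smul_eq_mul, Finset.card_univ, nsmul_eq_mul, mul_one]
  exact ENNReal.inv_mul_cancel (by simp) (by simp)

end Spectral

/-! ### The block matrix and the effect of removing one edge. -/

section Blocks

open Matrix

variable {r d : ℕ}

/-- The data `(ξ, v)` attached to each pair of block indices. -/
abbrev EdgeConfig (r d : ℕ) : Type := BlockPair r → ℝ × EuclideanSpace ℝ (Fin d)

/-- The block adjacency matrix of a configuration. -/
def configAdj (x : EdgeConfig r d) : Matrix (Fin r × Fin d) (Fin r × Fin d) ℝ :=
  blockAdj (fun a => (x a).1) (fun a => (x a).2)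

theorem configAdj_isHermitian (x : EdgeConfig r d) : (configAdj x).IsHermitian :=
  blockAdj_isHermitian _ _

/-- The resolvent of the block adjacency matrix of a configuration. -/
noncomputable def configRes (z : ℂ) (x : EdgeConfig r d) :
    Matrix (Fin r × Fin d) (Fin r × Fin d) ℂ := resolventMatrix (configAdj x) z

theorem configRes_apply_comm (z : ℂ) (x : EdgeConfig r d) (p q : Fin r × Fin d) :
    configRes z x p q = configRes z x q p :=
  resolventMatrix_apply_comm (configAdj_isHermitian x) z p q

/-- The vector with the entries of `u` in the block `k`, and zero elsewhere. -/
def blockVec (k : Fin r) (u : EuclideanSpace ℝ (Fin d)) : Fin r × Fin d → ℂ :=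
  fun q => if q.1 = k then (u q.2 : ℂ) else 0

/-- The squared norm of the block `k` of a vector. -/
noncomputable def blockSqSum (k : Fin r) (w : Fin r × Fin d → ℂ) : ℝ := ∑ i, ‖w (k, i)‖ ^ 2

theorem sum_blockSqSum (w : Fin r × Fin d → ℂ) : ∑ k, blockSqSum k w = sqSum w := by
  simp [blockSqSum, sqSum, Fintype.sum_prod_type]

theorem blockSqSum_nonneg (k : Fin r) (w : Fin r × Fin d → ℂ) : 0 ≤ blockSqSum k w :=
  Finset.sum_nonneg fun _ _ => by positivity

theorem blockSqSum_le (k : Fin r) (w : Fin r × Fin d → ℂ) : blockSqSum k w ≤ sqSum w := by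
  rw [← sum_blockSqSum]
  exact Finset.single_le_sum (fun k _ => blockSqSum_nonneg k w) (Finset.mem_univ k)

theorem norm_block_sum_sq_le (k l : Fin r) (f g : Fin r × Fin d → ℂ) :
    ‖∑ i, f (k, i) * g (l, i)‖ ^ 2 ≤ blockSqSum k f * blockSqSum l g :=
  norm_dotProduct_sq_le (fun i => f (k, i)) (fun i => g (l, i))

theorem sqSum_blockVec (k : Fin r) (u : EuclideanSpace ℝ (Fin d)) :
    sqSum (blockVec k u) = ‖u‖ ^ 2 := by
  rw [EuclideanSpace.norm_sq_eq, sqSum, Fintype.sum_prod_type, Finset.sum_eq_single k]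
  · simp [blockVec]
  · intro b _ hb
    simp [blockVec, hb]
  · simp

theorem blockVec_dotProduct_mulVec (M : Matrix (Fin r × Fin d) (Fin r × Fin d) ℂ) (k l : Fin r)
    (u : EuclideanSpace ℝ (Fin d)) : blockVec k u ⬝ᵥ (M *ᵥ blockVec l u) =
      ∑ i, ∑ j, (u i : ℂ) * (u j : ℂ) * M (k, i) (l, j) := by
  simp only [dotProduct, mulVec, Fintype.sum_prod_type]
  rw [Finset.sum_eq_single k]
  · refine Finset.sum_congr rfl fun i _ => ?_
    rw [Finset.sum_eq_single l, Finset.mul_sum]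
    · refine Finset.sum_congr rfl fun j _ => ?_
      simp [blockVec]; ring
    · intro b _ hb
      simp [blockVec, hb]
    · simp
  · intro b _ hb
    simp [blockVec, hb]
  · simp

theorem configAdj_apply_of_lt (x : EdgeConfig r d) {k l : Fin r} (h : k < l) (i j : Fin d) :
    configAdj x (k, i) (l, j) =
      (x ⟨(k, l), h⟩).1 * (x ⟨(k, l), h⟩).2 i * (x ⟨(k, l), h⟩).2 j := by
  simp [configAdj, blockAdj, adjBlock, h]

theorem configAdj_apply_of_gt (x : EdgeConfig r d) {k l : Fin r} (h : l < k) (i j : Fin d) :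
    configAdj x (k, i) (l, j) =
      (x ⟨(l, k), h⟩).1 * (x ⟨(l, k), h⟩).2 i * (x ⟨(l, k), h⟩).2 j := by
  simp [configAdj, blockAdj, adjBlock, h, h.not_gt]

theorem configAdj_apply_self (x : EdgeConfig r d) (k : Fin r) (i j : Fin d) :
    configAdj x (k, i) (k, j) = 0 := by
  simp [configAdj, blockAdj, adjBlock]

/-- Resetting the edge to 0 deletes two mutually transposed blocks: a perturbation of rank at most
two, built from the edge vector placed in each of the two blocks. -/
theorem configAdj_sub_update (x : EdgeConfig r d) (e : BlockPair r) :
    (configAdj x - configAdj (Function.update x e 0)).map Complex.ofReal =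
      ((x e).1 : ℂ) • (vecMulVec (blockVec e.1.1 (x e).2) (blockVec e.1.2 (x e).2) +
        vecMulVec (blockVec e.1.2 (x e).2) (blockVec e.1.1 (x e).2)) := by
  obtain ⟨⟨a, b⟩, hab⟩ := e
  ext ⟨k, i⟩ ⟨l, j⟩
  have hab' : a < b := hab
  simp only [map_apply, Matrix.sub_apply, Matrix.smul_apply, Matrix.add_apply,
    vecMulVec_apply, blockVec, smul_eq_mul]
  rcases lt_trichotomy k l with h | h | h
  · rw [configAdj_apply_of_lt x h, configAdj_apply_of_lt _ h]
    have h1 : ¬ (k = b ∧ l = a) := by rintro ⟨rfl, rfl⟩; exact absurd h hab'.not_gt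
    by_cases h2 : k = a ∧ l = b
    · obtain ⟨rfl, rfl⟩ := h2
      simp [hab'.ne, hab'.ne', mul_assoc]
    · have hne : (⟨(k, l), h⟩ : BlockPair r) ≠ ⟨(a, b), hab⟩ := by
        intro h'; apply h2; simpa using h'
      rw [Function.update_of_ne hne]
      have e1 : (if k = a then ((x ⟨(a, b), hab⟩).2 i : ℂ) else 0) *
          (if l = b then ((x ⟨(a, b), hab⟩).2 j : ℂ) else 0) = 0 := by
        by_cases hk : k = a <;> by_cases hl : l = b <;> simp [hk, hl]
        exact absurd ⟨hk, hl⟩ h2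
      have e2 : (if k = b then ((x ⟨(a, b), hab⟩).2 i : ℂ) else 0) *
          (if l = a then ((x ⟨(a, b), hab⟩).2 j : ℂ) else 0) = 0 := by
        by_cases hk : k = b <;> by_cases hl : l = a <;> simp [hk, hl]
        exact absurd ⟨hk, hl⟩ h1
      rw [e1, e2]; simp
  · subst h
    have e1 : (if k = a then ((x ⟨(a, b), hab⟩).2 i : ℂ) else 0) *
          (if k = b then ((x ⟨(a, b), hab⟩).2 j : ℂ) else 0) = 0 := by
      by_cases hk : k = a
      · subst hk; simp [hab'.ne]
      · simp [hk]
    have e2 : (if k = b then ((x ⟨(a, b), hab⟩).2 i : ℂ) else 0) *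
          (if k = a then ((x ⟨(a, b), hab⟩).2 j : ℂ) else 0) = 0 := by
      by_cases hk : k = a
      · subst hk; simp [hab'.ne]
      · simp [hk]
    rw [e1, e2, configAdj_apply_self, configAdj_apply_self]
    simp
  · rw [configAdj_apply_of_gt x h, configAdj_apply_of_gt _ h]
    have h1 : ¬ (k = a ∧ l = b) := by rintro ⟨rfl, rfl⟩; exact absurd h hab'.not_gt
    by_cases h2 : l = a ∧ k = b
    · obtain ⟨rfl, rfl⟩ := h2
      simp [hab'.ne, hab'.ne', mul_assoc]
    · have hne : (⟨(l, k), h⟩ : BlockPair r) ≠ ⟨(a, b), hab⟩ := by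
        intro h'; apply h2; simpa using h'
      rw [Function.update_of_ne hne]
      have e1 : (if k = a then ((x ⟨(a, b), hab⟩).2 i : ℂ) else 0) *
          (if l = b then ((x ⟨(a, b), hab⟩).2 j : ℂ) else 0) = 0 := by
        by_cases hk : k = a <;> by_cases hl : l = b <;> simp [hk, hl]
        exact absurd ⟨hk, hl⟩ h1
      have e2 : (if k = b then ((x ⟨(a, b), hab⟩).2 i : ℂ) else 0) *
          (if l = a then ((x ⟨(a, b), hab⟩).2 j : ℂ) else 0) = 0 := by
        by_cases hk : k = b <;> by_cases hl : l = a <;> simp [hk, hl]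
        exact absurd ⟨hl, hk⟩ h2
      rw [e1, e2]; simp

theorem vecMul_configRes (z : ℂ) (x : EdgeConfig r d) (w : Fin r × Fin d → ℂ) :
    w ᵥ* configRes z x = configRes z x *ᵥ w := by
  rw [← mulVec_transpose]
  congr 1
  exact transpose_resolventMatrix (configAdj_isHermitian x) z

theorem dotProduct_configRes_comm (z : ℂ) (x : EdgeConfig r d) (v w : Fin r × Fin d → ℂ) :
    v ⬝ᵥ (configRes z x *ᵥ w) = w ⬝ᵥ (configRes z x *ᵥ v) := by
  rw [dotProduct_mulVec, vecMul_configRes, dotProduct_comm]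

theorem configRes_sub_apply {z : ℂ} (hz : z.im ≠ 0) (x : EdgeConfig r d) (e : BlockPair r)
    (p q : Fin r × Fin d) : configRes z x p q - configRes z (Function.update x e 0) p q =
      -((x e).1 : ℂ) *
        ((configRes z x *ᵥ blockVec e.1.1 (x e).2) p *
            (configRes z (Function.update x e 0) *ᵥ blockVec e.1.2 (x e).2) q +
          (configRes z x *ᵥ blockVec e.1.2 (x e).2) p *
            (configRes z (Function.update x e 0) *ᵥ blockVec e.1.1 (x e).2) q) := by
  have h : configRes z x - configRes z (Function.update x e 0) =
      -(configRes z x * (configAdj x - configAdj (Function.update x e 0)).map Complex.ofReal *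
        configRes z (Function.update x e 0)) :=
    resolventMatrix_sub (configAdj_isHermitian x) (configAdj_isHermitian _) hz
  rw [configAdj_sub_update, Matrix.mul_smul, mul_add, mul_vecMulVec, mul_vecMulVec, smul_mul_assoc,
    add_mul, vecMulVec_mul, vecMulVec_mul, vecMul_configRes, vecMul_configRes] at h
  have h' := congrFun (congrFun h p) q
  simp only [Matrix.sub_apply, Matrix.neg_apply, Matrix.smul_apply, Matrix.add_apply,
    vecMulVec_apply, smul_eq_mul] at h'
  rw [neg_mul]
  exact h'

/-- Compared with `configRes_sub_apply`, the two resolvents exchange places. Taking v and w among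
the two block vectors of the edge gives a closed linear system for the forms of the full resolvent,
with forms of the removed-edge resolvent as coefficients. -/
theorem dotProduct_configRes_sub {z : ℂ} (hz : z.im ≠ 0) (x : EdgeConfig r d) (e : BlockPair r)
    (v w : Fin r × Fin d → ℂ) :
    v ⬝ᵥ (configRes z x *ᵥ w) - v ⬝ᵥ (configRes z (Function.update x e 0) *ᵥ w) =
      -((x e).1 : ℂ) *
        ((v ⬝ᵥ (configRes z (Function.update x e 0) *ᵥ blockVec e.1.1 (x e).2)) *
            (blockVec e.1.2 (x e).2 ⬝ᵥ (configRes z x *ᵥ w)) +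
          (v ⬝ᵥ (configRes z (Function.update x e 0) *ᵥ blockVec e.1.2 (x e).2)) *
            (blockVec e.1.1 (x e).2 ⬝ᵥ (configRes z x *ᵥ w))) := by
  set α := blockVec e.1.1 (x e).2
  set β := blockVec e.1.2 (x e).2
  set G := configRes z x
  set G₀ := configRes z (Function.update x e 0)
  have hM : G - G₀ = -(((x e).1 : ℂ) • (vecMulVec (G *ᵥ α) (G₀ *ᵥ β) +
      vecMulVec (G *ᵥ β) (G₀ *ᵥ α))) := by
    ext p q
    have := configRes_sub_apply hz x e p q
    simp only [Matrix.sub_apply, Matrix.neg_apply, Matrix.smul_apply, Matrix.add_apply, vecMulVec_apply, smul_eq_mul]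
    rw [neg_mul] at this
    exact this
  rw [dotProduct_configRes_comm z x v w, dotProduct_configRes_comm z _ v w, ← dotProduct_sub,
    ← sub_mulVec, hM]
  simp only [neg_mulVec, smul_mulVec, add_mulVec, vecMulVec_mulVec, dotProduct_neg, dotProduct_smul,
    dotProduct_add, smul_eq_mul, op_smul_eq_smul]
  rw [dotProduct_comm (G₀ *ᵥ α) v, dotProduct_comm (G₀ *ᵥ β) v,
    dotProduct_configRes_comm z x w α, dotProduct_configRes_comm z x w β]
  ring

theorem sqSum_configRes_blockVec_le {z : ℂ} (hz : z.im ≠ 0) (x : EdgeConfig r d) (k : Fin r)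
    (u : EuclideanSpace ℝ (Fin d)) :
    sqSum (configRes z x *ᵥ blockVec k u) ≤ ‖u‖ ^ 2 / z.im ^ 2 := by
  rw [← sqSum_blockVec k u]
  exact sqSum_resolventMatrix_mulVec_le (configAdj_isHermitian x) hz _

theorem norm_dotProduct_configRes_le {z : ℂ} (hz : z.im ≠ 0) (x : EdgeConfig r d) (k l : Fin r)
    (u : EuclideanSpace ℝ (Fin d)) :
    ‖blockVec k u ⬝ᵥ (configRes z x *ᵥ blockVec l u)‖ ≤ ‖u‖ ^ 2 / |z.im| := by
  refine (pow_le_pow_iff_left₀ (norm_nonneg _) (by positivity) two_ne_zero).1 ?_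
  refine (norm_dotProduct_sq_le _ _).trans ?_
  rw [sqSum_blockVec, div_pow, sq_abs, sq (‖u‖ ^ 2), mul_div_assoc]
  exact mul_le_mul_of_nonneg_left (sqSum_configRes_blockVec_le hz x l u) (by positivity)

/-- The trace of the `(k, l)` block. -/
def blockTrace (M : Matrix (Fin r × Fin d) (Fin r × Fin d) ℂ) (k l : Fin r) : ℂ :=
  ∑ i, M (k, i) (l, i)

/-- Keeping only the mass in block k, instead of the whole norm, makes the sum of these bounds over
k independent of r. -/
theorem norm_blockTrace_sub_sq_le {z : ℂ} (hz : z.im ≠ 0) (x : EdgeConfig r d) (e : BlockPair r)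
    (k l : Fin r) :
    ‖blockTrace (configRes z x) k l - blockTrace (configRes z (Function.update x e 0)) k l‖ ^ 2 ≤
      2 * (x e).1 ^ 2 * (‖(x e).2‖ ^ 2 / z.im ^ 2) *
        (blockSqSum k (configRes z x *ᵥ blockVec e.1.1 (x e).2) +
          blockSqSum k (configRes z x *ᵥ blockVec e.1.2 (x e).2)) := by
  set α := blockVec e.1.1 (x e).2
  set β := blockVec e.1.2 (x e).2
  set G := configRes z x
  set G₀ := configRes z (Function.update x e 0)
  have h1 : blockTrace G k l - blockTrace G₀ k l = -((x e).1 : ℂ) *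
      (∑ i, (G *ᵥ α) (k, i) * (G₀ *ᵥ β) (l, i) + ∑ i, (G *ᵥ β) (k, i) * (G₀ *ᵥ α) (l, i)) := by
    rw [blockTrace, blockTrace, ← Finset.sum_sub_distrib, ← Finset.sum_add_distrib, Finset.mul_sum]
    exact Finset.sum_congr rfl fun i _ => configRes_sub_apply hz x e _ _
  have hα := (blockSqSum_le l _).trans (sqSum_configRes_blockVec_le hz (Function.update x e 0) e.1.1 (x e).2)
  have hβ := (blockSqSum_le l _).trans (sqSum_configRes_blockVec_le hz (Function.update x e 0) e.1.2 (x e).2)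
  have h2 := norm_block_sum_sq_le k l (G *ᵥ α) (G₀ *ᵥ β)
  have h3 := norm_block_sum_sq_le k l (G *ᵥ β) (G₀ *ᵥ α)
  have h4 := h2.trans (mul_le_mul_of_nonneg_left hβ (blockSqSum_nonneg k (G *ᵥ α)))
  have h5 := h3.trans (mul_le_mul_of_nonneg_left hα (blockSqSum_nonneg k (G *ᵥ β)))
  rw [h1, norm_mul, mul_pow, norm_neg, Complex.norm_real, Real.norm_eq_abs, sq_abs]
  set S := ∑ i, (G *ᵥ α) (k, i) * (G₀ *ᵥ β) (l, i)
  set T := ∑ i, (G *ᵥ β) (k, i) * (G₀ *ᵥ α) (l, i)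
  have h6 : ‖S + T‖ ^ 2 ≤ 2 * (‖S‖ ^ 2 + ‖T‖ ^ 2) := by
    have := norm_add_le S T
    nlinarith [sq_nonneg (‖S‖ - ‖T‖), norm_nonneg (S + T), norm_nonneg S, norm_nonneg T]
  have h7 : ‖S + T‖ ^ 2 ≤ 2 * (blockSqSum k (G *ᵥ α) * (‖(x e).2‖ ^ 2 / z.im ^ 2) +
      blockSqSum k (G *ᵥ β) * (‖(x e).2‖ ^ 2 / z.im ^ 2)) :=
    h6.trans (by gcongr)
  refine (mul_le_mul_of_nonneg_left h7 (sq_nonneg (x e).1)).trans (le_of_eq ?_)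
  ring

theorem sum_norm_blockTrace_sub_sq_le {z : ℂ} (hz : z.im ≠ 0) (x : EdgeConfig r d)
    (e : BlockPair r) :
    ∑ k, ‖blockTrace (configRes z x) k k - blockTrace (configRes z (Function.update x e 0)) k k‖ ^ 2
      ≤ 4 * (x e).1 ^ 2 * (‖(x e).2‖ ^ 2 / z.im ^ 2) ^ 2 := by
  refine (Finset.sum_le_sum fun k _ => norm_blockTrace_sub_sq_le hz x e k k).trans ?_
  rw [← Finset.mul_sum, Finset.sum_add_distrib, sum_blockSqSum, sum_blockSqSum]
  have hα := sqSum_configRes_blockVec_le hz x e.1.1 (x e).2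
  have hβ := sqSum_configRes_blockVec_le hz x e.1.2 (x e).2
  refine (mul_le_mul_of_nonneg_left (add_le_add hα hβ) (by positivity)).trans (le_of_eq ?_)
  ring

theorem norm_blockTrace_sub_le {z : ℂ} (hz : z.im ≠ 0) (x : EdgeConfig r d) (e : BlockPair r)
    (k l : Fin r) :
    ‖blockTrace (configRes z x) k l - blockTrace (configRes z (Function.update x e 0)) k l‖ ≤
      2 * |(x e).1| * (‖(x e).2‖ ^ 2 / z.im ^ 2) := by
  refine (pow_le_pow_iff_left₀ (norm_nonneg _) (by positivity) two_ne_zero).1 ?_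
  refine (norm_blockTrace_sub_sq_le hz x e k l).trans ?_
  have hα := (blockSqSum_le k _).trans (sqSum_configRes_blockVec_le hz x e.1.1 (x e).2)
  have hβ := (blockSqSum_le k _).trans (sqSum_configRes_blockVec_le hz x e.1.2 (x e).2)
  refine (mul_le_mul_of_nonneg_left (add_le_add hα hβ) (by positivity)).trans (le_of_eq ?_)
  rw [mul_pow, mul_pow, sq_abs]
  ring

/-- Cauchy–Schwarz over the d diagonal entries of each block, then the Hilbert–Schmidt bound. After
division by d² the r² squares add up to O(r), so off-diagonal block traces are small on average. -/
theorem sum_norm_blockTrace_sq_le {z : ℂ} (hz : z.im ≠ 0) (x : EdgeConfig r d) :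
    ∑ k, ∑ l, ‖blockTrace (configRes z x) k l‖ ^ 2 ≤ d * (r * d / z.im ^ 2) := by
  have h := sum_norm_sq_resolventMatrix_le (configAdj_isHermitian x) hz
  simp only [Fintype.card_prod, Fintype.card_fin, Nat.cast_mul] at h
  refine le_trans ?_ (mul_le_mul_of_nonneg_left h (Nat.cast_nonneg d))
  simp only [Fintype.sum_prod_type, Finset.mul_sum]
  refine Finset.sum_le_sum fun k _ => ?_
  rw [Finset.sum_comm]
  refine Finset.sum_le_sum fun l _ => ?_
  have h1 : ‖blockTrace (configRes z x) k l‖ ^ 2 ≤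
      d * ∑ i, ‖configRes z x (k, i) (l, i)‖ ^ 2 := by
    have h2 : ‖blockTrace (configRes z x) k l‖ ≤ ∑ i, ‖configRes z x (k, i) (l, i)‖ :=
      norm_sum_le _ _
    refine (pow_le_pow_left₀ (norm_nonneg _) h2 2).trans ?_
    simpa using sq_sum_le_card_mul_sum_sq (s := Finset.univ)
      (f := fun i => ‖configRes z x (k, i) (l, i)‖)
  refine h1.trans ?_
  rw [Finset.mul_sum]
  refine Finset.sum_le_sum fun i _ => ?_
  exact Finset.single_le_sum (f := fun j => (d : ℝ) * ‖configRes z x (k, i) (l, j)‖ ^ 2)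
    (fun j _ => by positivity) (Finset.mem_univ i)

theorem norm_blockTrace_le {z : ℂ} (hz : z.im ≠ 0) (x : EdgeConfig r d) (k l : Fin r) :
    ‖blockTrace (configRes z x) k l‖ ≤ d * |z.im|⁻¹ := by
  refine (norm_sum_le _ _).trans ((Finset.sum_le_sum fun i _ =>
    norm_resolventMatrix_apply_le (configAdj_isHermitian x) hz _ _).trans (le_of_eq ?_))
  simp

theorem trace_eq_sum_blockTrace (M : Matrix (Fin r × Fin d) (Fin r × Fin d) ℂ) :
    M.trace = ∑ k, blockTrace M k k := by
  simp [Matrix.trace, blockTrace, Fintype.sum_prod_type]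

end Blocks

/-! ### Algebra of the linear system across one edge. -/

/-- The limiting value of the off-diagonal form across an edge, up to sign. -/
noncomputable def edgeFun (g g' : ℂ) : ℂ := g * g' / (1 - g * g')

theorem edgeFun_comm (g g' : ℂ) : edgeFun g g' = edgeFun g' g := by
  simp [edgeFun, mul_comm g g']

theorem norm_mul_le_of_norm_le_quarter {g g' : ℂ} (hg : ‖g‖ ≤ 1 / 4) (hg' : ‖g'‖ ≤ 1 / 4) :
    ‖g * g'‖ ≤ 1 / 16 := by
  rw [norm_mul]
  have := mul_le_mul hg hg' (norm_nonneg _) (by norm_num)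
  linarith

theorem le_norm_one_sub_mul {g g' : ℂ} (hg : ‖g‖ ≤ 1 / 4) (hg' : ‖g'‖ ≤ 1 / 4) :
    15 / 16 ≤ ‖1 - g * g'‖ := by
  have h1 := norm_mul_le_of_norm_le_quarter hg hg'
  have h2 := norm_sub_norm_le (1 : ℂ) (g * g')
  rw [norm_one] at h2
  linarith

/-- Here a, b, a' are forms of the removed-edge resolvent and y, t forms of the full one. The system
has determinant (1 + b)² - aa' and solution y = (b(1 + b) - aa')/((1 + b)² - aa'), which becomes
-gg'/(1 - gg') at b = 0, a = g, a' = g'. The bounds 1/4 keep both denominators away from zero. -/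
theorem norm_form_add_edgeFun_le {a b a' y t g g' : ℂ} (hy : y - b = -(a * t + b * y))
    (ht : t - a' = -(b * t + a' * y)) (ha : ‖a‖ ≤ 1 / 4) (hb : ‖b‖ ≤ 1 / 4) (ha' : ‖a'‖ ≤ 1 / 4)
    (hg : ‖g‖ ≤ 1 / 4) (hg' : ‖g'‖ ≤ 1 / 4) :
    ‖y + edgeFun g g'‖ ≤ 4 * (‖b‖ + ‖a - g‖ + ‖a' - g'‖) := by
  have hden1 : 15 / 16 ≤ ‖1 - g * g'‖ := le_norm_one_sub_mul hg hg'
  have hgg := norm_mul_le_of_norm_le_quarter hg hg'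
  have haa := norm_mul_le_of_norm_le_quarter ha ha'
  have h1b : 3 / 4 ≤ ‖1 + b‖ := by
    have := norm_sub_norm_le (1 : ℂ) (-b)
    rw [norm_one, norm_neg, sub_neg_eq_add] at this
    linarith
  have hden2 : 1 / 2 ≤ ‖(1 + b) ^ 2 - a * a'‖ := by
    have := norm_sub_norm_le ((1 + b) ^ 2) (a * a')
    rw [norm_pow] at this
    nlinarith
  have hne : (1 - g * g') ≠ 0 := norm_pos_iff.1 (by linarith)
  have hmul : (y + edgeFun g g') * (((1 + b) ^ 2 - a * a') * (1 - g * g')) =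
      b * ((1 + b) * (1 - g * g') + g * g' * (2 + b)) + (g * (g' - a') + a' * (g - a)) := by
    unfold edgeFun
    have hy2 : y * ((1 + b) ^ 2 - a * a') = b * (1 + b) - a * a' := by
      linear_combination (1 + b) * hy - a * ht
    have : (y + g * g' / (1 - g * g')) * (((1 + b) ^ 2 - a * a') * (1 - g * g')) =
        (y * ((1 + b) ^ 2 - a * a')) * (1 - g * g') + g * g' * ((1 + b) ^ 2 - a * a') := by
      field_simp
    rw [this, hy2]; ring
  have hnum : ‖b * ((1 + b) * (1 - g * g') + g * g' * (2 + b)) + (g * (g' - a') + a' * (g - a))‖ ≤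
      ‖b‖ * (3 / 2) + (1 / 4 * ‖a' - g'‖ + 1 / 4 * ‖a - g‖) := by
    have u1 : ‖1 + b‖ ≤ 5 / 4 := (norm_add_le _ _).trans (by rw [norm_one]; linarith)
    have u2 : ‖1 - g * g'‖ ≤ 17 / 16 := (norm_sub_le _ _).trans (by rw [norm_one]; linarith)
    have u3 : ‖2 + b‖ ≤ 9 / 4 := (norm_add_le _ _).trans (by
      rw [show ‖(2 : ℂ)‖ = 2 by simp]; linarith)
    have u4 : ‖(1 + b) * (1 - g * g') + g * g' * (2 + b)‖ ≤ 3 / 2 := by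
      refine (norm_add_le _ _).trans ?_
      rw [norm_mul, norm_mul (g * g')]
      have := mul_le_mul u1 u2 (norm_nonneg _) (by norm_num)
      have := mul_le_mul hgg u3 (norm_nonneg _) (by norm_num)
      linarith
    refine (norm_add_le _ _).trans (add_le_add ?_ ((norm_add_le _ _).trans (add_le_add ?_ ?_)))
    · rw [norm_mul]; gcongr
    · rw [norm_mul, norm_sub_rev g' a']; gcongr
    · rw [norm_mul, norm_sub_rev g a]; gcongr
  rw [← hmul, norm_mul, norm_mul] at hnum
  have hprod : 15 / 32 ≤ ‖(1 + b) ^ 2 - a * a'‖ * ‖1 - g * g'‖ := by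
    have := mul_le_mul hden2 hden1 (by norm_num) (norm_nonneg _)
    linarith
  have h3 : ‖y + edgeFun g g'‖ * (15 / 32) ≤
      ‖b‖ * (3 / 2) + (1 / 4 * ‖a' - g'‖ + 1 / 4 * ‖a - g‖) :=
    (mul_le_mul_of_nonneg_left hprod (norm_nonneg _)).trans hnum
  linarith [norm_nonneg b, norm_nonneg (a - g), norm_nonneg (a' - g')]

theorem norm_edgeFun_le {g g' : ℂ} (hg : ‖g‖ ≤ 1 / 4) (hg' : ‖g'‖ ≤ 1 / 4) :
    ‖edgeFun g g'‖ ≤ 1 := by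
  unfold edgeFun
  rw [norm_div, div_le_one (by linarith [le_norm_one_sub_mul hg hg'])]
  linarith [le_norm_one_sub_mul hg hg', norm_mul_le_of_norm_le_quarter hg hg']

/-- The Lipschitz constant 1/2 is what the stability argument compares with |z|. -/
theorem norm_edgeFun_sub_le {g g' w w' : ℂ} (hg : ‖g‖ ≤ 1 / 4) (hg' : ‖g'‖ ≤ 1 / 4)
    (hw : ‖w‖ ≤ 1 / 4) (hw' : ‖w'‖ ≤ 1 / 4) :
    ‖edgeFun g g' - edgeFun w w'‖ ≤ (‖g - w‖ + ‖g' - w'‖) / 2 := by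
  have d1 := le_norm_one_sub_mul hg hg'
  have d2 := le_norm_one_sub_mul hw hw'
  have n1 : (1 - g * g') ≠ 0 := norm_pos_iff.1 (by linarith)
  have n2 : (1 - w * w') ≠ 0 := norm_pos_iff.1 (by linarith)
  have h : (edgeFun g g' - edgeFun w w') * ((1 - g * g') * (1 - w * w')) =
      (g - w) * g' + w * (g' - w') := by
    unfold edgeFun
    field_simp
    ring
  have hn : ‖(g - w) * g' + w * (g' - w')‖ ≤ ‖g - w‖ * (1 / 4) + 1 / 4 * ‖g' - w'‖ := by
    refine (norm_add_le _ _).trans (add_le_add ?_ ?_) <;> rw [norm_mul] <;> gcongr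
  rw [← h, norm_mul, norm_mul] at hn
  have hp : 1 / 2 ≤ ‖1 - g * g'‖ * ‖1 - w * w'‖ := by
    have := mul_le_mul d1 d2 (by norm_num) (norm_nonneg _)
    linarith
  have := (mul_le_mul_of_nonneg_left hp (norm_nonneg _)).trans hn
  linarith

/-! ### Edge forms, the trace identity and real quadratic forms. -/

section Blocks

open Matrix

variable {r d : ℕ}

/-- The resolvent form `⟨e_k ⊗ v, G (e_l ⊗ v)⟩` across the edge `e = (k, l)`. -/
noncomputable def edgeForm (z : ℂ) (x : EdgeConfig r d) (e : BlockPair r) : ℂ :=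
  blockVec e.1.1 (x e).2 ⬝ᵥ (configRes z x *ᵥ blockVec e.1.2 (x e).2)

/-- The form `⟨e_k ⊗ v, G⁰ (e_l ⊗ v)⟩` of the resolvent with the edge `e` removed. -/
noncomputable def removedForm (z : ℂ) (e : BlockPair r) (k l : Fin r) (x : EdgeConfig r d) : ℂ :=
  blockVec k (x e).2 ⬝ᵥ (configRes z (Function.update x e 0) *ᵥ blockVec l (x e).2)

/-- An absent edge contributes nothing; a present one gives the linear system. The factor ξ stays on
the right because its expectation later supplies the factor p. -/
theorem norm_edgeForm_add_edgeFun_le {z : ℂ} (hz : z.im ≠ 0) (x : EdgeConfig r d)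
    (e : BlockPair r) (h01 : (x e).1 = 0 ∨ (x e).1 = 1) (hv : ‖(x e).2‖ ^ 2 ≤ |z.im| / 4)
    {g g' : ℂ} (hg : ‖g‖ ≤ 1 / 4) (hg' : ‖g'‖ ≤ 1 / 4) :
    ‖((x e).1 : ℂ) * edgeForm z x e + (x e).1 * edgeFun g g'‖ ≤
      (x e).1 * (4 * (‖removedForm z e e.1.1 e.1.2 x‖ + ‖removedForm z e e.1.1 e.1.1 x - g‖ +
        ‖removedForm z e e.1.2 e.1.2 x - g'‖)) := by
  have hbd : ∀ k l, ‖removedForm z e k l x‖ ≤ 1 / 4 := fun k l => by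
    refine (norm_dotProduct_configRes_le hz _ k l (x e).2).trans ?_
    rw [div_le_iff₀ (abs_pos.2 hz)]
    linarith
  rcases h01 with h0 | h1
  · simp [h0]
  · have e1 := dotProduct_configRes_sub hz x e (blockVec e.1.1 (x e).2) (blockVec e.1.2 (x e).2)
    have e2 := dotProduct_configRes_sub hz x e (blockVec e.1.2 (x e).2) (blockVec e.1.2 (x e).2)
    rw [dotProduct_configRes_comm z (Function.update x e 0) (blockVec e.1.2 (x e).2)
      (blockVec e.1.1 (x e).2)] at e2
    rw [h1]
    simp only [h1, Complex.ofReal_one, neg_one_mul, one_mul] at e1 e2 ⊢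
    exact norm_form_add_edgeFun_le e1 e2 (hbd _ _) (hbd _ _) (hbd _ _) hg hg'

/-- The contribution of the block `(k, l)` to the trace of the `k`-th diagonal block of `A G`. -/
noncomputable def offTerm (z : ℂ) (x : EdgeConfig r d) (k l : Fin r) : ℂ :=
  ∑ i, ∑ j, (configAdj x (k, i) (l, j) : ℂ) * configRes z x (l, j) (k, i)

/-- The identity zG = AG - 1 traced over the k-th diagonal block. -/
theorem mul_blockTrace_configRes {z : ℂ} (hz : z.im ≠ 0) (x : EdgeConfig r d) (k : Fin r) :
    z * blockTrace (configRes z x) k k = -d + ∑ l, offTerm z x k l := by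
  have h := smul_resolventMatrix (configAdj_isHermitian x) hz
  have h1 : ∀ i, z * configRes z x (k, i) (k, i) =
      (∑ l, ∑ j, (configAdj x (k, i) (l, j) : ℂ) * configRes z x (l, j) (k, i)) - 1 := by
    intro i
    have := congrFun (congrFun h (k, i)) (k, i)
    rw [Matrix.smul_apply, Matrix.sub_apply, mul_apply, Fintype.sum_prod_type, one_apply_eq] at this
    exact this
  rw [blockTrace, Finset.mul_sum]
  simp_rw [h1]
  rw [Finset.sum_sub_distrib, Finset.sum_comm]
  simp only [offTerm, Finset.sum_const, Finset.card_univ, Fintype.card_fin, nsmul_eq_mul, mul_one]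
  ring

theorem offTerm_self (z : ℂ) (x : EdgeConfig r d) (k : Fin r) : offTerm z x k k = 0 := by
  simp [offTerm, configAdj_apply_self]

theorem offTerm_of_lt (z : ℂ) (x : EdgeConfig r d) {k l : Fin r} (h : k < l) :
    offTerm z x k l = ((x ⟨(k, l), h⟩).1 : ℂ) * edgeForm z x ⟨(k, l), h⟩ := by
  rw [edgeForm, blockVec_dotProduct_mulVec, Finset.mul_sum]
  simp only [offTerm, configAdj_apply_of_lt x h, Finset.mul_sum]
  refine Finset.sum_congr rfl fun i _ => Finset.sum_congr rfl fun j _ => ?_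
  rw [configRes_apply_comm z x (l, j)]
  push_cast; ring

theorem offTerm_of_gt (z : ℂ) (x : EdgeConfig r d) {k l : Fin r} (h : l < k) :
    offTerm z x k l = ((x ⟨(l, k), h⟩).1 : ℂ) * edgeForm z x ⟨(l, k), h⟩ := by
  rw [edgeForm, blockVec_dotProduct_mulVec, Finset.mul_sum]
  simp only [offTerm, configAdj_apply_of_gt x h, Finset.mul_sum]
  rw [Finset.sum_comm]
  refine Finset.sum_congr rfl fun i _ => Finset.sum_congr rfl fun j _ => ?_
  push_cast; ring

/-- The `(k, l)` block of the resolvent, with a real-linear functional applied to its entries. -/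
noncomputable def realBlock (φ : ℂ →ₗ[ℝ] ℝ) (z : ℂ) (x : EdgeConfig r d) (k l : Fin r) :
    Matrix (Fin d) (Fin d) ℝ := of fun i j => φ (configRes z x (k, i) (l, j))

/-- Concentration is assumed for real matrices only, so real and imaginary parts of a block are
treated separately. On real vectors a real functional dominated by the modulus commutes with the
matrix action, so the resolvent bound survives. -/
theorem norm_realBlock_le {φ : ℂ →ₗ[ℝ] ℝ} (hφ : ∀ w, |φ w| ≤ ‖w‖) {z : ℂ} (hz : z.im ≠ 0)
    (x : EdgeConfig r d) (k l : Fin r) :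
    ‖toEuclideanCLM (n := Fin d) (𝕜 := ℝ) (realBlock φ z x k l)‖ ≤ |z.im|⁻¹ := by
  refine ContinuousLinearMap.opNorm_le_bound _ (by positivity) fun u => ?_
  refine (pow_le_pow_iff_left₀ (norm_nonneg _) (by positivity) two_ne_zero).1 ?_
  have h1 := (blockSqSum_le k _).trans (sqSum_configRes_blockVec_le hz x l u)
  rw [mul_pow, inv_pow, sq_abs, EuclideanSpace.norm_sq_eq, inv_mul_eq_div]
  refine le_trans (Finset.sum_le_sum fun i _ => ?_) h1
  have h2 : (toEuclideanCLM (n := Fin d) (𝕜 := ℝ) (realBlock φ z x k l) u) i =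
      φ ((configRes z x *ᵥ blockVec l u) (k, i)) := by
    rw [ofLp_toEuclideanCLM]
    simp only [mulVec, dotProduct, Fintype.sum_prod_type, realBlock, of_apply]
    rw [Finset.sum_eq_single l]
    · rw [map_sum]
      refine Finset.sum_congr rfl fun j _ => ?_
      have : configRes z x (k, i) (l, j) * blockVec l u (l, j) =
          (u j) • configRes z x (k, i) (l, j) := by
        simp [blockVec, mul_comm]
      rw [this, map_smul, smul_eq_mul, mul_comm]
    · intro b _ hb
      simp [blockVec, hb]
    · simp
  rw [h2]
  exact pow_le_pow_left₀ (norm_nonneg _) (hφ _) 2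

theorem inner_toEuclideanCLM_self (D : Matrix (Fin d) (Fin d) ℝ) (u : EuclideanSpace ℝ (Fin d)) :
    inner ℝ (toEuclideanCLM (n := Fin d) (𝕜 := ℝ) D u) u = ∑ i, ∑ j, D i j * (u i * u j) := by
  rw [PiLp.inner_apply]
  refine Finset.sum_congr rfl fun i _ => ?_
  rw [ofLp_toEuclideanCLM]
  simp only [mulVec, dotProduct, RCLike.inner_apply, conj_trivial, Finset.mul_sum]
  exact Finset.sum_congr rfl fun j _ => by ring

/-- The removed-edge resolvent does not involve the vector of e: with the other edges fixed, this is
a quadratic form in that vector with a deterministic matrix. -/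
theorem map_removedForm (φ : ℂ →ₗ[ℝ] ℝ) (z : ℂ) (e : BlockPair r) (k l : Fin r)
    (x : EdgeConfig r d) : φ (removedForm z e k l x) =
      inner ℝ (toEuclideanCLM (n := Fin d) (𝕜 := ℝ)
        (realBlock φ z (Function.update x e 0) k l) (x e).2) (x e).2 := by
  rw [removedForm, blockVec_dotProduct_mulVec, inner_toEuclideanCLM_self]
  simp only [map_sum, realBlock, of_apply]
  refine Finset.sum_congr rfl fun i _ => Finset.sum_congr rfl fun j _ => ?_
  rw [← Complex.ofReal_mul, ← Complex.real_smul, map_smul, smul_eq_mul, mul_comm]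

theorem map_blockTrace (φ : ℂ →ₗ[ℝ] ℝ) (z : ℂ) (k l : Fin r) (x : EdgeConfig r d) :
    φ (blockTrace (configRes z x) k l) = (realBlock φ z x k l).trace := by
  simp [blockTrace, Matrix.trace, realBlock]

theorem continuous_configAdj : Continuous (configAdj : EdgeConfig r d → _) := by
  refine continuous_matrix fun p q => ?_
  obtain ⟨k, i⟩ := p
  obtain ⟨l, j⟩ := q
  rcases lt_trichotomy k l with h | h | h
  · simp only [configAdj_apply_of_lt _ h]; fun_prop
  · subst h; simp only [configAdj_apply_self]; fun_prop
  · simp only [configAdj_apply_of_gt _ h]; fun_prop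

theorem continuous_configRes {z : ℂ} (hz : z.im ≠ 0) :
    Continuous (configRes z : EdgeConfig r d → _) :=
  continuous_resolventMatrix continuous_configAdj configAdj_isHermitian hz

theorem continuous_blockTrace {z : ℂ} (hz : z.im ≠ 0) (k l : Fin r) :
    Continuous fun x : EdgeConfig r d => blockTrace (configRes z x) k l :=
  continuous_finsetSum _ fun _ _ => (continuous_configRes hz).matrix_elem _ _

theorem continuous_blockTrace_update {z : ℂ} (hz : z.im ≠ 0) (e : BlockPair r) (k l : Fin r) :
    Continuous fun x : EdgeConfig r d => blockTrace (configRes z (Function.update x e 0)) k l :=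
  (continuous_blockTrace hz k l).comp (continuous_id.update e continuous_const)

theorem continuous_blockVec (k : Fin r) :
    Continuous (blockVec k : EuclideanSpace ℝ (Fin d) → _) := by
  refine continuous_pi fun q => ?_
  unfold blockVec
  split_ifs <;> fun_prop

theorem continuous_removedForm {z : ℂ} (hz : z.im ≠ 0) (e : BlockPair r) (k l : Fin r) :
    Continuous fun x : EdgeConfig r d => removedForm z e k l x := by
  have h1 : ∀ k : Fin r, Continuous fun x : EdgeConfig r d => blockVec k (x e).2 := fun k =>
    (continuous_blockVec k).comp (by fun_prop)
  have h2 : Continuous fun x : EdgeConfig r d => configRes z (Function.update x e 0) :=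
    (continuous_configRes hz).comp (continuous_id.update e continuous_const)
  exact (h1 k).dotProduct (h2.matrix_mulVec (h1 l))

theorem continuous_edgeForm {z : ℂ} (hz : z.im ≠ 0) (e : BlockPair r) :
    Continuous fun x : EdgeConfig r d => edgeForm z x e := by
  have h1 : ∀ k : Fin r, Continuous fun x : EdgeConfig r d => blockVec k (x e).2 := fun k =>
    (continuous_blockVec k).comp (by fun_prop)
  exact (h1 _).dotProduct ((continuous_configRes hz).matrix_mulVec (h1 _))

end Blocks

/-! ### Edge laws and concentration of the removed-edge forms. -/

theorem sq_integral_le_integral_sq {α : Type*} [MeasurableSpace α] {μ : Measure α}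
    [IsProbabilityMeasure μ] {f : α → ℝ} (hf : AEStronglyMeasurable f μ) {B : ℝ}
    (hB : ∀ᵐ x ∂μ, |f x| ≤ B) : (∫ x, f x ∂μ) ^ 2 ≤ ∫ x, f x ^ 2 ∂μ := by
  have h : MemLp f 2 μ := MemLp.of_bound hf B hB
  have := variance_eq_sub h
  have h2 := variance_nonneg f μ
  simp only [Pi.pow_apply] at this
  linarith

theorem integral_le_sqrt_integral_sq {α : Type*} [MeasurableSpace α] {μ : Measure α}
    [IsProbabilityMeasure μ] {f : α → ℝ} (hf : AEStronglyMeasurable f μ) {B : ℝ}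
    (hB : ∀ᵐ x ∂μ, |f x| ≤ B) : ∫ x, f x ∂μ ≤ √(∫ x, f x ^ 2 ∂μ) :=
  Real.le_sqrt_of_sq_le (sq_integral_le_integral_sq hf hB)

section Law

set_option linter.unusedSectionVars false

open Matrix

variable {r d : ℕ}

/-- The laws of the independent edge variables: a `0/1` variable of mean `p` and an isotropic
vector of norm at most `C`, whose quadratic forms have variance at most `δ`. -/
structure IsEdgeLaw (μ : BlockPair r → Measure ℝ) (ν : BlockPair r → Measure (EuclideanSpace ℝ (Fin d)))
    (p C δ : ℝ) : Prop where
  zero_or_one : ∀ e, ∀ᵐ t ∂(μ e), t = 0 ∨ t = 1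
  mean : ∀ e, ∫ t, t ∂(μ e) = p
  norm_le : ∀ e, ∀ᵐ u ∂(ν e), ‖u‖ ≤ C
  isotropic : ∀ e (i j : Fin d), ∫ u, u i * u j ∂(ν e) = if i = j then (d : ℝ)⁻¹ else 0
  variance_le : ∀ e (D : Matrix (Fin d) (Fin d) ℝ),
    ‖toEuclideanCLM (n := Fin d) (𝕜 := ℝ) D‖ = 1 →
      variance (fun u => inner ℝ (toEuclideanCLM (n := Fin d) (𝕜 := ℝ) D u) u) (ν e) ≤ δ

/-- The law of the whole configuration. -/
noncomputable def configLaw (μ : BlockPair r → Measure ℝ)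
    (ν : BlockPair r → Measure (EuclideanSpace ℝ (Fin d))) : Measure (EdgeConfig r d) :=
  Measure.pi fun e => (μ e).prod (ν e)

variable {μ : BlockPair r → Measure ℝ} {ν : BlockPair r → Measure (EuclideanSpace ℝ (Fin d))}
  [∀ e, IsProbabilityMeasure (μ e)] [∀ e, IsProbabilityMeasure (ν e)] {p C δ : ℝ}

instance : IsProbabilityMeasure (configLaw μ ν) := by
  unfold configLaw; infer_instance

theorem IsEdgeLaw.ae_good (h : IsEdgeLaw μ ν p C δ) (e : BlockPair r) :
    ∀ᵐ x ∂(configLaw μ ν), ((x e).1 = 0 ∨ (x e).1 = 1) ∧ ‖(x e).2‖ ≤ C := by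
  have h1 : ∀ᵐ y ∂((μ e).prod (ν e)), (y.1 = 0 ∨ y.1 = 1) ∧ ‖y.2‖ ≤ C :=
    (Measure.quasiMeasurePreserving_fst.ae (h.zero_or_one e)).and
      (Measure.quasiMeasurePreserving_snd.ae (h.norm_le e))
  exact (Measure.tendsto_eval_ae_ae (μ := fun e => (μ e).prod (ν e)) (i := e)).eventually h1

theorem integrable_of_continuous_of_ae_le {E : Type*} [NormedAddCommGroup E]
    [SecondCountableTopology E] [MeasurableSpace E] [BorelSpace E] {f : EdgeConfig r d → E}
    (hf : Continuous f) {B : ℝ}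
    (hB : ∀ᵐ x ∂(configLaw μ ν), ‖f x‖ ≤ B) : Integrable f (configLaw μ ν) :=
  Integrable.of_bound hf.aestronglyMeasurable B hB

/-- The function may depend on the vector of e but not on its Bernoulli variable, so independence
factors out the mean p. -/
theorem integral_edge_mul {f : EdgeConfig r d → ℝ} (hf : Integrable f (configLaw μ ν))
    (e : BlockPair r) (hft : Integrable (fun x => (x e).1 * f x) (configLaw μ ν))
    (hmean : ∫ t, t ∂(μ e) = p)
    (hinv : ∀ x t u, f (Function.update x e (t, u)) = f (Function.update x e (0, u))) :
    ∫ x, (x e).1 * f x ∂(configLaw μ ν) = p * ∫ x, f x ∂(configLaw μ ν) := by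
  have h1 := integral_resample (fun e => (μ e).prod (ν e)) e hft
  have h2 := integral_resample (fun e => (μ e).prod (ν e)) e hf
  unfold configLaw
  rw [h1, h2, ← integral_const_mul]
  refine integral_congr_ae (Eventually.of_forall fun x => ?_)
  simp only [Function.update_self]
  have e1 : ∀ y : ℝ × EuclideanSpace ℝ (Fin d), y.1 * f (Function.update x e y) =
      y.1 * (fun u => f (Function.update x e (0, u))) y.2 := fun y => by
    simp only
    rw [← hinv x y.1 y.2]
  have e2 : ∀ y : ℝ × EuclideanSpace ℝ (Fin d), f (Function.update x e y) =
      1 * (fun u => f (Function.update x e (0, u))) y.2 := fun y => by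
    rw [one_mul]; exact hinv x y.1 y.2
  have h3 := (integral_congr_ae (Eventually.of_forall e1)).trans
    (integral_prod_mul (μ := μ e) (ν := ν e) (fun t : ℝ => t) fun u => f (Function.update x e (0, u)))
  have h4 := (integral_congr_ae (Eventually.of_forall e2)).trans
    (integral_prod_mul (μ := μ e) (ν := ν e) (fun _ : ℝ => (1 : ℝ))
      fun u => f (Function.update x e (0, u)))
  rw [h3, h4, hmean]
  simp

theorem IsEdgeLaw.variance_le_mul_sq (h : IsEdgeLaw μ ν p C δ) (e : BlockPair r)
    (D : Matrix (Fin d) (Fin d) ℝ) :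
    variance (fun u => inner ℝ (toEuclideanCLM (n := Fin d) (𝕜 := ℝ) D u) u) (ν e) ≤
      ‖toEuclideanCLM (n := Fin d) (𝕜 := ℝ) D‖ ^ 2 * δ := by
  set κ := ‖toEuclideanCLM (n := Fin d) (𝕜 := ℝ) D‖ with hκ
  rcases eq_or_ne κ 0 with h0 | h0
  · have : toEuclideanCLM (n := Fin d) (𝕜 := ℝ) D = 0 := norm_eq_zero.1 (hκ ▸ h0)
    rw [this, h0]
    simp only [_root_.zero_apply, inner_zero_left]
    simp [variance_eq_integral aemeasurable_const]
  · have h1 := h.variance_le e (κ⁻¹ • D) (by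
      rw [map_smul, norm_smul, ← hκ, norm_inv, hκ, norm_norm, ← hκ]
      exact inv_mul_cancel₀ h0)
    have h2 : (fun u => inner ℝ (toEuclideanCLM (n := Fin d) (𝕜 := ℝ) (κ⁻¹ • D) u) u) =
        fun u => κ⁻¹ * inner ℝ (toEuclideanCLM (n := Fin d) (𝕜 := ℝ) D u) u := by
      funext u
      rw [map_smul, _root_.smul_apply, real_inner_smul_left]
    rw [h2, variance_const_mul, inv_pow, inv_mul_le_iff₀ (by positivity)] at h1
    exact h1

theorem abs_apply_le_norm (u : EuclideanSpace ℝ (Fin d)) (i : Fin d) : |u i| ≤ ‖u‖ :=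
  PiLp.norm_apply_le u i

theorem IsEdgeLaw.integral_inner (h : IsEdgeLaw μ ν p C δ) (e : BlockPair r)
    (D : Matrix (Fin d) (Fin d) ℝ) :
    ∫ u, inner ℝ (toEuclideanCLM (n := Fin d) (𝕜 := ℝ) D u) u ∂(ν e) = D.trace / d := by
  have hint : ∀ i j : Fin d, Integrable (fun u : EuclideanSpace ℝ (Fin d) => D i j * (u i * u j)) (ν e) := by
    intro i j
    refine Integrable.const_mul (Integrable.of_bound
      (by fun_prop : Continuous fun u : EuclideanSpace ℝ (Fin d) => u i * u j).aestronglyMeasurable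
      (C * C) ?_) _
    filter_upwards [h.norm_le e] with u hu
    rw [norm_mul]
    exact mul_le_mul ((abs_apply_le_norm u i).trans hu) ((abs_apply_le_norm u j).trans hu)
      (norm_nonneg _) ((norm_nonneg _).trans hu)
  simp_rw [inner_toEuclideanCLM_self]
  rw [integral_finsetSum _ fun i _ => integrable_finsetSum _ fun j _ => hint i j]
  simp_rw [fun i => integral_finsetSum Finset.univ fun j _ => hint i j, integral_const_mul,
    h.isotropic]
  simp [Matrix.trace, div_eq_mul_inv, Finset.sum_mul]

theorem IsEdgeLaw.integral_sq_form_sub_le (h : IsEdgeLaw μ ν p C δ) (hδ : 0 ≤ δ) (e : BlockPair r)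
    (D : Matrix (Fin d) (Fin d) ℝ) {κ : ℝ} (hD : ‖toEuclideanCLM (n := Fin d) (𝕜 := ℝ) D‖ ≤ κ) :
    ∫ u, (inner ℝ (toEuclideanCLM (n := Fin d) (𝕜 := ℝ) D u) u - D.trace / d) ^ 2 ∂(ν e) ≤
      κ ^ 2 * δ := by
  have hc : Continuous fun u : EuclideanSpace ℝ (Fin d) =>
      (inner ℝ (toEuclideanCLM (n := Fin d) (𝕜 := ℝ) D u) u : ℝ) := by fun_prop
  have h1 := variance_eq_integral (μ := ν e) hc.measurable.aemeasurable
  rw [h.integral_inner] at h1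
  rw [← h1]
  refine (h.variance_le_mul_sq e D).trans ?_
  gcongr

theorem norm_sq_eq_re_im (w : ℂ) : ‖w‖ ^ 2 = Complex.reLm w ^ 2 + Complex.imLm w ^ 2 := by
  rw [← Complex.normSq_eq_norm_sq, Complex.normSq_apply]
  simp [sq]

theorem removedForm_update (z : ℂ) (e : BlockPair r) (k l : Fin r) (x : EdgeConfig r d)
    (y : ℝ × EuclideanSpace ℝ (Fin d)) : removedForm z e k l (Function.update x e y) =
      blockVec k y.2 ⬝ᵥ (configRes z (Function.update x e 0) *ᵥ blockVec l y.2) := by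
  simp [removedForm]

theorem norm_removedForm_le {z : ℂ} (hz : z.im ≠ 0) (e : BlockPair r) (k l : Fin r)
    {x : EdgeConfig r d} (hx : ‖(x e).2‖ ≤ C) : ‖removedForm z e k l x‖ ≤ C ^ 2 / |z.im| := by
  refine (norm_dotProduct_configRes_le hz _ k l (x e).2).trans ?_
  gcongr

/-- Resample the edge e with the others fixed: isotropy makes the normalised trace the conditional
mean of the form, and δ controls its conditional variance. The factor 2 counts real and imaginary
parts. -/
theorem IsEdgeLaw.integral_sq_removedForm_sub_le (h : IsEdgeLaw μ ν p C δ) (hδ : 0 ≤ δ) {z : ℂ}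
    (hz : z.im ≠ 0) (e : BlockPair r) (k l : Fin r) :
    ∫ x, ‖removedForm z e k l x - blockTrace (configRes z (Function.update x e 0)) k l / d‖ ^ 2
      ∂(configLaw μ ν) ≤ 2 * (|z.im|⁻¹ ^ 2 * δ) := by
  have hone : ∀ φ : ℂ →ₗ[ℝ] ℝ, (∀ w, |φ w| ≤ ‖w‖) →
      Integrable (fun x => φ (removedForm z e k l x -
        blockTrace (configRes z (Function.update x e 0)) k l / d) ^ 2) (configLaw μ ν) ∧
      ∫ x, φ (removedForm z e k l x -
        blockTrace (configRes z (Function.update x e 0)) k l / d) ^ 2 ∂(configLaw μ ν) ≤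
        |z.im|⁻¹ ^ 2 * δ := by
    intro φ hφ
    have hcont : Continuous fun x : EdgeConfig r d => φ (removedForm z e k l x -
        blockTrace (configRes z (Function.update x e 0)) k l / d) ^ 2 :=
      ((LinearMap.continuous_of_finiteDimensional φ).comp ((continuous_removedForm hz e k l).sub
        ((continuous_blockTrace_update hz e k l).div_const _))).pow 2
    have hI : Integrable (fun x => φ (removedForm z e k l x -
        blockTrace (configRes z (Function.update x e 0)) k l / d) ^ 2) (configLaw μ ν) := by
      refine integrable_of_continuous_of_ae_le hcont
        (B := (C ^ 2 / |z.im| + d * |z.im|⁻¹ / d) ^ 2) ?_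
      filter_upwards [h.ae_good e] with x hx
      rw [norm_pow]
      refine pow_le_pow_left₀ (norm_nonneg _) ((hφ _).trans ((norm_sub_le _ _).trans
        (add_le_add (norm_removedForm_le hz e k l hx.2) ?_))) 2
      rw [norm_div, Complex.norm_natCast]
      gcongr
      exact norm_blockTrace_le hz _ k l
    refine ⟨hI, ?_⟩
    unfold configLaw at hI ⊢
    rw [integral_resample (fun e => (μ e).prod (ν e)) e hI]
    have hbound : ∀ x : EdgeConfig r d, ∫ y, φ (removedForm z e k l (Function.update x e y) -
        blockTrace (configRes z (Function.update (Function.update x e y) e 0)) k l / d) ^ 2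
          ∂((μ e).prod (ν e)) ≤ |z.im|⁻¹ ^ 2 * δ := by
      intro x
      set D := realBlock φ z (Function.update x e 0) k l with hD
      have e1 : ∀ y : ℝ × EuclideanSpace ℝ (Fin d),
          φ (removedForm z e k l (Function.update x e y) -
            blockTrace (configRes z (Function.update (Function.update x e y) e 0)) k l / d) ^ 2 =
          (fun _ : ℝ => (1 : ℝ)) y.1 * (fun u =>
            (inner ℝ (toEuclideanCLM (n := Fin d) (𝕜 := ℝ) D u) u - D.trace / d) ^ 2) y.2 := by
        intro y
        have hdiv : ∀ w : ℂ, φ (w / d) = φ w / d := by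
          intro w
          have : w / (d : ℂ) = ((d : ℝ)⁻¹) • w := by
            rw [Complex.real_smul]; push_cast; rw [div_eq_inv_mul]
          rw [this, map_smul, smul_eq_mul, div_eq_inv_mul]
        rw [map_sub, map_removedForm, hdiv, map_blockTrace]
        simp [hD]
      rw [(integral_congr_ae (Eventually.of_forall e1)).trans (integral_prod_mul (μ := μ e)
        (ν := ν e) (fun _ : ℝ => (1 : ℝ)) fun u =>
          (inner ℝ (toEuclideanCLM (n := Fin d) (𝕜 := ℝ) D u) u - D.trace / d) ^ 2)]
      simp only [integral_const, probReal_univ, smul_eq_mul, one_mul]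
      exact h.integral_sq_form_sub_le hδ e D (norm_realBlock_le hφ hz _ k l)
    refine (integral_mono_of_nonneg (Eventually.of_forall fun x => integral_nonneg fun y => sq_nonneg _)
      (integrable_const _) (Eventually.of_forall hbound)).trans ?_
    simp
  obtain ⟨i1, b1⟩ := hone Complex.reLm fun w => Complex.abs_re_le_norm w
  obtain ⟨i2, b2⟩ := hone Complex.imLm fun w => Complex.abs_im_le_norm w
  simp_rw [norm_sq_eq_re_im]
  rw [integral_add i1 i2]
  linarith

end Law

/-! ### Fluctuations of block traces and the mean contribution of an edge. -/

section Law

set_option linter.unusedSectionVars false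

open Matrix

variable {r d : ℕ}

/-- The normalized trace of the `(k, l)` block of the resolvent. -/
noncomputable def normTrace (z : ℂ) (k l : Fin r) (x : EdgeConfig r d) : ℂ :=
  blockTrace (configRes z x) k l / d

theorem continuous_normTrace {z : ℂ} (hz : z.im ≠ 0) (k l : Fin r) :
    Continuous fun x : EdgeConfig r d => normTrace z k l x :=
  (continuous_blockTrace hz k l).div_const _

theorem norm_normTrace_le {z : ℂ} (hz : z.im ≠ 0) (k l : Fin r) (x : EdgeConfig r d) :
    ‖normTrace z k l x‖ ≤ |z.im|⁻¹ := by
  rw [normTrace, norm_div, Complex.norm_natCast]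
  refine div_le_of_le_mul₀ (by positivity) (by positivity) ?_
  rw [mul_comm]
  exact norm_blockTrace_le hz x k l

theorem continuous_normTrace_update {z : ℂ} (hz : z.im ≠ 0) (e : BlockPair r) (k l : Fin r) :
    Continuous fun x : EdgeConfig r d => normTrace z k l (Function.update x e 0) :=
  (continuous_blockTrace_update hz e k l).div_const _

variable (μ : BlockPair r → Measure ℝ) (ν : BlockPair r → Measure (EuclideanSpace ℝ (Fin d)))

/-- The mean of the normalized trace of the `k`-th diagonal block of the resolvent. -/
noncomputable def diagMean (z : ℂ) (k : Fin r) : ℂ := ∫ x, normTrace z k k x ∂(configLaw μ ν)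

/-- The mean deviation of the normalized trace of the `k`-th diagonal block of the resolvent. -/
noncomputable def diagDev (z : ℂ) (k : Fin r) : ℝ :=
  ∫ x, ‖normTrace z k k x - diagMean μ ν z k‖ ∂(configLaw μ ν)

/-- The mean modulus of the normalized trace of the `(k, l)` block of the resolvent. -/
noncomputable def offMean (z : ℂ) (k l : Fin r) : ℝ :=
  ∫ x, ‖normTrace z k l x‖ ∂(configLaw μ ν)

variable {μ ν} [∀ e, IsProbabilityMeasure (μ e)] [∀ e, IsProbabilityMeasure (ν e)] {p C δ : ℝ}

theorem integrable_normTrace {z : ℂ} (hz : z.im ≠ 0) (k l : Fin r) :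
    Integrable (fun x => normTrace z k l x) (configLaw μ ν) :=
  integrable_of_continuous_of_ae_le (continuous_normTrace hz k l)
    (Eventually.of_forall (norm_normTrace_le hz k l))

theorem norm_diagMean_le {z : ℂ} (hz : z.im ≠ 0) (k : Fin r) : ‖diagMean μ ν z k‖ ≤ |z.im|⁻¹ := by
  refine (norm_integral_le_of_norm_le_const (Eventually.of_forall (norm_normTrace_le hz k k))).trans ?_
  simp

theorem IsEdgeLaw.integral_edge (h : IsEdgeLaw μ ν p C δ) (e : BlockPair r) :
    ∫ x, (x e).1 ∂(configLaw μ ν) = p := by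
  have hI : Integrable (fun x : EdgeConfig r d => (x e).1 * 1) (configLaw μ ν) := by
    refine integrable_of_continuous_of_ae_le (by fun_prop) (B := 1) ?_
    filter_upwards [h.ae_good e] with x hx
    rcases hx.1 with h0 | h0 <;> simp [h0]
  have := integral_edge_mul (f := fun _ => (1 : ℝ)) (integrable_const _) e hI (h.mean e)
    fun _ _ _ => rfl
  simpa using this

/-- Efron–Stein for the real and imaginary parts, compared with the trace after removal of the edge.
-/
theorem integral_sq_dev_le_sum {z : ℂ} (hz : z.im ≠ 0) (k : Fin r) :
    ∫ x, ‖normTrace z k k x - diagMean μ ν z k‖ ^ 2 ∂(configLaw μ ν) ≤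
      ∑ e, ∫ x, ‖normTrace z k k x - normTrace z k k (Function.update x e 0)‖ ^ 2
        ∂(configLaw μ ν) := by
  have hone : ∀ φ : ℂ →ₗ[ℝ] ℝ, (∀ w, |φ w| ≤ ‖w‖) →
      ∫ x, φ (normTrace z k k x - diagMean μ ν z k) ^ 2 ∂(configLaw μ ν) ≤
      ∑ e, ∫ x, φ (normTrace z k k x - normTrace z k k (Function.update x e 0)) ^ 2
        ∂(configLaw μ ν) := by
    intro φ hφ
    have hφc := LinearMap.continuous_of_finiteDimensional φ
    have hmean : φ (diagMean μ ν z k) = ∫ x, φ (normTrace z k k x) ∂(configLaw μ ν) :=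
      ((LinearMap.toContinuousLinearMap φ).integral_comp_comm
        (integrable_normTrace (μ := μ) (ν := ν) hz k k)).symm
    simp_rw [map_sub, hmean]
    unfold configLaw
    refine integral_sq_sub_integral_le_sum (ρ := fun e => (μ e).prod (ν e)) (B := |z.im|⁻¹)
      (f := fun x => φ (normTrace z k k x))
      (h := fun e x => φ (normTrace z k k (Function.update x e 0)))
      (hφc.comp (continuous_normTrace hz k k)).measurable
      (fun x => (hφ _).trans (norm_normTrace_le hz k k x))
      (fun e => (hφc.comp (continuous_normTrace_update hz e k k)).measurable)
      (fun e x => (hφ _).trans (norm_normTrace_le hz k k _)) fun e x y => ?_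
    simp
  have hint : ∀ (φ : ℂ →ₗ[ℝ] ℝ), (∀ w, |φ w| ≤ ‖w‖) → ∀ f : EdgeConfig r d → ℂ, Continuous f →
      (∀ x, ‖f x‖ ≤ |z.im|⁻¹) →
      Integrable (fun x => φ (normTrace z k k x - f x) ^ 2) (configLaw μ ν) := by
    intro φ hφ f hf hfb
    refine integrable_of_continuous_of_ae_le (((LinearMap.continuous_of_finiteDimensional φ).comp
      ((continuous_normTrace hz k k).sub hf)).pow 2) (B := (|z.im|⁻¹ + |z.im|⁻¹) ^ 2)
      (Eventually.of_forall fun x => ?_)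
    rw [norm_pow]
    exact pow_le_pow_left₀ (norm_nonneg _) ((hφ _).trans ((norm_sub_le _ _).trans
      (add_le_add (norm_normTrace_le hz k k x) (hfb x)))) 2
  have hre : ∀ w, |Complex.reLm w| ≤ ‖w‖ := fun w => Complex.abs_re_le_norm w
  have him : ∀ w, |Complex.imLm w| ≤ ‖w‖ := fun w => Complex.abs_im_le_norm w
  simp_rw [norm_sq_eq_re_im]
  rw [integral_add (hint _ hre _ continuous_const fun _ => norm_diagMean_le hz k)
    (hint _ him _ continuous_const fun _ => norm_diagMean_le hz k)]
  simp_rw [fun e => integral_add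
    (hint _ hre _ (continuous_normTrace_update hz e k k) fun _ => norm_normTrace_le hz k k _)
    (hint _ him _ (continuous_normTrace_update hz e k k) fun _ => norm_normTrace_le hz k k _)]
  rw [Finset.sum_add_distrib]
  exact add_le_add (hone _ hre) (hone _ him)

/-- Summing over k before over edges, each of the at most r² edges costs O(p/d²). With κ = rp/d the
average over k is O(κ/d), which vanishes as d → ∞. -/
theorem IsEdgeLaw.sum_integral_sq_dev_le (h : IsEdgeLaw μ ν p C δ) (hp : 0 ≤ p) {z : ℂ}
    (hz : z.im ≠ 0) :
    ∑ k, ∫ x, ‖normTrace z k k x - diagMean μ ν z k‖ ^ 2 ∂(configLaw μ ν) ≤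
      (r : ℝ) ^ 2 * (4 * (C ^ 2 / z.im ^ 2) ^ 2 / d ^ 2 * p) := by
  have hint : ∀ (k : Fin r) (e : BlockPair r), Integrable (fun x =>
      ‖normTrace z k k x - normTrace z k k (Function.update x e 0)‖ ^ 2) (configLaw μ ν) := by
    intro k e
    refine integrable_of_continuous_of_ae_le (((continuous_normTrace hz k k).sub
      (continuous_normTrace_update hz e k k)).norm.pow 2) (B := (|z.im|⁻¹ + |z.im|⁻¹) ^ 2)
      (Eventually.of_forall fun x => ?_)
    rw [norm_pow, norm_norm]
    exact pow_le_pow_left₀ (norm_nonneg _) ((norm_sub_le _ _).trans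
      (add_le_add (norm_normTrace_le hz k k x) (norm_normTrace_le hz k k _))) 2
  have hintE : ∀ e, Integrable (fun x : EdgeConfig r d => (x e).1) (configLaw μ ν) := by
    intro e
    refine integrable_of_continuous_of_ae_le (by fun_prop) (B := 1) ?_
    filter_upwards [h.ae_good e] with x hx
    rcases hx.1 with h0 | h0 <;> simp [h0]
  have hedge : ∀ e : BlockPair r, ∑ k, ∫ x, ‖normTrace z k k x -
      normTrace z k k (Function.update x e 0)‖ ^ 2 ∂(configLaw μ ν) ≤
      4 * (C ^ 2 / z.im ^ 2) ^ 2 / d ^ 2 * p := by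
    intro e
    rw [← integral_finsetSum _ fun k _ => hint k e, ← h.integral_edge e, ← integral_const_mul]
    refine integral_mono_ae (integrable_finsetSum _ fun k _ => hint k e) ((hintE e).const_mul _) ?_
    filter_upwards [h.ae_good e] with x hx
    have h1 := sum_norm_blockTrace_sub_sq_le hz x e
    have h2 : ∀ k, ‖normTrace z k k x - normTrace z k k (Function.update x e 0)‖ ^ 2 =
        ‖blockTrace (configRes z x) k k - blockTrace (configRes z (Function.update x e 0)) k k‖ ^ 2
          / d ^ 2 := by
      intro k
      rw [normTrace, normTrace, ← sub_div, norm_div, Complex.norm_natCast, div_pow]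
    simp_rw [h2]
    rw [← Finset.sum_div, div_mul_eq_mul_div]
    gcongr
    refine h1.trans ?_
    have h3 : (x e).1 ^ 2 = (x e).1 := by rcases hx.1 with h0 | h0 <;> simp [h0]
    have h4 : 0 ≤ (x e).1 := by rcases hx.1 with h0 | h0 <;> simp [h0]
    rw [h3, mul_assoc, mul_assoc, mul_comm (x e).1]
    have h5 := hx.2
    gcongr
  refine (Finset.sum_le_sum fun k _ => integral_sq_dev_le_sum hz k).trans ?_
  rw [Finset.sum_comm]
  refine (Finset.sum_le_sum fun e _ => hedge e).trans ?_
  rw [Finset.sum_const, nsmul_eq_mul]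
  gcongr
  have : Fintype.card (BlockPair r) ≤ r * r := by
    simpa using Fintype.card_subtype_le (fun q : Fin r × Fin r => q.1 < q.2)
  rw [sq, Finset.card_univ]
  exact_mod_cast this

/-- Concentration passes from the form to the removed-edge trace, and restoring the edge costs
O(1/d). It is used with w = 0 for the form across two blocks and with w the mean trace for a form
inside one block. -/
theorem IsEdgeLaw.integral_norm_removedForm_sub_le (h : IsEdgeLaw μ ν p C δ) (hδ : 0 ≤ δ) {z : ℂ}
    (hz : z.im ≠ 0) (e : BlockPair r) (k l : Fin r) (w : ℂ) :
    Integrable (fun x => ‖removedForm z e k l x - w‖) (configLaw μ ν) ∧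
    ∫ x, ‖removedForm z e k l x - w‖ ∂(configLaw μ ν) ≤
      √(2 * (|z.im|⁻¹ ^ 2 * δ)) + 2 * (C ^ 2 / z.im ^ 2) / d +
        ∫ x, ‖normTrace z k l x - w‖ ∂(configLaw μ ν) := by
  have hc0 : Continuous fun x : EdgeConfig r d => removedForm z e k l x -
      normTrace z k l (Function.update x e 0) :=
    (continuous_removedForm hz e k l).sub (continuous_normTrace_update hz e k l)
  have hb0 : ∀ᵐ x ∂(configLaw μ ν), ‖‖removedForm z e k l x -
      normTrace z k l (Function.update x e 0)‖‖ ≤ C ^ 2 / |z.im| + |z.im|⁻¹ := by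
    filter_upwards [h.ae_good e] with x hx
    rw [norm_norm]
    exact (norm_sub_le _ _).trans (add_le_add (norm_removedForm_le hz e k l hx.2)
      (norm_normTrace_le hz k l _))
  have i0 : Integrable (fun x => ‖removedForm z e k l x -
      normTrace z k l (Function.update x e 0)‖) (configLaw μ ν) :=
    integrable_of_continuous_of_ae_le hc0.norm hb0
  have i1 : Integrable (fun x => ‖removedForm z e k l x - w‖) (configLaw μ ν) := by
    refine integrable_of_continuous_of_ae_le ((continuous_removedForm hz e k l).sub
      continuous_const).norm (B := C ^ 2 / |z.im| + ‖w‖) ?_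
    filter_upwards [h.ae_good e] with x hx
    rw [norm_norm]
    exact (norm_sub_le _ _).trans (by gcongr; exact norm_removedForm_le hz e k l hx.2)
  have i2 : Integrable (fun x => ‖normTrace z k l x - w‖) (configLaw μ ν) :=
    ((integrable_normTrace hz k l).sub (integrable_const w)).norm
  refine ⟨i1, ?_⟩
  have hs : ∫ x, ‖removedForm z e k l x - normTrace z k l (Function.update x e 0)‖
      ∂(configLaw μ ν) ≤ √(2 * (|z.im|⁻¹ ^ 2 * δ)) := by
    refine (integral_le_sqrt_integral_sq hc0.norm.aestronglyMeasurable hb0).trans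
      (Real.sqrt_le_sqrt ?_)
    exact h.integral_sq_removedForm_sub_le hδ hz e k l
  have hpt : ∀ᵐ x ∂(configLaw μ ν), ‖removedForm z e k l x - w‖ ≤
      ‖removedForm z e k l x - normTrace z k l (Function.update x e 0)‖ +
        2 * (C ^ 2 / z.im ^ 2) / d + ‖normTrace z k l x - w‖ := by
    filter_upwards [h.ae_good e] with x hx
    have h1 : ‖normTrace z k l (Function.update x e 0) - normTrace z k l x‖ ≤
        2 * (C ^ 2 / z.im ^ 2) / d := by
      rw [norm_sub_rev, normTrace, normTrace, ← sub_div, norm_div, Complex.norm_natCast]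
      gcongr
      refine (norm_blockTrace_sub_le hz x e k l).trans ?_
      have h3 : |(x e).1| ≤ 1 := by rcases hx.1 with h0 | h0 <;> simp [h0]
      have h5 := hx.2
      calc 2 * |(x e).1| * (‖(x e).2‖ ^ 2 / z.im ^ 2) ≤ 2 * 1 * (C ^ 2 / z.im ^ 2) := by gcongr
        _ = _ := by ring
    have h2 : removedForm z e k l x - w =
        (removedForm z e k l x - normTrace z k l (Function.update x e 0)) +
        (normTrace z k l (Function.update x e 0) - normTrace z k l x) + (normTrace z k l x - w) := by
      ring
    rw [h2]
    exact (norm_add₃_le).trans (by gcongr)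
  have i3 : Integrable (fun x => ‖removedForm z e k l x - normTrace z k l (Function.update x e 0)‖ +
      2 * (C ^ 2 / z.im ^ 2) / d) (configLaw μ ν) := i0.add (integrable_const _)
  refine (integral_mono_ae i1 (i3.add i2) hpt).trans ?_
  simp only [Pi.add_apply]
  rw [integral_add i3 i2, integral_add i0 (integrable_const _)]
  simp only [integral_const, probReal_univ, smul_eq_mul, one_mul]
  gcongr

/-- The error in the edge form depends on e only through its vector, so multiplication by ξ turns
its expectation into p times itself. -/
theorem IsEdgeLaw.norm_integral_edgeForm_add_le (h : IsEdgeLaw μ ν p C δ) (hδ : 0 ≤ δ)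
    (hp : 0 ≤ p) {z : ℂ} (hz : 4 ≤ |z.im|) (hC : C ^ 2 ≤ |z.im| / 4) (e : BlockPair r) :
    Integrable (fun x => ((x e).1 : ℂ) * edgeForm z x e) (configLaw μ ν) ∧
    ‖∫ x, ((x e).1 : ℂ) * edgeForm z x e ∂(configLaw μ ν) +
      p * edgeFun (diagMean μ ν z e.1.1) (diagMean μ ν z e.1.2)‖ ≤
      4 * p * (3 * (√(2 * (|z.im|⁻¹ ^ 2 * δ)) + 2 * (C ^ 2 / z.im ^ 2) / d) +
        diagDev μ ν z e.1.1 + diagDev μ ν z e.1.2 + offMean μ ν z e.1.1 e.1.2) := by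
  have hz0 : z.im ≠ 0 := fun h0 => by rw [h0, abs_zero] at hz; norm_num at hz
  set γ := diagMean μ ν z e.1.1 with hγ
  set γ' := diagMean μ ν z e.1.2 with hγ'
  have hinv : |z.im|⁻¹ ≤ 1 / 4 := by rw [inv_eq_one_div]; gcongr
  have hgγ : ‖γ‖ ≤ 1 / 4 := (norm_diagMean_le hz0 _).trans hinv
  have hgγ' : ‖γ'‖ ≤ 1 / 4 := (norm_diagMean_le hz0 _).trans hinv
  have hgood : ∀ᵐ x ∂(configLaw μ ν), ((x e).1 = 0 ∨ (x e).1 = 1) ∧ ‖(x e).2‖ ^ 2 ≤ |z.im| / 4 ∧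
      |(x e).1| ≤ 1 ∧ 0 ≤ (x e).1 := by
    filter_upwards [h.ae_good e] with x hx
    refine ⟨hx.1, (pow_le_pow_left₀ (norm_nonneg _) hx.2 2).trans hC, ?_, ?_⟩ <;>
      rcases hx.1 with h0 | h0 <;> simp [h0]
  have i1 : Integrable (fun x => ((x e).1 : ℂ) * edgeForm z x e) (configLaw μ ν) := by
    refine integrable_of_continuous_of_ae_le ((by fun_prop :
      Continuous fun x : EdgeConfig r d => ((x e).1 : ℂ)).mul (continuous_edgeForm hz0 e))
      (B := 1 * (1 / 4)) ?_
    filter_upwards [hgood] with x hx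
    rw [norm_mul, Complex.norm_real]
    refine mul_le_mul hx.2.2.1 ((norm_dotProduct_configRes_le hz0 _ _ _ _).trans ?_)
      (norm_nonneg _) zero_le_one
    rw [div_le_iff₀ (abs_pos.2 hz0)]
    linarith [hx.2.1]
  have iE : Integrable (fun x : EdgeConfig r d => (x e).1) (configLaw μ ν) := by
    refine integrable_of_continuous_of_ae_le (by fun_prop) (B := 1) ?_
    filter_upwards [hgood] with x hx using hx.2.2.1
  have i2 : Integrable (fun x : EdgeConfig r d => ((x e).1 : ℂ) * edgeFun γ γ') (configLaw μ ν) :=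
    iE.ofReal.mul_const _
  refine ⟨i1, ?_⟩
  obtain ⟨j1, b1⟩ := h.integral_norm_removedForm_sub_le hδ hz0 e e.1.1 e.1.2 0
  obtain ⟨j2, b2⟩ := h.integral_norm_removedForm_sub_le hδ hz0 e e.1.1 e.1.1 γ
  obtain ⟨j3, b3⟩ := h.integral_norm_removedForm_sub_le hδ hz0 e e.1.2 e.1.2 γ'
  simp only [sub_zero] at j1 b1
  have e1 : (p : ℂ) * edgeFun γ γ' = ∫ x, ((x e).1 : ℂ) * edgeFun γ γ' ∂(configLaw μ ν) := by
    have h1 := integral_complex_ofReal (μ := configLaw μ ν) (f := fun x : EdgeConfig r d => (x e).1)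
    rw [h.integral_edge e] at h1
    rw [integral_mul_const, h1]
  set F : EdgeConfig r d → ℝ := fun x => ‖removedForm z e e.1.1 e.1.2 x‖ +
    ‖removedForm z e e.1.1 e.1.1 x - γ‖ + ‖removedForm z e e.1.2 e.1.2 x - γ'‖ with hF
  have jF : Integrable F (configLaw μ ν) := (j1.add j2).add j3
  have jEF : Integrable (fun x => (x e).1 * F x) (configLaw μ ν) := by
    refine jF.bdd_mul (c := 1) (by fun_prop : Continuous fun x : EdgeConfig r d => (x e).1).aestronglyMeasurable ?_
    filter_upwards [hgood] with x hx using hx.2.2.1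
  have hEF := integral_edge_mul jF e jEF (h.mean e) (fun x t u => by
    simp only [hF, removedForm_update])
  rw [e1, ← integral_add i1 i2]
  have hle : ‖∫ x, ((x e).1 : ℂ) * edgeForm z x e + ((x e).1 : ℂ) * edgeFun γ γ' ∂(configLaw μ ν)‖ ≤
      ∫ x, 4 * ((x e).1 * F x) ∂(configLaw μ ν) := by
    refine norm_integral_le_of_norm_le (jEF.const_mul 4) ?_
    filter_upwards [hgood] with x hx
    refine (norm_edgeForm_add_edgeFun_le hz0 x e hx.1 hx.2.1 hgγ hgγ').trans (le_of_eq ?_)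
    simp only [hF]; ring
  refine hle.trans ?_
  rw [integral_const_mul, hEF, ← mul_assoc]
  refine mul_le_mul_of_nonneg_left ?_ (by positivity)
  have hFint : ∫ x, F x ∂(configLaw μ ν) = ∫ x, ‖removedForm z e e.1.1 e.1.2 x‖ ∂(configLaw μ ν) +
      ∫ x, ‖removedForm z e e.1.1 e.1.1 x - γ‖ ∂(configLaw μ ν) +
      ∫ x, ‖removedForm z e e.1.2 e.1.2 x - γ'‖ ∂(configLaw μ ν) := by
    have j12 : Integrable (fun x => ‖removedForm z e e.1.1 e.1.2 x‖ +
      ‖removedForm z e e.1.1 e.1.1 x - γ‖) (configLaw μ ν) := j1.add j2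
    rw [hF, integral_add j12 j3, integral_add j1 j2]
  rw [hFint]
  unfold diagDev offMean
  linarith

end Law

/-! ### Stability of the system for the mean block traces. -/

section Stability

variable {r : ℕ}

/-- In the difference of equations j and k the nonlinear part is at most (κ/2)|γ_j - γ_k|, which |z|
≥ κ + 2 absorbs. This replaces exchangeability of the blocks, which is not assumed. -/
theorem norm_sub_le_of_approx_solution {z : ℂ} {κ : ℝ} (hr : 0 < r) (hκ : 0 ≤ κ)
    (hz : κ + 2 ≤ ‖z‖) {γ : Fin r → ℂ} (hγ : ∀ k, ‖γ k‖ ≤ 1 / 4) {err : Fin r → ℝ}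
    (herr : ∀ k, ‖z * γ k + 1 + κ / r * ∑ l, edgeFun (γ k) (γ l)‖ ≤ err k) (j k : Fin r) :
    ‖γ j - γ k‖ ≤ err j + err k := by
  have hr' : (0 : ℝ) < r := Nat.cast_pos.2 hr
  have h1 : z * (γ j - γ k) = (z * γ j + 1 + κ / r * ∑ l, edgeFun (γ j) (γ l)) -
      (z * γ k + 1 + κ / r * ∑ l, edgeFun (γ k) (γ l)) -
      κ / r * ∑ l, (edgeFun (γ j) (γ l) - edgeFun (γ k) (γ l)) := by
    rw [Finset.sum_sub_distrib]; ring
  have h2 : ‖∑ l, (edgeFun (γ j) (γ l) - edgeFun (γ k) (γ l))‖ ≤ r * (‖γ j - γ k‖ / 2) := by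
    refine (norm_sum_le _ _).trans ((Finset.sum_le_sum fun l _ =>
      norm_edgeFun_sub_le (hγ j) (hγ l) (hγ k) (hγ l)).trans (le_of_eq ?_))
    simp
  have h3 : ‖(κ / r : ℂ) * ∑ l, (edgeFun (γ j) (γ l) - edgeFun (γ k) (γ l))‖ ≤
      κ * (‖γ j - γ k‖ / 2) := by
    rw [norm_mul, norm_div, Complex.norm_real, Complex.norm_natCast, Real.norm_of_nonneg hκ]
    refine (mul_le_mul_of_nonneg_left h2 (by positivity)).trans (le_of_eq ?_)
    field_simp
  have h4 : ‖z‖ * ‖γ j - γ k‖ ≤ err j + err k + κ * (‖γ j - γ k‖ / 2) := by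
    rw [← norm_mul, h1]
    refine (norm_sub_le _ _).trans (add_le_add ((norm_sub_le _ _).trans
      (add_le_add (herr j) (herr k))) h3)
  nlinarith [norm_nonneg (γ j - γ k)]

/-- Average the equations over k and evaluate every `edgeFun` at the mean m instead; by the previous
lemma |m - γ_k| is at most the average error plus `err k`. -/
theorem norm_mean_equation_le {z : ℂ} {κ : ℝ} (hr : 0 < r) (hκ : 0 ≤ κ)
    (hz : κ + 2 ≤ ‖z‖) {γ : Fin r → ℂ} (hγ : ∀ k, ‖γ k‖ ≤ 1 / 4) {err : Fin r → ℝ}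
    (herr : ∀ k, ‖z * γ k + 1 + κ / r * ∑ l, edgeFun (γ k) (γ l)‖ ≤ err k) :
    ‖z * ((∑ k, γ k) / r) + 1 + κ * edgeFun ((∑ k, γ k) / r) ((∑ k, γ k) / r)‖ ≤
      (1 + 2 * κ) * ((∑ k, err k) / r) := by
  have hr' : (0 : ℝ) < r := Nat.cast_pos.2 hr
  have hrC : (r : ℂ) ≠ 0 := by exact_mod_cast hr.ne'
  set m := (∑ k, γ k) / (r : ℂ) with hm
  set S := ∑ k, err k with hS
  have hmn : ‖m‖ ≤ 1 / 4 := by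
    rw [hm, norm_div, Complex.norm_natCast, div_le_iff₀ hr']
    refine (norm_sum_le _ _).trans ((Finset.sum_le_sum fun k _ => hγ k).trans (le_of_eq ?_))
    simp [mul_comm]
  have hdev : ∀ k, ‖m - γ k‖ ≤ S / r + err k := by
    intro k
    have h1 : m - γ k = (∑ j, (γ j - γ k)) / r := by
      rw [hm, Finset.sum_sub_distrib, sub_div]
      simp [hrC]
    rw [h1, norm_div, Complex.norm_natCast, div_le_iff₀ hr']
    refine (norm_sum_le _ _).trans ((Finset.sum_le_sum fun j _ =>
      norm_sub_le_of_approx_solution hr hκ hz hγ herr j k).trans (le_of_eq ?_))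
    rw [Finset.sum_add_distrib, ← hS]
    simp
    field_simp
  have hid : (z * m + 1 + κ * edgeFun m m) = (∑ k, ((z * γ k + 1 + κ / r * ∑ l, edgeFun (γ k) (γ l)) +
      κ / r * ∑ l, (edgeFun m m - edgeFun (γ k) (γ l)))) / r := by
    have h1 : ∀ k, (z * γ k + 1 + κ / r * ∑ l, edgeFun (γ k) (γ l)) +
      κ / r * ∑ l, (edgeFun m m - edgeFun (γ k) (γ l)) = z * γ k + (1 + κ * edgeFun m m) := by
      intro k
      rw [Finset.sum_sub_distrib]
      simp only [Finset.sum_const, Finset.card_univ, Fintype.card_fin, nsmul_eq_mul]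
      field_simp
      ring
    simp_rw [h1]
    rw [Finset.sum_add_distrib, ← Finset.mul_sum, add_div, mul_div_assoc, ← hm]
    simp only [Finset.sum_const, Finset.card_univ, Fintype.card_fin, nsmul_eq_mul]
    field_simp
    ring
  rw [hid, norm_div, Complex.norm_natCast, div_le_iff₀ hr']
  have hterm : ∀ k, ‖(z * γ k + 1 + κ / r * ∑ l, edgeFun (γ k) (γ l)) +
      κ / r * ∑ l, (edgeFun m m - edgeFun (γ k) (γ l))‖ ≤
      err k + κ * (S / r + err k / 2 + S / r / 2) := by
    intro k
    refine (norm_add_le _ _).trans (add_le_add (herr k) ?_)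
    rw [norm_mul, norm_div, Complex.norm_real, Complex.norm_natCast, Real.norm_of_nonneg hκ,
      div_mul_eq_mul_div, div_le_iff₀ hr', mul_assoc]
    refine mul_le_mul_of_nonneg_left ?_ hκ
    refine (norm_sum_le _ _).trans ((Finset.sum_le_sum fun l _ =>
      (norm_edgeFun_sub_le hmn hmn (hγ k) (hγ l)).trans
        (div_le_div_of_nonneg_right (add_le_add (hdev k) (hdev l)) two_pos.le)).trans (le_of_eq ?_))
    rw [← Finset.sum_div, Finset.sum_add_distrib, Finset.sum_add_distrib, Finset.sum_add_distrib,
      ← hS]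
    simp only [Finset.sum_const, Finset.card_univ, Fintype.card_fin, nsmul_eq_mul]
    field_simp
    ring
  refine (norm_sum_le _ _).trans ((Finset.sum_le_sum fun k _ => hterm k).trans (le_of_eq ?_))
  rw [Finset.sum_add_distrib, ← Finset.mul_sum, Finset.sum_add_distrib, Finset.sum_add_distrib,
    ← Finset.sum_div Finset.univ err, ← hS]
  simp only [Finset.sum_const, Finset.card_univ, Fintype.card_fin, nsmul_eq_mul]
  field_simp
  ring

/-- Clearing the denominator, the cubic at m equals (κ - c)m² + (m² - 1)(zm + 1 + κm²/(1 - m²)). -/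
theorem norm_limitCubic_le {c κ : ℝ} {z m : ℂ} (hm : ‖m‖ ≤ 1 / 4) :
    ‖limitCubic c z m‖ ≤ |κ - c| + 2 * ‖z * m + 1 + κ * edgeFun m m‖ := by
  have h1 := le_norm_one_sub_mul hm hm
  have hne : 1 - m * m ≠ 0 := norm_pos_iff.1 (by linarith)
  have hne' : 1 - m ^ 2 ≠ 0 := by rwa [sq]
  have hid : limitCubic c z m = ((κ - c : ℝ) : ℂ) * (m * m) +
      (m * m - 1) * (z * m + 1 + κ * edgeFun m m) := by
    have : (m * m - 1) * edgeFun m m = -(m * m) := by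
      unfold edgeFun
      field_simp
      ring
    unfold limitCubic
    push_cast
    linear_combination (-(κ : ℂ)) * this
  have h2 := norm_mul_le_of_norm_le_quarter hm hm
  rw [hid]
  refine (norm_add_le _ _).trans (add_le_add ?_ ?_)
  · rw [norm_mul, Complex.norm_real, Real.norm_eq_abs]
    exact mul_le_of_le_one_right (abs_nonneg _) (by linarith)
  · rw [norm_mul]
    refine mul_le_mul_of_nonneg_right ?_ (norm_nonneg _)
    refine (norm_sub_le _ _).trans ?_
    rw [norm_one]; linarith

theorem norm_limitCubic_sub_le {c : ℝ} {z s m : ℂ} (hs : ‖s‖ ≤ 1 / 4) (hm : ‖m‖ ≤ 1 / 4) :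
    ‖limitCubic c z s - limitCubic c z m‖ ≤ (2 * ‖z‖ + 1 + |c|) * ‖s - m‖ := by
  have hid : limitCubic c z s - limitCubic c z m =
      (z * (s * s + s * m + m * m - 1) + (1 - (c : ℂ)) * (s + m)) * (s - m) := by
    unfold limitCubic; ring
  rw [hid, norm_mul]
  refine mul_le_mul_of_nonneg_right ?_ (norm_nonneg _)
  have h1 := norm_mul_le_of_norm_le_quarter hs hs
  have h2 := norm_mul_le_of_norm_le_quarter hs hm
  have h3 := norm_mul_le_of_norm_le_quarter hm hm
  have h4 : ‖s * s + s * m + m * m - 1‖ ≤ 2 := by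
    refine (norm_sub_le _ _).trans ?_
    have := norm_add₃_le (a := s * s) (b := s * m) (c := m * m)
    rw [norm_one]; linarith
  have h5 : ‖s + m‖ ≤ 1 := (norm_add_le _ _).trans (by linarith)
  have h6 : ‖1 - (c : ℂ)‖ ≤ 1 + |c| := by
    refine (norm_sub_le _ _).trans ?_
    rw [norm_one, Complex.norm_real, Real.norm_eq_abs]
  refine (norm_add_le _ _).trans ?_
  rw [norm_mul, norm_mul]
  have h7 := mul_le_mul_of_nonneg_left h4 (norm_nonneg z)
  have h8 := mul_le_mul h6 h5 (norm_nonneg _) (by positivity)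
  linarith

end Stability

/-! ### The cubic for the random normalised trace, up to a small mean error. -/

section Law

set_option linter.unusedSectionVars false

variable {r d : ℕ} {μ : BlockPair r → Measure ℝ} {ν : BlockPair r → Measure (EuclideanSpace ℝ (Fin d))}
  [∀ e, IsProbabilityMeasure (μ e)] [∀ e, IsProbabilityMeasure (ν e)] {p C δ : ℝ}

theorem normTrace_comm (z : ℂ) (k l : Fin r) (x : EdgeConfig r d) :
    normTrace z k l x = normTrace z l k x := by
  unfold normTrace blockTrace
  simp_rw [configRes_apply_comm z x (k, _)]

theorem offMean_comm (z : ℂ) (k l : Fin r) : offMean μ ν z k l = offMean μ ν z l k := by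
  unfold offMean
  simp_rw [normTrace_comm z k l]

theorem diagDev_nonneg (z : ℂ) (k : Fin r) : 0 ≤ diagDev μ ν z k :=
  integral_nonneg fun _ => norm_nonneg _

theorem offMean_nonneg (z : ℂ) (k l : Fin r) : 0 ≤ offMean μ ν z k l :=
  integral_nonneg fun _ => norm_nonneg _

theorem IsEdgeLaw.norm_diag_equation_le (h : IsEdgeLaw μ ν p C δ) (hδ : 0 ≤ δ)
    (hp : 0 ≤ p) (hd : 0 < d) {z : ℂ} (hz : 4 ≤ |z.im|) (hC : C ^ 2 ≤ |z.im| / 4) (k : Fin r) :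
    ‖z * diagMean μ ν z k + 1 + (p / d : ℝ) * ∑ l, edgeFun (diagMean μ ν z k) (diagMean μ ν z l)‖ ≤
      (∑ l, (4 * p * (3 * (√(2 * (|z.im|⁻¹ ^ 2 * δ)) + 2 * (C ^ 2 / z.im ^ 2) / d) +
        diagDev μ ν z k + diagDev μ ν z l + offMean μ ν z k l) + if k = l then p else 0)) / d := by
  have hz0 : z.im ≠ 0 := fun h0 => by rw [h0, abs_zero] at hz; norm_num at hz
  have hd' : (0 : ℝ) < d := Nat.cast_pos.2 hd
  have hdC : (d : ℂ) ≠ 0 := by exact_mod_cast hd.ne'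
  have hinv : |z.im|⁻¹ ≤ 1 / 4 := by rw [inv_eq_one_div]; gcongr
  have hγ : ∀ k, ‖diagMean μ ν z k‖ ≤ 1 / 4 := fun k => (norm_diagMean_le hz0 _).trans hinv
  have hε : 0 ≤ √(2 * (|z.im|⁻¹ ^ 2 * δ)) + 2 * (C ^ 2 / z.im ^ 2) / d := by positivity
  have hoff : ∀ l, Integrable (fun x => offTerm z x k l) (configLaw μ ν) ∧
      ‖∫ x, offTerm z x k l ∂(configLaw μ ν) + p * edgeFun (diagMean μ ν z k) (diagMean μ ν z l)‖ ≤
      4 * p * (3 * (√(2 * (|z.im|⁻¹ ^ 2 * δ)) + 2 * (C ^ 2 / z.im ^ 2) / d) +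
        diagDev μ ν z k + diagDev μ ν z l + offMean μ ν z k l) + if k = l then p else 0 := by
    intro l
    rcases lt_trichotomy k l with hkl | hkl | hkl
    · simp only [offTerm_of_lt z _ hkl, hkl.ne, if_false, add_zero]
      exact h.norm_integral_edgeForm_add_le hδ hp hz hC ⟨(k, l), hkl⟩
    -- The diagonal block of A is zero while the sum of `edgeFun` includes l = k; as |edgeFun| ≤ 1,
    -- completing the sum costs p.
    · subst hkl
      simp only [offTerm_self, integral_zero, zero_add, if_true]
      refine ⟨integrable_zero _ _ _, ?_⟩
      rw [norm_mul, Complex.norm_real, Real.norm_of_nonneg hp]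
      have h1 := mul_le_mul_of_nonneg_left (norm_edgeFun_le (hγ k) (hγ k)) hp
      have h2 := diagDev_nonneg (μ := μ) (ν := ν) z k
      have h3 := offMean_nonneg (μ := μ) (ν := ν) z k k
      have : 0 ≤ 4 * p * (3 * (√(2 * (|z.im|⁻¹ ^ 2 * δ)) + 2 * (C ^ 2 / z.im ^ 2) / d) +
        diagDev μ ν z k + diagDev μ ν z k + offMean μ ν z k k) := by positivity
      linarith
    · simp only [offTerm_of_gt z _ hkl, hkl.ne', if_false, add_zero]
      rw [edgeFun_comm, offMean_comm z k l]
      have := h.norm_integral_edgeForm_add_le hδ hp hz hC ⟨(l, k), hkl⟩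
      refine ⟨this.1, this.2.trans (le_of_eq ?_)⟩
      ring
  have hmean : z * diagMean μ ν z k = -1 + (∑ l, ∫ x, offTerm z x k l ∂(configLaw μ ν)) / d := by
    have h1 : ∀ x : EdgeConfig r d, z * normTrace z k k x = -1 + (∑ l, offTerm z x k l) / d := by
      intro x
      rw [normTrace, ← mul_div_assoc, mul_blockTrace_configRes hz0, add_div, neg_div, div_self hdC]
    rw [diagMean, ← integral_const_mul]
    simp_rw [h1]
    rw [integral_add (integrable_const _) ((integrable_finsetSum _ fun l _ => (hoff l).1).div_const _),
      integral_div, integral_finsetSum _ fun l _ => (hoff l).1]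
    simp
  have hid : z * diagMean μ ν z k + 1 +
      (p / d : ℝ) * ∑ l, edgeFun (diagMean μ ν z k) (diagMean μ ν z l) =
      (∑ l, (∫ x, offTerm z x k l ∂(configLaw μ ν) +
        p * edgeFun (diagMean μ ν z k) (diagMean μ ν z l))) / d := by
    rw [hmean, Finset.sum_add_distrib, ← Finset.mul_sum]
    push_cast
    ring
  rw [hid, norm_div, Complex.norm_natCast]
  gcongr
  exact (norm_sum_le _ _).trans (Finset.sum_le_sum fun l _ => (hoff l).2)

theorem IsEdgeLaw.sum_diagDev_le (h : IsEdgeLaw μ ν p C δ) (hp : 0 ≤ p) (hr : 0 < r) {z : ℂ}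
    (hz : z.im ≠ 0) :
    (∑ k, diagDev μ ν z k) / r ≤ √(4 * (C ^ 2 / z.im ^ 2) ^ 2 * (r * p / d) / d) := by
  have hr' : (0 : ℝ) < r := Nat.cast_pos.2 hr
  have h1 : ∀ k, diagDev μ ν z k ^ 2 ≤
      ∫ x, ‖normTrace z k k x - diagMean μ ν z k‖ ^ 2 ∂(configLaw μ ν) := fun k =>
    sq_integral_le_integral_sq (((continuous_normTrace hz k k).sub
      continuous_const).norm.aestronglyMeasurable) (B := |z.im|⁻¹ + |z.im|⁻¹)
      (Eventually.of_forall fun x => by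
        rw [abs_norm]
        exact (norm_sub_le _ _).trans (add_le_add (norm_normTrace_le hz k k x) (norm_diagMean_le hz k)))
  have h2 := (Finset.sum_le_sum fun k _ => h1 k).trans (h.sum_integral_sq_dev_le hp hz)
  have h3 := sq_sum_le_card_mul_sum_sq (s := Finset.univ) (f := fun k => diagDev μ ν z k)
  simp only [Finset.card_univ, Fintype.card_fin] at h3
  have h4 := h3.trans (mul_le_mul_of_nonneg_left h2 hr'.le)
  refine Real.le_sqrt_of_sq_le ?_
  rw [div_pow, div_le_iff₀ (by positivity)]
  refine h4.trans (le_of_eq ?_)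
  ring

theorem sum_offMean_le (hd : 0 < d) (hr : 0 < r) {z : ℂ} (hz : z.im ≠ 0) :
    (∑ k, ∑ l, offMean μ ν z k l) / r ^ 2 ≤ √(1 / z.im ^ 2 / r) := by
  have hr' : (0 : ℝ) < r := Nat.cast_pos.2 hr
  have hd' : (0 : ℝ) < d := Nat.cast_pos.2 hd
  have hint : ∀ k l : Fin r, Integrable (fun x => ‖normTrace z k l x‖ ^ 2) (configLaw μ ν) := by
    intro k l
    refine integrable_of_continuous_of_ae_le ((continuous_normTrace hz k l).norm.pow 2)
      (B := |z.im|⁻¹ ^ 2) (Eventually.of_forall fun x => ?_)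
    rw [norm_pow, norm_norm]
    exact pow_le_pow_left₀ (norm_nonneg _) (norm_normTrace_le hz k l x) 2
  have h1 : ∀ k l, offMean μ ν z k l ^ 2 ≤ ∫ x, ‖normTrace z k l x‖ ^ 2 ∂(configLaw μ ν) :=
    fun k l => sq_integral_le_integral_sq ((continuous_normTrace hz k l).norm.aestronglyMeasurable)
      (B := |z.im|⁻¹) (Eventually.of_forall fun x => by
        rw [abs_norm]; exact norm_normTrace_le hz k l x)
  have h2 : ∑ k, ∑ l, offMean μ ν z k l ^ 2 ≤ r / z.im ^ 2 := by
    refine (Finset.sum_le_sum fun k _ => Finset.sum_le_sum fun l _ => h1 k l).trans ?_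
    simp_rw [fun k => (integral_finsetSum Finset.univ fun l _ => hint k l).symm]
    rw [← integral_finsetSum _ fun k _ => integrable_finsetSum _ fun l _ => hint k l]
    have hpt : ∀ x : EdgeConfig r d, ∑ k, ∑ l, ‖normTrace z k l x‖ ^ 2 ≤ r / z.im ^ 2 := by
      intro x
      have h3 := sum_norm_blockTrace_sq_le hz x
      have h4 : ∀ k l, ‖normTrace z k l x‖ ^ 2 =
          ‖blockTrace (configRes z x) k l‖ ^ 2 / (d : ℝ) ^ 2 := fun k l => by
        rw [normTrace, norm_div, Complex.norm_natCast, div_pow]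
      simp_rw [h4, ← Finset.sum_div]
      rw [div_le_iff₀ (by positivity)]
      refine h3.trans (le_of_eq ?_)
      field_simp
    refine (integral_mono_of_nonneg (Eventually.of_forall fun x => by positivity)
      (integrable_const _) (Eventually.of_forall hpt)).trans ?_
    simp
  have h3 := sq_sum_le_card_mul_sum_sq (s := (Finset.univ : Finset (Fin r × Fin r)))
    (f := fun q => offMean μ ν z q.1 q.2)
  simp only [Finset.card_univ, Fintype.card_prod, Fintype.card_fin, Nat.cast_mul,
    Fintype.sum_prod_type] at h3
  refine Real.le_sqrt_of_sq_le ?_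
  rw [div_pow, div_le_iff₀ (by positivity)]
  refine h3.trans ((mul_le_mul_of_nonneg_left h2 (by positivity)).trans (le_of_eq ?_))
  field_simp

/-- The normalized trace of the resolvent. -/
noncomputable def meanTrace (z : ℂ) (x : EdgeConfig r d) : ℂ := (∑ k, normTrace z k k x) / r

theorem norm_meanTrace_le {z : ℂ} (hz : z.im ≠ 0) (x : EdgeConfig r d) :
    ‖meanTrace z x‖ ≤ |z.im|⁻¹ := by
  rw [meanTrace, norm_div, Complex.norm_natCast]
  refine div_le_of_le_mul₀ (by positivity) (by positivity) ((norm_sum_le _ _).trans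
    ((Finset.sum_le_sum fun k _ => norm_normTrace_le hz k k x).trans (le_of_eq ?_)))
  simp [mul_comm]

theorem continuous_meanTrace {z : ℂ} (hz : z.im ≠ 0) :
    Continuous fun x : EdgeConfig r d => meanTrace z x :=
  (continuous_finsetSum _ fun k _ => continuous_normTrace hz k k).div_const _

/-- The error in the limiting equation, in terms of the dimensions, the sparsity `κ = r p / d` and
the fluctuation `δ` of the quadratic forms. -/
noncomputable def cubicError (C c : ℝ) (z : ℂ) (κ r d δ : ℝ) : ℝ :=
  (2 * ‖z‖ + 1 + |c|) * √(4 * (C ^ 2 / z.im ^ 2) ^ 2 * κ / d) + (|κ - c| + 2 * ((1 + 2 * κ) *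
    (4 * κ * (3 * (√(2 * (|z.im|⁻¹ ^ 2 * δ)) + 2 * (C ^ 2 / z.im ^ 2) / d) +
      2 * √(4 * (C ^ 2 / z.im ^ 2) ^ 2 * κ / d) + √(1 / z.im ^ 2 / r)) + κ / r)))

/-- The bounds used for deviations and off-diagonal traces control averages over k and over (k, l),
not single rows; averages are all that the mean equation requires. The Lipschitz bound on the cubic
then passes from the mean m to the random trace. -/
theorem IsEdgeLaw.integral_norm_limitCubic_le (h : IsEdgeLaw μ ν p C δ) (hδ : 0 ≤ δ) (hp : 0 ≤ p)
    (hr : 0 < r) (hd : 0 < d) {z : ℂ} (hz : 4 ≤ |z.im|) (hC : C ^ 2 ≤ |z.im| / 4)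
    (hκ : r * p / d + 2 ≤ |z.im|) (c : ℝ) :
    ∫ x, ‖limitCubic c z (meanTrace z x)‖ ∂(configLaw μ ν) ≤
      cubicError C c z (r * p / d) r d δ := by
  have hz0 : z.im ≠ 0 := fun h0 => by rw [h0, abs_zero] at hz; norm_num at hz
  have hd' : (0 : ℝ) < d := Nat.cast_pos.2 hd
  have hr' : (0 : ℝ) < r := Nat.cast_pos.2 hr
  have hrC : (r : ℂ) ≠ 0 := by exact_mod_cast hr.ne'
  have hinv : |z.im|⁻¹ ≤ 1 / 4 := by rw [inv_eq_one_div]; gcongr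
  have hγ : ∀ k, ‖diagMean μ ν z k‖ ≤ 1 / 4 := fun k => (norm_diagMean_le hz0 _).trans hinv
  set κ : ℝ := r * p / d with hκdef
  have hκ0 : 0 ≤ κ := by positivity
  set ε := √(2 * (|z.im|⁻¹ ^ 2 * δ)) + 2 * (C ^ 2 / z.im ^ 2) / d with hε
  set m := (∑ k, diagMean μ ν z k) / (r : ℂ) with hm
  have hmn : ‖m‖ ≤ 1 / 4 := by
    rw [hm, norm_div, Complex.norm_natCast, div_le_iff₀ hr']
    refine (norm_sum_le _ _).trans ((Finset.sum_le_sum fun k _ => hγ k).trans (le_of_eq ?_))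
    simp [mul_comm]
  have hpd : ((p / d : ℝ) : ℂ) = (κ : ℂ) / r := by
    rw [hκdef]; push_cast; field_simp
  have herr := fun k => h.norm_diag_equation_le hδ hp hd hz hC k
  simp_rw [hpd] at herr
  have heq := norm_mean_equation_le hr hκ0 (hκ.trans (Complex.abs_im_le_norm z)) hγ herr
  rw [← hm] at heq
  have hσ := h.sum_diagDev_le hp hr hz0
  have hτ := sum_offMean_le (μ := μ) (ν := ν) hd hr hz0
  rw [← hκdef] at hσ
  set σ := (∑ k, diagDev μ ν z k) / (r : ℝ) with hσdef
  set τ := (∑ k, ∑ l, offMean μ ν z k l) / (r : ℝ) ^ 2 with hτdef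
  -- Averaging over rows turns rp/d into κ, and the r diagonal terms p contribute only κ/r.
  have hsum : (∑ k, (∑ l, (4 * p * (3 * ε + diagDev μ ν z k + diagDev μ ν z l + offMean μ ν z k l) +
      if k = l then p else 0)) / (d : ℝ)) / r = 4 * κ * (3 * ε + 2 * σ + τ) + κ / r := by
    have hA : ∑ k, diagDev μ ν z k = r * σ := by rw [hσdef]; field_simp
    have hB : ∑ k, ∑ l, offMean μ ν z k l = r ^ 2 * τ := by rw [hτdef]; field_simp
    simp only [Finset.sum_add_distrib, ← Finset.mul_sum, ← Finset.sum_div, Finset.sum_ite_eq,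
      Finset.mem_univ, if_true, Finset.sum_const, Finset.card_univ, Fintype.card_fin, nsmul_eq_mul,
      hA, hB]
    rw [hκdef]
    field_simp
    ring
  rw [hsum] at heq
  have hcub := norm_limitCubic_le (c := c) (κ := κ) (z := z) hmn
  have hdev : ∫ x, ‖meanTrace z x - m‖ ∂(configLaw μ ν) ≤ σ := by
    have hi : ∀ k : Fin r, Integrable (fun x => ‖normTrace z k k x - diagMean μ ν z k‖)
        (configLaw μ ν) := fun k =>
      ((integrable_normTrace hz0 k k).sub (integrable_const _)).norm
    rw [hσdef]
    unfold diagDev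
    rw [← integral_finsetSum _ fun k _ => hi k, ← integral_div]
    refine integral_mono_of_nonneg (Eventually.of_forall fun x => norm_nonneg _)
      ((integrable_finsetSum _ fun k _ => hi k).div_const _) (Eventually.of_forall fun x => ?_)
    have e1 : meanTrace z x - m = (∑ k, (normTrace z k k x - diagMean μ ν z k)) / r := by
      rw [meanTrace, hm, Finset.sum_sub_distrib, sub_div]
    simp only [e1]
    rw [norm_div, Complex.norm_natCast]
    gcongr
    exact norm_sum_le _ _
  have hiD : Integrable (fun x => ‖meanTrace z x - m‖) (configLaw μ ν) := by
    refine integrable_of_continuous_of_ae_le ((continuous_meanTrace hz0).sub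
      continuous_const).norm (B := |z.im|⁻¹ + ‖m‖) (Eventually.of_forall fun x => ?_)
    rw [norm_norm]
    exact (norm_sub_le _ _).trans (by gcongr; exact norm_meanTrace_le hz0 x)
  have hpt : ∀ x : EdgeConfig r d, ‖limitCubic c z (meanTrace z x)‖ ≤
      (2 * ‖z‖ + 1 + |c|) * ‖meanTrace z x - m‖ + ‖limitCubic c z m‖ := by
    intro x
    have h1 := norm_limitCubic_sub_le (c := c) (z := z) ((norm_meanTrace_le hz0 x).trans hinv) hmn
    have h2 := norm_add_le (limitCubic c z (meanTrace z x) - limitCubic c z m) (limitCubic c z m)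
    rw [sub_add_cancel] at h2
    linarith
  have hfin : ∫ x, ‖limitCubic c z (meanTrace z x)‖ ∂(configLaw μ ν) ≤
      (2 * ‖z‖ + 1 + |c|) * σ + ‖limitCubic c z m‖ := by
    refine (integral_mono_of_nonneg (Eventually.of_forall fun x => norm_nonneg _)
      ((hiD.const_mul _).add (integrable_const _)) (Eventually.of_forall hpt)).trans ?_
    simp only [Pi.add_apply]
    rw [integral_add (hiD.const_mul _) (integrable_const _), integral_const_mul]
    simp only [integral_const, probReal_univ, smul_eq_mul, one_mul]
    gcongr
  refine hfin.trans ?_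
  unfold cubicError
  rw [← hε]
  refine add_le_add (by gcongr) (hcub.trans ?_)
  gcongr
  refine heq.trans ?_
  gcongr

end Law

/-! ### Second moment, and transfer to the original probability space. -/

section Law

set_option linter.unusedSectionVars false

variable {r d : ℕ} {μ : BlockPair r → Measure ℝ} {ν : BlockPair r → Measure (EuclideanSpace ℝ (Fin d))}
  [∀ e, IsProbabilityMeasure (μ e)] [∀ e, IsProbabilityMeasure (ν e)] {p C δ : ℝ}

/-- The second moment of the empirical spectral distribution. -/
noncomputable def secondMoment (x : EdgeConfig r d) : ℝ :=
  ((r : ℝ) * d)⁻¹ * ∑ k, ∑ l, ∑ i, ∑ j, configAdj x (k, i) (l, j) ^ 2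

theorem secondMoment_nonneg (x : EdgeConfig r d) : 0 ≤ secondMoment x := by
  unfold secondMoment; positivity

/-- The sum equals ξ²‖v‖⁴, which is at most ξC⁴ because ξ is 0 or 1. -/
theorem IsEdgeLaw.integral_sq_edge_le (h : IsEdgeLaw μ ν p C δ) (e : BlockPair r) :
    Integrable (fun x => ∑ i, ∑ j, ((x e).1 * (x e).2 i * (x e).2 j) ^ 2) (configLaw μ ν) ∧
    ∫ x, ∑ i, ∑ j, ((x e).1 * (x e).2 i * (x e).2 j) ^ 2 ∂(configLaw μ ν) ≤ p * C ^ 4 := by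
  have hid : ∀ x : EdgeConfig r d, ∑ i, ∑ j, ((x e).1 * (x e).2 i * (x e).2 j) ^ 2 =
      (x e).1 ^ 2 * ‖(x e).2‖ ^ 4 := by
    intro x
    have : ‖(x e).2‖ ^ 4 = (∑ i, (x e).2 i ^ 2) * ∑ i, (x e).2 i ^ 2 := by
      rw [show ‖(x e).2‖ ^ 4 = ‖(x e).2‖ ^ 2 * ‖(x e).2‖ ^ 2 by ring, EuclideanSpace.norm_sq_eq]
      simp
    rw [this, Finset.sum_mul_sum, Finset.mul_sum]
    refine Finset.sum_congr rfl fun i _ => ?_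
    rw [Finset.mul_sum]
    exact Finset.sum_congr rfl fun j _ => by ring
  have hle : ∀ᵐ x ∂(configLaw μ ν), (x e).1 ^ 2 * ‖(x e).2‖ ^ 4 ≤ (x e).1 * C ^ 4 ∧
      0 ≤ (x e).1 ∧ (x e).1 ≤ 1 := by
    filter_upwards [h.ae_good e] with x hx
    have h1 := pow_le_pow_left₀ (norm_nonneg _) hx.2 4
    rcases hx.1 with h0 | h0
    · simp [h0]
    · simp [h0, h1]
  have i1 : Integrable (fun x : EdgeConfig r d => (x e).1 ^ 2 * ‖(x e).2‖ ^ 4) (configLaw μ ν) := by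
    refine integrable_of_continuous_of_ae_le (by fun_prop) (B := C ^ 4) ?_
    filter_upwards [hle] with x hx
    rw [Real.norm_of_nonneg (by positivity)]
    exact hx.1.trans (mul_le_of_le_one_left (by positivity) hx.2.2)
  have i2 : Integrable (fun x : EdgeConfig r d => (x e).1) (configLaw μ ν) := by
    refine integrable_of_continuous_of_ae_le (by fun_prop) (B := 1) ?_
    filter_upwards [hle] with x hx
    rw [Real.norm_of_nonneg hx.2.1]
    exact hx.2.2
  simp_rw [hid]
  refine ⟨i1, (integral_mono_ae i1 (i2.mul_const _) (hle.mono fun x hx => hx.1)).trans ?_⟩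
  rw [integral_mul_const, h.integral_edge e]

/-- The r² blocks cost at most pC⁴ each and the normalisation is 1/(rd). The bound stays finite as κ
→ c and provides tightness. -/
theorem IsEdgeLaw.integral_secondMoment_le (h : IsEdgeLaw μ ν p C δ) (hp : 0 ≤ p) (hr : 0 < r) :
    Integrable secondMoment (configLaw μ ν) ∧
    ∫ x, secondMoment x ∂(configLaw μ ν) ≤ r * p / d * C ^ 4 := by
  have hr' : (0 : ℝ) < r := Nat.cast_pos.2 hr
  have hkl : ∀ k l : Fin r,
      Integrable (fun x => ∑ i, ∑ j, configAdj x (k, i) (l, j) ^ 2) (configLaw μ ν) ∧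
      ∫ x, ∑ i, ∑ j, configAdj x (k, i) (l, j) ^ 2 ∂(configLaw μ ν) ≤ p * C ^ 4 := by
    intro k l
    rcases lt_trichotomy k l with hkl | hkl | hkl
    · simp_rw [configAdj_apply_of_lt _ hkl]
      exact h.integral_sq_edge_le ⟨(k, l), hkl⟩
    · subst hkl
      simp only [configAdj_apply_self]
      refine ⟨by simp, ?_⟩
      simp only [ne_eq, OfNat.ofNat_ne_zero, not_false_eq_true, zero_pow, Finset.sum_const_zero,
        integral_zero]
      positivity
    · simp_rw [configAdj_apply_of_gt _ hkl]
      exact h.integral_sq_edge_le ⟨(l, k), hkl⟩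
  have hi := fun k => integrable_finsetSum Finset.univ fun l _ => (hkl k l).1
  refine ⟨(integrable_finsetSum Finset.univ fun k _ => hi k).const_mul _, ?_⟩
  unfold secondMoment
  rw [integral_const_mul, integral_finsetSum _ fun k _ => hi k]
  simp_rw [fun k => integral_finsetSum Finset.univ fun l _ => (hkl k l).1]
  have hs : ∑ k, ∑ l, ∫ x, ∑ i, ∑ j, configAdj x (k, i) (l, j) ^ 2 ∂(configLaw μ ν) ≤
      r * (r * (p * C ^ 4)) := by
    refine (Finset.sum_le_sum fun k _ => Finset.sum_le_sum fun l _ => (hkl k l).2).trans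
      (le_of_eq ?_)
    simp
  refine (mul_le_mul_of_nonneg_left hs (by positivity)).trans (le_of_eq ?_)
  rw [mul_inv]
  field_simp

theorem stieltjes_empiricalSpectral_configAdj {z : ℂ} (hz : z.im ≠ 0) (x : EdgeConfig r d) :
    stieltjes (empiricalSpectral (configAdj_isHermitian x)) z = meanTrace z x := by
  rw [stieltjes_empiricalSpectral _ hz]
  change _ * (configRes z x).trace = _
  rw [trace_eq_sum_blockTrace, meanTrace]
  simp only [normTrace, ← Finset.sum_div, Fintype.card_prod, Fintype.card_fin, Nat.cast_mul, mul_inv]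
  ring

theorem tailBound_of_secondMoment_le (hr : 0 < r) (hd : 0 < d) {x : EdgeConfig r d} {K : NNReal}
    (h : secondMoment x ≤ K) : TailBound K (empiricalSpectral (configAdj_isHermitian x)) := by
  have : Nonempty (Fin r × Fin d) := ⟨(⟨0, hr⟩, ⟨0, hd⟩)⟩
  refine tailBound_of_lintegral_sq_le ?_
  rw [lintegral_sq_empiricalSpectral]
  have h1 : ((Fintype.card (Fin r × Fin d) : ℝ))⁻¹ * ∑ p, ∑ q, configAdj x p q ^ 2 =
      secondMoment x := by
    unfold secondMoment
    simp only [Fintype.sum_prod_type, Fintype.card_prod, Fintype.card_fin, Nat.cast_mul]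
    congr 1
    exact Finset.sum_congr rfl fun k _ => Finset.sum_comm
  rw [h1]
  exact (ENNReal.ofReal_le_ofReal h).trans (by simp)

/-- Together the three independence assumptions make the pairs (ξ, v) independent over edges, each
with independent components. -/
theorem configLaw_eq_map {Ω : Type*} [MeasurableSpace Ω] {P : Measure Ω} [IsProbabilityMeasure P]
    {ξ : BlockPair r → Ω → ℝ} {v : BlockPair r → Ω → EuclideanSpace ℝ (Fin d)}
    (hξ : ∀ a, Measurable (ξ a)) (hv : ∀ a, Measurable (v a)) (hξi : iIndepFun ξ P)
    (hvi : iIndepFun v P) (hξv : IndepFun (fun ω a => ξ a ω) (fun ω a => v a ω) P) :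
    P.map (fun ω a => (ξ a ω, v a ω)) =
      configLaw (fun a => P.map (ξ a)) (fun a => P.map (v a)) := by
  have i1 : ∀ a, IsProbabilityMeasure (P.map (ξ a)) := fun a =>
    Measure.isProbabilityMeasure_map (hξ a).aemeasurable
  have i2 : ∀ a, IsProbabilityMeasure (P.map (v a)) := fun a =>
    Measure.isProbabilityMeasure_map (hv a).aemeasurable
  have m1 : Measurable fun ω a => ξ a ω := measurable_pi_lambda _ hξ
  have m2 : Measurable fun ω a => v a ω := measurable_pi_lambda _ hv
  have h1 := (iIndepFun_iff_map_fun_eq_pi_map fun a => (hξ a).aemeasurable).1 hξi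
  have h2 := (iIndepFun_iff_map_fun_eq_pi_map fun a => (hv a).aemeasurable).1 hvi
  have h3 := (indepFun_iff_map_prod_eq_prod_map_map m1.aemeasurable m2.aemeasurable).1 hξv
  rw [h1, h2] at h3
  have h4 := (measurePreserving_arrowProdEquivProdArrow ℝ (EuclideanSpace ℝ (Fin d)) (BlockPair r)
    (fun a => P.map (ξ a)) (fun a => P.map (v a))).symm
  have h5 := h4.map_eq
  rw [← h3, Measure.map_map h4.measurable (m1.prodMk m2)] at h5
  exact h5

theorem measure_ge_le_of_map_eq {Ω : Type*} [MeasurableSpace Ω] {P : Measure Ω}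
    {X : Ω → EdgeConfig r d} (hX : Measurable X) (hmap : P.map X = configLaw μ ν)
    {f : EdgeConfig r d → ℝ} (hf : Measurable f) (hf0 : ∀ x, 0 ≤ f x)
    (hfi : Integrable f (configLaw μ ν)) {a b : ℝ} (ha : 0 < a)
    (hb : ∫ x, f x ∂(configLaw μ ν) ≤ b) : P {ω | a ≤ f (X ω)} ≤ ENNReal.ofReal (b / a) := by
  have h1 := mul_meas_ge_le_integral_of_nonneg (Eventually.of_forall hf0) hfi a
  have h2 : P {ω | a ≤ f (X ω)} = configLaw μ ν {x | a ≤ f x} := by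
    rw [← hmap, Measure.map_apply hX (measurableSet_le measurable_const hf)]
    rfl
  rw [h2, ← ofReal_measureReal]
  refine ENNReal.ofReal_le_ofReal ?_
  rw [le_div_iff₀ ha, mul_comm]
  exact h1.trans hb

theorem continuous_secondMoment : Continuous (secondMoment : EdgeConfig r d → ℝ) := by
  unfold secondMoment
  have h := continuous_configAdj (r := r) (d := d)
  refine continuous_const.mul (continuous_finsetSum _ fun k _ => continuous_finsetSum _ fun l _ =>
    continuous_finsetSum _ fun i _ => continuous_finsetSum _ fun j _ => (h.matrix_elem _ _).pow 2)

end Law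

/-! ### Passage to the limit and the theorem. -/

/-- With δ fixed, every term other than the concentration error vanishes. The remainder is of order
√δ, and δ is made small afterwards. -/
theorem tendsto_cubicError {C c : ℝ} {z : ℂ} {p : ℕ → ℝ} {d : ℕ → ℕ} (hd : Tendsto d atTop atTop)
    (hp : Tendsto (fun r : ℕ => (r : ℝ) * p r / (d r : ℝ)) atTop (𝓝 c)) (δ : ℝ) :
    Tendsto (fun r : ℕ => cubicError C c z (r * p r / d r) r (d r) δ) atTop
      (𝓝 (2 * ((1 + 2 * c) * (4 * c * (3 * √(2 * (|z.im|⁻¹ ^ 2 * δ))))))) := by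
  have hdR : Tendsto (fun r => (d r : ℝ)) atTop atTop := tendsto_natCast_atTop_atTop.comp hd
  have hrR : Tendsto (fun r : ℕ => (r : ℝ)) atTop atTop := tendsto_natCast_atTop_atTop
  have t1 : Tendsto (fun r : ℕ => √(4 * (C ^ 2 / z.im ^ 2) ^ 2 * (r * p r / d r) / d r)) atTop
      (𝓝 0) := by
    simpa using ((hp.const_mul (4 * (C ^ 2 / z.im ^ 2) ^ 2)).div_atTop hdR).sqrt
  have t2 : Tendsto (fun r : ℕ => 2 * (C ^ 2 / z.im ^ 2) / d r) atTop (𝓝 0) :=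
    tendsto_const_nhds.div_atTop hdR
  have t3 : Tendsto (fun r : ℕ => √(1 / z.im ^ 2 / r)) atTop (𝓝 0) := by
    have h := ((tendsto_const_nhds (x := 1 / z.im ^ 2)).div_atTop hrR).sqrt
    rwa [Real.sqrt_zero] at h
  have t4 : Tendsto (fun r : ℕ => r * p r / d r / r) atTop (𝓝 0) := hp.div_atTop hrR
  have t5 := (t1.const_mul (2 * ‖z‖ + 1 + |c|)).add (((hp.sub_const c).abs).add
    ((((hp.const_mul 2).const_add 1).mul (((hp.const_mul 4).mul
      ((((t2.const_add (√(2 * (|z.im|⁻¹ ^ 2 * δ)))).const_mul 3).add (t1.const_mul 2)).add t3)).add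
        t4)).const_mul 2))
  unfold cubicError
  simpa using t5

/-- The hypothesis speaks of one sequence of matrices at a time. Choosing, for each r, a matrix that
violates the bound whenever some matrix does makes it uniform over all matrices. -/
theorem ConcentratedForms.eventually_variance_le {Ω : ℕ → Type*} [∀ r, MeasurableSpace (Ω r)]
    {P : ∀ r, Measure (Ω r)} {ι : ℕ → Type*} {d : ℕ → ℕ} (hd : ∀ r, 0 < d r)
    {y : ∀ r, ι r → Ω r → EuclideanSpace ℝ (Fin (d r))} (h : ConcentratedForms P y) {δ : ℝ}
    (hδ : 0 < δ) : ∀ᶠ r in atTop, ∀ D : Matrix (Fin (d r)) (Fin (d r)) ℝ,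
      ‖Matrix.toEuclideanCLM (n := Fin (d r)) (𝕜 := ℝ) D‖ = 1 → ∀ a : ι r,
        variance (fun ω => inner ℝ (Matrix.toEuclideanCLM (n := Fin (d r)) (𝕜 := ℝ) D (y r a ω))
          (y r a ω)) (P r) ≤ δ := by
  have hex : ∀ r, ∃ D : Matrix (Fin (d r)) (Fin (d r)) ℝ,
      ‖Matrix.toEuclideanCLM (n := Fin (d r)) (𝕜 := ℝ) D‖ = 1 ∧
      ((∀ a : ι r, variance (fun ω => inner ℝ (Matrix.toEuclideanCLM (n := Fin (d r)) (𝕜 := ℝ) D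
          (y r a ω)) (y r a ω)) (P r) ≤ δ) →
        ∀ D : Matrix (Fin (d r)) (Fin (d r)) ℝ,
          ‖Matrix.toEuclideanCLM (n := Fin (d r)) (𝕜 := ℝ) D‖ = 1 → ∀ a : ι r,
          variance (fun ω => inner ℝ (Matrix.toEuclideanCLM (n := Fin (d r)) (𝕜 := ℝ) D (y r a ω))
            (y r a ω)) (P r) ≤ δ) := by
    intro r
    by_contra! hcon
    have : Nonempty (Fin (d r)) := ⟨⟨0, hd r⟩⟩
    -- If no such choice existed, testing the identity, of norm one because d > 0, would produce a
    -- violating D, and that D is itself a valid choice.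
    obtain ⟨-, D, hD, a, ha⟩ := hcon 1 (by rw [map_one]; exact norm_one)
    exact absurd ((hcon D hD).1 a) (not_le.2 ha)
  choose D hD hD' using hex
  filter_upwards [h D hD δ hδ] with r hr using hD' r hr

theorem isEdgeLaw_map {Ω : Type*} [MeasurableSpace Ω] {P : Measure Ω} [IsProbabilityMeasure P]
    {r d : ℕ} {ξ : BlockPair r → Ω → ℝ} {v : BlockPair r → Ω → EuclideanSpace ℝ (Fin d)}
    {p C δ : ℝ} (hξ : ∀ a, Measurable (ξ a)) (hv : ∀ a, Measurable (v a))
    (h01 : ∀ a, ∀ᵐ ω ∂P, ξ a ω = 0 ∨ ξ a ω = 1) (hone : ∀ a, P.real {ω | ξ a ω = 1} = p)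
    (hiso : ∀ a (i j : Fin d), ∫ ω, v a ω i * v a ω j ∂P = if i = j then (d : ℝ)⁻¹ else 0)
    (hbd : ∀ a, ∀ᵐ ω ∂P, ‖v a ω‖ ≤ C)
    (hvar : ∀ D : Matrix (Fin d) (Fin d) ℝ,
      ‖Matrix.toEuclideanCLM (n := Fin d) (𝕜 := ℝ) D‖ = 1 → ∀ a,
        variance (fun ω => inner ℝ (Matrix.toEuclideanCLM (n := Fin d) (𝕜 := ℝ) D (v a ω))
          (v a ω)) P ≤ δ) :
    IsEdgeLaw (fun a => P.map (ξ a)) (fun a => P.map (v a)) p C δ where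
  zero_or_one a := by
    rw [ae_map_iff (hξ a).aemeasurable]
    · exact h01 a
    · exact (measurableSet_singleton (0 : ℝ)).union (measurableSet_singleton (1 : ℝ))
  mean a := by
    have h1 : ∀ᵐ ω ∂P, ξ a ω = ({ω | ξ a ω = 1} : Set Ω).indicator 1 ω := by
      filter_upwards [h01 a] with ω hω
      rcases hω with h | h <;> simp [Set.indicator, h]
    have hms : MeasurableSet {ω | ξ a ω = 1} := hξ a (measurableSet_singleton (1 : ℝ))
    rw [integral_map (hξ a).aemeasurable (by fun_prop), integral_congr_ae h1,
      integral_indicator_one hms]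
    exact hone a
  norm_le a := by
    rw [ae_map_iff (hv a).aemeasurable (measurableSet_le (by fun_prop) measurable_const)]
    exact hbd a
  isotropic a i j := by
    rw [integral_map (hv a).aemeasurable
      (by fun_prop : Continuous fun u : EuclideanSpace ℝ (Fin d) => u i * u j).aestronglyMeasurable]
    exact hiso a i j
  variance_le a D hD := by
    rw [variance_map
      (by fun_prop : Continuous fun u : EuclideanSpace ℝ (Fin d) =>
        (inner ℝ (Matrix.toEuclideanCLM (n := Fin d) (𝕜 := ℝ) D u) u : ℝ)).measurable.aemeasurable
      (hv a).aemeasurable]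
    exact hvar D hD a

theorem theoremt
    {Ω : ℕ → Type*} [∀ r, MeasurableSpace (Ω r)]
    (P : ∀ r, Measure (Ω r)) [∀ r, IsProbabilityMeasure (P r)]
    (d : ℕ → ℕ) (hd_pos : ∀ r, 0 < d r) (p : ℕ → ℝ) (c : ℝ) (hc : 0 ≤ c)
    -- the asymptotic regime
    (hd : Tendsto d atTop atTop)
    (hp : Tendsto (fun r : ℕ => (r : ℝ) * p r / (d r : ℝ)) atTop (𝓝 c))
    -- the random variables and vectors, indexed by the pairs `k < l`
    (ξ : ∀ r, BlockPair r → Ω r → ℝ)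
    (v : ∀ r, BlockPair r → Ω r → EuclideanSpace ℝ (Fin (d r)))
    (hξ_meas : ∀ r a, Measurable (ξ r a)) (hv_meas : ∀ r a, Measurable (v r a))
    -- all of them are mutually independent
    (hξ_indep : ∀ r, iIndepFun (ξ r) (P r))
    (hv_indep : ∀ r, iIndepFun (v r) (P r))
    (hξv_indep : ∀ r, IndepFun (fun ω a => ξ r a ω) (fun ω a => v r a ω) (P r))
    -- the `ξ` are Bernoulli variables of parameter `p r`
    (hξ_01 : ∀ r a, ∀ᵐ ω ∂(P r), ξ r a ω = 0 ∨ ξ r a ω = 1)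
    (hξ_one : ∀ r a, (P r).real {ω | ξ r a ω = 1} = p r)
    -- the `v` are normalized and isotropic, have bounded norms and concentrated quadratic forms
    (hv_iso : ∀ r a (i j : Fin (d r)),
      ∫ ω, v r a ω i * v r a ω j ∂(P r) = if i = j then (d r : ℝ)⁻¹ else 0)
    (hv_bdd : ∃ C : ℝ, ∀ r a, ∀ᵐ ω ∂(P r), ‖v r a ω‖ ≤ C)
    (hv_conc : ConcentratedForms P v) :
    ∃ N : Measure ℝ, IsProbabilityMeasure N ∧
      WeakTendstoInProb P
        (fun r ω => empiricalSpectral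
          (blockAdj_isHermitian (fun a => ξ r a ω) (fun a => v r a ω))) N ∧
      (∀ z : ℂ, z.im ≠ 0 →
        z * stieltjes N z ^ 3 + (1 - (c : ℂ)) * stieltjes N z ^ 2 - z * stieltjes N z - 1 = 0) ∧
      ∀ f : ℂ → ℂ, IsStieltjesOfMeasure f →
        (∀ z : ℂ, z.im ≠ 0 → z * f z ^ 3 + (1 - (c : ℂ)) * f z ^ 2 - z * f z - 1 = 0) →
        ∀ z : ℂ, z.im ≠ 0 → f z = stieltjes N z := by
  obtain ⟨C, hC⟩ := hv_bdd
  have hmeas : ∀ r, Measurable fun ω a => (ξ r a ω, v r a ω) := fun r =>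
    measurable_pi_lambda _ fun a => (hξ_meas r a).prodMk (hv_meas r a)
  have hpξ : ∀ r a, IsProbabilityMeasure ((P r).map (ξ r a)) := fun r a =>
    Measure.isProbabilityMeasure_map (hξ_meas r a).aemeasurable
  have hpv : ∀ r a, IsProbabilityMeasure ((P r).map (v r a)) := fun r a =>
    Measure.isProbabilityMeasure_map (hv_meas r a).aemeasurable
  have hmap := fun r => configLaw_eq_map (hξ_meas r) (hv_meas r) (hξ_indep r) (hv_indep r)
    (hξv_indep r)
  have hlaw : ∀ δ : ℝ, 0 < δ → ∀ᶠ r in atTop,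
      IsEdgeLaw (fun a => (P r).map (ξ r a)) (fun a => (P r).map (v r a)) (p r) C δ := by
    intro δ hδ
    filter_upwards [hv_conc.eventually_variance_le hd_pos hδ] with r hr
    exact isEdgeLaw_map (hξ_meas r) (hv_meas r) (hξ_01 r) (hξ_one r) (hv_iso r) (hC r) hr
  -- For r < 2 there are no pairs, and nothing constrains `p r`.
  have hp0 : ∀ᶠ r in atTop, 0 ≤ p r := by
    filter_upwards [eventually_ge_atTop 2] with r hr
    rw [← hξ_one r ⟨(⟨0, by omega⟩, ⟨1, by omega⟩), by simp⟩]
    exact measureReal_nonneg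
  have hκ : ∀ᶠ r : ℕ in atTop, (r : ℝ) * p r / d r ≤ c + 1 := hp.eventually_le_const (by linarith)
  have hr0 : ∀ᶠ r : ℕ in atTop, 0 < r := eventually_gt_atTop 0
  -- Above height 4C² + c + 7 one has |Im z| ≥ 4, C² ≤ |Im z|/4 and, as eventually κ ≤ c + 1, also κ
  -- + 2 ≤ |Im z|.
  obtain ⟨N, hN, hweak, hcub⟩ := exists_weak_limit_of_limitCubic P
    (fun r ω => empiricalSpectral (blockAdj_isHermitian (fun a => ξ r a ω) (fun a => v r a ω)))
    (η := 4 * C ^ 2 + c + 7) hc (by positivity)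
    (by
      filter_upwards [hr0] with r hr ω
      have : Nonempty (Fin r × Fin (d r)) := ⟨(⟨0, hr⟩, ⟨0, hd_pos r⟩)⟩
      exact isProbabilityMeasure_empiricalSpectral _)
    (by
      intro ε hε
      obtain ⟨ε', hε'0, hε'⟩ := ENNReal.lt_iff_exists_nnreal_btwn.1 hε
      have hε'0 : 0 < ε' := by simpa using hε'0
      -- Markov's inequality with mean second moment at most (c + 1)C⁴; the added 1 keeps the
      -- threshold positive.
      refine ⟨Real.toNNReal ((c + 1) * C ^ 4 / ε' + 1), ?_⟩
      filter_upwards [hlaw 1 one_pos, hp0, hκ, hr0] with r h1 h2 h3 h4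
      obtain ⟨hi, hle⟩ := h1.integral_secondMoment_le h2 h4
      have hK : (0 : ℝ) < (c + 1) * C ^ 4 / ε' + 1 := by positivity
      refine (measure_mono ?_).trans ((measure_ge_le_of_map_eq (hmeas r) (hmap r)
        continuous_secondMoment.measurable secondMoment_nonneg hi hK
        (hle.trans (mul_le_mul_of_nonneg_right h3 (by positivity)))).trans ?_)
      · intro ω hω
        by_contra hcon
        refine hω (tailBound_of_secondMoment_le (x := fun a => (ξ r a ω, v r a ω)) h4 (hd_pos r) ?_)
        rw [Real.coe_toNNReal _ hK.le]
        exact (not_le.1 hcon).le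
      · refine le_trans ?_ hε'.le
        rw [← ENNReal.ofReal_coe_nnreal]
        refine ENNReal.ofReal_le_ofReal ?_
        have : (0 : ℝ) < ε' := hε'0
        rw [div_le_iff₀ hK]
        have : (ε' : ℝ) * ((c + 1) * C ^ 4 / ε' + 1) = (c + 1) * C ^ 4 + ε' := by field_simp
        linarith)
    (by
      intro z hz a ha
      have hzpos : 0 < z.im := lt_trans (by positivity) hz
      have habs : |z.im| = z.im := abs_of_pos hzpos
      have hz0 : z.im ≠ 0 := hzpos.ne'
      have hz4 : 4 ≤ |z.im| := by rw [habs]; nlinarith [sq_nonneg C]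
      have hzC : C ^ 2 ≤ |z.im| / 4 := by rw [habs]; linarith
      rw [ENNReal.tendsto_nhds_zero]
      intro ε hε
      obtain ⟨ε', hε'0, hε'⟩ := ENNReal.lt_iff_exists_nnreal_btwn.1 hε
      have hε'0 : (0 : ℝ) < ε' := by simpa using hε'0
      have hlim : Tendsto (fun δ : ℝ => 2 * ((1 + 2 * c) * (4 * c *
          (3 * √(2 * (|z.im|⁻¹ ^ 2 * δ)))))) (𝓝[>] 0) (𝓝 0) := by
        have hcont : Continuous fun δ : ℝ => 2 * ((1 + 2 * c) * (4 * c *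
          (3 * √(2 * (|z.im|⁻¹ ^ 2 * δ))))) := by fun_prop
        have := hcont.tendsto 0
        simp only [mul_zero, Real.sqrt_zero] at this
        exact this.mono_left nhdsWithin_le_nhds
      -- First δ is fixed so that the limiting error lies below a ε'; then r grows, and Markov's
      -- inequality at level a leaves probability at most ε'.
      obtain ⟨δ, hδlt, hδ⟩ := ((hlim.eventually_lt_const (mul_pos ha hε'0)).and
        self_mem_nhdsWithin).exists
      have hδ : 0 < δ := hδ
      filter_upwards [hlaw δ hδ, hp0, hκ, hr0,
        (tendsto_cubicError (C := C) (z := z) hd hp δ).eventually_le_const hδlt] with r h1 h2 h3 h4 h5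
      have hint := h1.integral_norm_limitCubic_le hδ.le h2 h4 (hd_pos r) hz4 hzC
        (by rw [habs]; nlinarith [sq_nonneg C]) c
      have hcont : Continuous fun x : EdgeConfig r (d r) => ‖limitCubic c z (meanTrace z x)‖ :=
        ((continuous_limitCubic c z).comp (continuous_meanTrace hz0)).norm
      have hi : Integrable (fun x => ‖limitCubic c z (meanTrace z x)‖)
          (configLaw (fun a => (P r).map (ξ r a)) (fun a => (P r).map (v r a))) := by
        obtain ⟨B, hB⟩ := ((isCompact_closedBall (0 : ℂ) |z.im|⁻¹).image
          (continuous_limitCubic c z)).isBounded.exists_norm_le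
        refine integrable_of_continuous_of_ae_le hcont (B := B) (Eventually.of_forall fun x => ?_)
        rw [norm_norm]
        exact hB _ ⟨_, by simpa using norm_meanTrace_le hz0 x, rfl⟩
      refine le_trans (le_of_eq ?_) ((measure_ge_le_of_map_eq (hmeas r) (hmap r) hcont.measurable
        (fun x => norm_nonneg _) hi ha (hint.trans h5)).trans ?_)
      · congr 1
        ext ω
        have := stieltjes_empiricalSpectral_configAdj hz0 (fun a => (ξ r a ω, v r a ω))
        simp only [Set.mem_ofPred_eq]
        rw [← this]
        rfl
      · rw [mul_div_cancel_left₀ _ ha.ne', ENNReal.ofReal_coe_nnreal]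
        exact hε'.le)
  exact ⟨N, hN, hweak, hcub, fun f hf hfe z hz => eq_stieltjes_of_limitCubic hc hcub hf hfe hz⟩
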